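/- Let $\Lambda=(\mathbb R/2\pi\mathbb Z)^2$ with Lebesgue measure, and let $\mathcal D'(\Lambda)$ be the space of real distributions on $\Lambda$ with the $\sigma$-algebra generated by the pairings with test functions. For $k\in\mathbb Z^2$ let $\mathbf e_k(x)=\frac1{2\pi}e^{\sqrt{-1}\,k\cdot x}$, and let $\langle u,\mathbf e_k\rangle$ denote the pairing extending the inner product $\int_\Lambda f\bar g\,dx$. For $s\in\mathbb R$ let $H^s=\{u\in\mathcal D'(\Lambda):\|u\|_{H^s}<\infty\}$, where $\|u\|_{H^s}^2=\sum_{k\in\mathbb Z^2}(1+|k|^2)^s|\langle u,\mathbf e_k\rangle|^2$. Let $\mu_0$ be the massive Gaussian free field, i.e. the centered Gaussian probability measure on $\mathcal D'(\Lambda)$ with $$\int\langle\phi,\mathbf e_k\rangle\overline{\langle\phi,\mathbf e_\ell\rangle}\,\mu_0(d\phi)=(1+|k|^2)^{-1}\mathbf 1_{k=\ell},\qquad k,\ell\in\mathbb Z^2.$$ A cut-off is a Borel function $\psi:\mathbb R^2\to[0,1]$ with $\psi(x)=\psi(-x)$ for all $x$, $\psi(0)=1$, $\sup_{x\ne0}|x|^{-\theta}|\psi(x)-1|<\infty$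 for some $\theta\in(0,1)$, and $\sup_x|x|^m|\psi(x)|<\infty$ for some $m\ge4$. For a cut-off $\psi$ and $N\in\mathbb N$ put $$P_N\phi=\sum_{k\in\mathbb Z^2}\psi(2^{-N}k)\langle\phi,\mathbf e_k\rangle\mathbf e_k,\qquad C_N=\frac1{4\pi^2}\sum_{k\in\mathbb Z^2}\frac{\psi(2^{-N}k)^2}{1+|k|^2},\qquad \exp_N^\diamond(\alpha\phi)=\exp\Big(\alpha P_N\phi-\frac{\alpha^2}2C_N\Big).$$ **Theorem 2.2.** Let $|\alpha|<\sqrt{4\pi}$ and $\beta\in(\frac{\alpha^2}{4\pi},1)$. Then there is a random variable $\exp^\diamond(\alpha\,\cdot)\in L^2(\mu_0;H^{-\beta})$ such that the following holds for every cut-off $\psi$. For $\mu_0$-a.e. $\phi$ and every $N$ the series $P_N\phi$ converges absolutely at every point of $\Lambda$, and $\exp_N^\diamond(\alpha\phi)$ is an integrable function belonging to $H^{-\beta}$; moreover $\exp_N^\diamond(\alpha\,\cdot)\in L^2(\mu_0;H^{-\beta})$ for every $N$; and, as $N\to\infty$, $\exp_N^\diamond(\alpha\phi)\to\exp^\diamond(\alpha\phi)$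 in $H^{-\beta}$, both for $\mu_0$-a.e. $\phi$ and in $L^2(\mu_0;H^{-\beta})$. In particular the limit does not depend on the choice of $\psi$. -/

import Mathlib

open MeasureTheory ProbabilityTheory Filter Topology
open scoped ContDiff ENNReal NNReal

namespace WickGFF

noncomputable section

/-- The period `2π` of the torus is positive; this makes the Lebesgue measure available. -/
instance instTwoPiPos : Fact (0 < 2 * Real.pi) := ⟨Real.two_pi_pos⟩

/-- The plane `ℝ²` with its Euclidean norm. -/
abbrev Plane : Type := EuclideanSpace ℝ (Fin 2)

/-- The torus `Λ = (ℝ / 2πℤ)²`. Its `volume` is Lebesgue measure, of total mass `(2π)²`. -/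
abbrev Torus : Type := Fin 2 → AddCircle (2 * Real.pi)

/-- The projection `ℝ² → Λ`. -/
def proj (x : Plane) : Torus := fun i => (x i : AddCircle (2 * Real.pi))

/-- The periodic lift to the plane of a function on the torus. -/
def lift {E : Type*} (f : Torus → E) : Plane → E := fun x => f (proj x)

/-- The real test functions `C^∞(Λ; ℝ)`: functions on the torus with smooth periodic lift. -/
def testFunctions : Submodule ℝ (Torus → ℝ) where
  carrier := {f | ContDiff ℝ ∞ (lift f)}
  add_mem' := by
    intro f g hf hg
    rw [Set.mem_ofPred_eq] at hf hg ⊢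
    exact hf.add hg
  zero_mem' := (contDiff_const : ContDiff ℝ ∞ fun _ : Plane => (0 : ℝ))
  smul_mem' := by
    intro c f hf
    rw [Set.mem_ofPred_eq] at hf ⊢
    exact contDiff_const.smul hf

/-- The real distributions `D'(Λ) = D'(Λ; ℝ)`: linear functionals on `C^∞(Λ; ℝ)` that are continuous
for the Fréchet topology given by the `C^m` norms, that is, bounded by a multiple of one of them. -/
def distributions : Submodule ℝ (Module.Dual ℝ testFunctions) where
  carrier := {u | ∃ (m : ℕ) (C : ℝ), 0 ≤ C ∧ ∀ (f : testFunctions) (B : ℝ),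
    (∀ j ≤ m, ∀ x, ‖iteratedFDeriv ℝ j (lift (f : Torus → ℝ)) x‖ ≤ B) → |u f| ≤ C * B}
  add_mem' := by
    rintro u v ⟨m, C, hC, hu⟩ ⟨n, D, hD, hv⟩
    refine ⟨max m n, C + D, by positivity, fun f B hB => ?_⟩
    have h1 := hu f B fun j hj => hB j (hj.trans (le_max_left _ _))
    have h2 := hv f B fun j hj => hB j (hj.trans (le_max_right _ _))
    have h3 := abs_add_le (u f) (v f)
    rw [LinearMap.add_apply]
    linarith
  zero_mem' := ⟨0, 0, le_rfl, fun f B _ => by simp⟩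
  smul_mem' := by
    rintro c u ⟨m, C, hC, hu⟩
    refine ⟨m, |c| * C, by positivity, fun f B hB => ?_⟩
    rw [LinearMap.smul_apply, smul_eq_mul, abs_mul, mul_assoc]
    exact mul_le_mul_of_nonneg_left (hu f B hB) (abs_nonneg c)

/-- The space `D'(Λ)` as a type. -/
abbrev TorusDistribution : Type := distributions

/-- The pairing of a distribution with a real test function. -/
def pair (u : TorusDistribution) (f : testFunctions) : ℝ := (u : Module.Dual ℝ testFunctions) f

/-- The σ-algebra on `D'(Λ)` generated by the pairings with test functions. -/
instance instMeasurableSpaceDistribution : MeasurableSpace TorusDistribution :=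
  ⨆ f : testFunctions, MeasurableSpace.comap (fun u => pair u f) inferInstance

/-- A frequency `k ∈ ℤ²` seen as a point of the plane. -/
def freq (k : Fin 2 → ℤ) : Plane := WithLp.toLp 2 fun i => (k i : ℝ)

/-- The Fourier mode `𝐞_k(x) = (2π)⁻¹ exp(√-1 k·x)`. -/
def mode (k : Fin 2 → ℤ) (x : Torus) : ℂ :=
  (2 * (Real.pi : ℂ))⁻¹ * ∏ i, fourier (k i) (x i)

theorem mode_proj (k : Fin 2 → ℤ) (x : Plane) :
    mode k (proj x) =
      (2 * (Real.pi : ℂ))⁻¹ * Complex.exp (Complex.I * ((∑ i, (k i : ℝ) * x i : ℝ) : ℂ)) := by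
  have hpi : (Real.pi : ℂ) ≠ 0 := by exact_mod_cast Real.pi_ne_zero
  simp only [mode, proj, fourier_coe_apply, ← Complex.exp_sum]
  congr 2
  push_cast
  rw [Finset.mul_sum]
  refine Finset.sum_congr rfl fun i _ => ?_
  field_simp

theorem contDiff_lift_mode (k : Fin 2 → ℤ) : ContDiff ℝ ∞ (lift (mode k)) := by
  have h : lift (mode k) = fun x : Plane =>
      (2 * (Real.pi : ℂ))⁻¹ * Complex.exp (Complex.I * ((∑ i, (k i : ℝ) * x i : ℝ) : ℂ)) :=
    funext (mode_proj k)
  rw [h]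
  have h0 : ContDiff ℝ ∞ fun x : Plane => ∑ i, (k i : ℝ) * x i :=
    ContDiff.sum fun i _ => by fun_prop
  have h1 : ContDiff ℝ ∞ fun x : Plane => ((∑ i, (k i : ℝ) * x i : ℝ) : ℂ) :=
    Complex.ofRealCLM.contDiff.comp h0
  fun_prop

/-- The real part of a Fourier mode, as a test function. -/
def modeRe (k : Fin 2 → ℤ) : testFunctions :=
  ⟨fun x => (mode k x).re, Complex.reCLM.contDiff.comp (contDiff_lift_mode k)⟩

/-- The imaginary part of a Fourier mode, as a test function. -/
def modeIm (k : Fin 2 → ℤ) : testFunctions :=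
  ⟨fun x => (mode k x).im, Complex.imCLM.contDiff.comp (contDiff_lift_mode k)⟩

/-- The Fourier coefficient `⟨u, 𝐞_k⟩` of a real distribution. The pairing extends the inner product
`∫ f ḡ dx`, hence is conjugate-linear in the second argument. -/
def coeff (u : TorusDistribution) (k : Fin 2 → ℤ) : ℂ :=
  (pair u (modeRe k) : ℂ) - Complex.I * (pair u (modeIm k) : ℂ)

/-- The `H^s` norm `(∑_k (1 + |k|²)^s |⟨u, 𝐞_k⟩|²)^{1/2}` of a distribution, with values in
`[0, ∞]`. -/
def sobolevNorm (s : ℝ) (u : TorusDistribution) : ℝ≥0∞ :=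
  (∑' k : Fin 2 → ℤ, ENNReal.ofReal ((1 + ‖freq k‖ ^ 2) ^ s * ‖coeff u k‖ ^ 2)) ^ (1 / 2 : ℝ)

/-- Membership in the Sobolev space `H^s(Λ)`. -/
def MemSobolev (s : ℝ) (u : TorusDistribution) : Prop := sobolevNorm s u < ⊤

/-- `X` represents an element of `L²(μ; H^s)`. -/
def MemL2Sobolev (μ : Measure TorusDistribution) (s : ℝ)
    (X : TorusDistribution → TorusDistribution) : Prop :=
  AEMeasurable X μ ∧ (∀ᵐ φ ∂μ, MemSobolev s (X φ)) ∧ ∫⁻ φ, sobolevNorm s (X φ) ^ 2 ∂μ < ⊤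

/-- `μ` is the massive Gaussian free field measure: the centered Gaussian measure on `D'(Λ)` with
covariance `(1 - Δ)⁻¹`. Since pairings are linear in the test function, Gaussianity of each of them
is joint Gaussianity of all of them. -/
structure IsMassiveGFF (μ : Measure TorusDistribution) : Prop where
  isProbabilityMeasure : IsProbabilityMeasure μ
  gaussian : ∀ f : testFunctions, ∃ v : ℝ≥0, μ.map (fun φ => pair φ f) = gaussianReal 0 v
  covariance : ∀ k l : Fin 2 → ℤ,
    ∫ φ, coeff φ k * (starRingEnd ℂ) (coeff φ l) ∂μ
      = if k = l then (((1 + ‖freq k‖ ^ 2)⁻¹ : ℝ) : ℂ) else 0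

/-- The admissible cut-off functions on the plane. -/
structure IsCutoff (ψ : Plane → ℝ) : Prop where
  measurable : Measurable ψ
  mem_Icc : ∀ x, 0 ≤ ψ x ∧ ψ x ≤ 1
  even : ∀ x, ψ x = ψ (-x)
  at_zero : ψ 0 = 1
  near_zero : ∃ θ : ℝ, 0 < θ ∧ θ < 1 ∧ ∃ C : ℝ, ∀ x, x ≠ 0 → ‖x‖ ^ (-θ) * |ψ x - 1| ≤ C
  decay : ∃ m : ℝ, 4 ≤ m ∧ ∃ C : ℝ, ∀ x, ‖x‖ ^ m * |ψ x| ≤ C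

/-- The dilated cut-off `ψ_N(k) = ψ(2^{-N} k)`. -/
def cutoffN (ψ : Plane → ℝ) (N : ℕ) (k : Fin 2 → ℤ) : ℝ := ψ (((2 : ℝ) ^ N)⁻¹ • freq k)

/-- The term of index `k` of the Fourier series of `P_N u` at `x`. -/
def truncTerm (ψ : Plane → ℝ) (N : ℕ) (u : TorusDistribution) (x : Torus) (k : Fin 2 → ℤ) : ℂ :=
  (cutoffN ψ N k : ℂ) * coeff u k * mode k x

/-- The function `P_N u = ∑_k ψ(2^{-N} k) ⟨u, 𝐞_k⟩ 𝐞_k`. The sum is real because `ψ` is even and `u`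
is real. -/
def trunc (ψ : Plane → ℝ) (N : ℕ) (u : TorusDistribution) (x : Torus) : ℝ :=
  (∑' k, truncTerm ψ N u x k).re

/-- The constant `C_N = (4π²)⁻¹ ∑_k ψ(2^{-N} k)² / (1 + |k|²)`. -/
def renorm (ψ : Plane → ℝ) (N : ℕ) : ℝ :=
  1 / (4 * Real.pi ^ 2) * ∑' k : Fin 2 → ℤ, cutoffN ψ N k ^ 2 / (1 + ‖freq k‖ ^ 2)

/-- The approximate Wick exponential `exp(α P_N φ - α² C_N / 2)`, a function on the torus. -/
def wickExp (ψ : Plane → ℝ) (α : ℝ) (N : ℕ) (φ : TorusDistribution) (x : Torus) : ℝ :=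
  Real.exp (α * trunc ψ N φ x - α ^ 2 / 2 * renorm ψ N)

theorem continuous_testFunction (f : testFunctions) : Continuous (f : Torus → ℝ) := by
  have hq : IsOpenQuotientMap (Pi.map fun (_ : Fin 2) (t : ℝ) => (t : AddCircle (2 * Real.pi))) :=
    IsOpenQuotientMap.piMap fun _ => QuotientAddGroup.isOpenQuotientMap_mk
  rw [hq.isQuotientMap.continuous_iff]
  have hf : ContDiff ℝ ∞ (lift (f : Torus → ℝ)) := f.2
  exact hf.continuous.comp (PiLp.continuous_toLp 2 fun _ : Fin 2 => ℝ)

theorem proj_surjective : Function.Surjective proj := by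
  intro y
  choose t ht using fun i => QuotientAddGroup.mk_surjective (y i)
  exact ⟨WithLp.toLp 2 t, funext ht⟩

theorem integrable_testFunction_mul (f : testFunctions) {g : Torus → ℝ} (hg : Integrable g) :
    Integrable fun x => (f : Torus → ℝ) x * g x := by
  obtain ⟨C, hC⟩ := isCompact_univ.exists_bound_of_continuousOn
    (continuous_testFunction f).continuousOn
  exact hg.bdd_mul (continuous_testFunction f).aestronglyMeasurable
    (Eventually.of_forall fun x => hC x (Set.mem_univ x))

open Classical in
/-- The distribution `f ↦ ∫ f g dx` given by an integrable function `g` on the torus (and `0` when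
`g` is not integrable). -/
def ofFunction (g : Torus → ℝ) : TorusDistribution :=
  if hg : Integrable g then
    ⟨{ toFun := fun f => ∫ x, (f : Torus → ℝ) x * g x
       map_add' := fun f₁ f₂ => by
        rw [← integral_add (integrable_testFunction_mul f₁ hg) (integrable_testFunction_mul f₂ hg)]
        refine integral_congr_ae (Eventually.of_forall fun x => ?_)
        exact add_mul _ _ _
       map_smul' := fun c f => by
        rw [RingHom.id_apply, smul_eq_mul, ← integral_const_mul]
        refine integral_congr_ae (Eventually.of_forall fun x => ?_)
        exact mul_assoc _ _ _ },
     by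
      refine ⟨0, ∫ x, ‖g x‖, integral_nonneg fun x => norm_nonneg _, fun f B hB => ?_⟩
      have hfB : ∀ x, ‖(f : Torus → ℝ) x‖ ≤ B := by
        intro x
        obtain ⟨y, rfl⟩ := proj_surjective x
        simpa [lift] using hB 0 le_rfl y
      have hc : (∫ x, ‖g x‖) * B = ∫ x, B * ‖g x‖ := by rw [integral_const_mul, mul_comm]
      change ‖∫ x, (f : Torus → ℝ) x * g x‖ ≤ _
      rw [hc]
      refine norm_integral_le_of_norm_le (hg.norm.const_mul B) (Eventually.of_forall fun x => ?_)
      rw [norm_mul]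
      exact mul_le_mul_of_nonneg_right (hfB x) (norm_nonneg _)⟩
  else 0

/-- The approximate Wick exponential as a distribution. -/
def wickExpDist (ψ : Plane → ℝ) (α : ℝ) (N : ℕ) (φ : TorusDistribution) : TorusDistribution :=
  ofFunction (wickExp ψ α N φ)

end

end WickGFF

open WickGFF

/-!
Write `W_a` for the Wick exponential `exp(α φ_a - α² E[φ_a²] / 2)` of the field `φ_a` whose Fourier
multiplier is `a`; the approximations of the theorem are the `W_a` with `a k = ψ(2^{-N} k)`. If `a`
and `b` have finite support, then `φ_a` and `φ_b` are jointly Gaussian, and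
`E[W_a(x) W_b(y)] = exp(α² E[φ_a(x) φ_b(y)])` (`IsMassiveGFF.wick_mul_wick`). Expanding the square,
`E ‖W_a - W_b‖²` in `H^{-β}` is a sum of two integrals over the torus
`∫ S(z) (exp(c C_p(z)) - exp(c C_q(z))) dz`, where `c = α² / (4π²)`, the function `S` has Fourier
coefficients `(1 + |k|²)^{-β}`, and `C_p` has the coefficients `p_k (1 + |k|²)⁻¹`, `p` and `q` being
products of the multipliers `a` and `b`.

The multipliers are arbitrary, so that `C_p` has no useful pointwise bound. The exponential series
of `exp(c C_p)` however has only terms `C_p^n`, whose Fourier coefficients are dominated in absolute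
value by those of `H^n` as soon as the coefficients of `C_p` are dominated by those of a kernel `H`.
Thus all three factors may be replaced by majorants
(`Majorized.norm_integral_exp_sub_le`). The majorants are kernels `∫_ε^1 t^{s-1} Θ_t dt` with the
heat kernel `Θ_t`, for which Poisson summation gives
`Θ_t(z) ≤ (π / t) exp(-|z₀| |z₁| / (2t)) + C`. Hence the kernel of order `s < 1` is essentially
`O((|z₀| |z₁|)^{s-1})`, and the one of order `1`, which majorizes `(1 + |k|²)⁻¹` with a constant
arbitrarily close to `1`, is at most `π log (1 / (|z₀| |z₁|)) + O(1)`. Altogether the integrand is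
`O((|z₀| |z₁|)^{-(1 - β + α² / (4π) + small)})`, which is integrable since `α² / (4π) < β`. Spending
a little of this room on the difference of the exponentials bounds the integral by `K η` whenever
`|a_k - b_k| ≤ η (1 + |k|²)^δ`, with `K` independent of the multipliers and of their supports
(`exists_norm_integral_exp_cov_sub_le`, `IsMassiveGFF.exists_lintegral_sum_wick_sub_le`).

The limit is built from the multipliers `1_{box L}`, which do not involve `ψ`: by the estimate the
Fourier coefficients of their Wick exponentials converge almost surely, and by comparison with
`W_0 = 1` the limits are the coefficients of an `H^{-β}` valued random variable
(`IsMassiveGFF.exists_wick_limit`). For a cut-off `ψ`, the estimate for `a k = 1_{box L} ψ(2^{-N} k)`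
and `b = 1_{box L}` holds with `η = O(2^{-2δN})` by the regularity of `ψ` at the origin; Fatou's
lemma as `L → ∞` turns it into a geometric bound for the distance to the limit
(`IsMassiveGFF.exists_lintegral_wickExpDist_sub_le`), which is summable in `N` and so gives
convergence both in mean square and almost surely.
-/

namespace WickGFF

noncomputable section

/-! ### Characters of the torus and majorants of Fourier series -/

/-- The character `x ↦ exp(√-1 k·x)` of the torus. -/
def char (k : Fin 2 → ℤ) (x : Torus) : ℂ := ∏ i, fourier (k i) (x i)

theorem continuous_char (k : Fin 2 → ℤ) : Continuous (char k) :=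
  continuous_finsetProd _ fun i _ => (fourier (k i)).continuous.comp (continuous_apply i)

theorem norm_char (k : Fin 2 → ℤ) (x : Torus) : ‖char k x‖ = 1 := by
  simp only [char, norm_prod, fourier_apply, Circle.norm_coe, Finset.prod_const_one]

theorem char_zero (x : Torus) : char 0 x = 1 := by
  simp [char]

theorem char_add (k l : Fin 2 → ℤ) (x : Torus) : char (k + l) x = char k x * char l x := by
  simp only [char, ← Finset.prod_mul_distrib, Pi.add_apply, fourier_add]

theorem char_neg (k : Fin 2 → ℤ) (x : Torus) : char (-k) x = (starRingEnd ℂ) (char k x) := by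
  simp only [char, map_prod, Pi.neg_apply, fourier_neg]

theorem char_apply_add (k : Fin 2 → ℤ) (x y : Torus) : char k (x + y) = char k x * char k y := by
  simp only [char, ← Finset.prod_mul_distrib, Pi.add_apply]
  refine Finset.prod_congr rfl fun i _ => ?_
  simp only [fourier_apply, zsmul_add, AddCircle.toCircle_add, Circle.coe_mul]

theorem char_apply_neg (k : Fin 2 → ℤ) (x : Torus) :
    char k (-x) = (starRingEnd ℂ) (char k x) := by
  rw [← char_neg]
  simp only [char, Pi.neg_apply, fourier_apply, zsmul_neg, neg_zsmul]

theorem char_apply_sub (k : Fin 2 → ℤ) (x y : Torus) :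
    char k (x - y) = char k x * (starRingEnd ℂ) (char k y) := by
  rw [sub_eq_add_neg, char_apply_add, char_apply_neg]

theorem integral_fourier (n : ℤ) :
    ∫ x : AddCircle (2 * Real.pi), fourier n x = if n = 0 then 2 * (Real.pi : ℂ) else 0 := by
  split_ifs with h
  · subst h
    simp [AddCircle.measure_univ, Measure.real, Real.pi_pos.le]
  · exact integral_eq_zero_of_add_right_eq_neg (fourier_add_half_inv_index h Real.two_pi_pos)

theorem integral_char (k : Fin 2 → ℤ) :
    ∫ x, char k x = if k = 0 then 4 * (Real.pi : ℂ) ^ 2 else 0 := by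
  have h : ∫ x, char k x = ∏ i, ∫ x : AddCircle (2 * Real.pi), fourier (k i) x :=
    integral_fintype_prod_eq_prod fun i (x : AddCircle (2 * Real.pi)) => fourier (k i) x
  rw [h, Fin.prod_univ_two, integral_fourier, integral_fourier]
  have hk : k = 0 ↔ k 0 = 0 ∧ k 1 = 0 := by simp [funext_iff, Fin.forall_fin_two]
  by_cases h0 : k 0 = 0 <;> by_cases h1 : k 1 = 0 <;> simp [hk, h0, h1]
  ring

/-- `Majorized F G` says that `F` and `G` are absolutely convergent Fourier series, possibly with
repeated frequencies, such that the coefficients of `F` are dominated in absolute value by those of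
`G`. -/
def Majorized (F : Torus → ℂ) (G : Torus → ℝ) : Prop :=
  ∃ (ι : Type) (_ : Countable ι) (κ : ι → Fin 2 → ℤ) (f : ι → ℂ) (g : ι → ℝ), Summable g ∧
    (∀ i, ‖f i‖ ≤ g i) ∧ (∀ x, HasSum (fun i => f i * char (κ i) x) (F x)) ∧
    ∀ x, HasSum (fun i => (g i : ℂ) * char (κ i) x) (G x)

namespace Majorized

variable {F F' : Torus → ℂ} {G G' : Torus → ℝ}

theorem one : Majorized (fun _ => 1) fun _ => 1 := by
  refine ⟨Unit, inferInstance, fun _ => 0, fun _ => 1, fun _ => 1,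
    (hasSum_fintype _).summable, fun _ => by simp, fun x => ?_, fun x => ?_⟩
  · simp [char_zero]
  · simp [char_zero]

theorem mul (h : Majorized F G) (h' : Majorized F' G') :
    Majorized (fun x => F x * F' x) fun x => G x * G' x := by
  obtain ⟨ι, _, κ, f, g, hg, hfg, hF, hG⟩ := h
  obtain ⟨ι', _, κ', f', g', hg', hfg', hF', hG'⟩ := h'
  have h0 : ∀ i, 0 ≤ g i := fun i => (norm_nonneg _).trans (hfg i)
  have h0' : ∀ i, 0 ≤ g' i := fun i => (norm_nonneg _).trans (hfg' i)
  have hs : Summable fun p : ι × ι' => g p.1 * g' p.2 := hg.mul_of_nonneg hg' h0 h0'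
  have key : ∀ (p : ι × ι') (a b : ℂ) (x : Torus), a * char (κ p.1) x * (b * char (κ' p.2) x)
      = a * b * char (κ p.1 + κ' p.2) x := fun p a b x => by rw [char_add]; ring
  refine ⟨ι × ι', inferInstance, fun p => κ p.1 + κ' p.2, fun p => f p.1 * f' p.2,
    fun p => g p.1 * g' p.2, hs, fun p => ?_, fun x => ?_, fun x => ?_⟩
  · rw [norm_mul]
    exact mul_le_mul (hfg _) (hfg' _) (norm_nonneg _) (h0 _)
  · have h1 := (hF x).mul (hF' x) (Summable.of_norm_bounded hs fun p => by
      rw [key, norm_mul, norm_char, mul_one, norm_mul]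
      exact mul_le_mul (hfg _) (hfg' _) (norm_nonneg _) (h0 _))
    simpa only [key] using h1
  · have h1 := (hG x).mul (hG' x) (Summable.of_norm_bounded hs fun p => by
      rw [key, norm_mul, norm_char, mul_one, ← Complex.ofReal_mul, Complex.norm_real,
        Real.norm_of_nonneg (mul_nonneg (h0 _) (h0' _))])
    simpa only [key, Complex.ofReal_mul] using h1

theorem pow (h : Majorized F G) (n : ℕ) : Majorized (fun x => F x ^ n) fun x => G x ^ n := by
  induction n with
  | zero => simpa using one
  | succ n ih => simpa only [pow_succ] using ih.mul h

theorem continuous_left (h : Majorized F G) : Continuous F := by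
  obtain ⟨ι, _, κ, f, g, hg, hfg, hF, hG⟩ := h
  have : F = fun x => ∑' i, f i * char (κ i) x := funext fun x => (hF x).tsum_eq.symm
  rw [this]
  refine continuous_tsum (fun i => continuous_const.mul (continuous_char _)) hg fun i x => ?_
  rw [norm_mul, norm_char, mul_one]
  exact hfg i

theorem self (h : Majorized F G) : Majorized (fun x => (G x : ℂ)) G := by
  obtain ⟨ι, _, κ, f, g, hg, hfg, hF, hG⟩ := h
  refine ⟨ι, inferInstance, κ, fun i => g i, g, hg, fun i => ?_, hG, hG⟩
  rw [Complex.norm_real, Real.norm_of_nonneg ((norm_nonneg _).trans (hfg i))]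

theorem continuous_right (h : Majorized F G) : Continuous G := by
  exact Complex.continuous_re.comp h.self.continuous_left

/-- Integration picks the coefficients of frequency zero, so that it respects majorants although
`|F| ≤ G` may fail pointwise. -/
theorem norm_integral_le (h : Majorized F G) : ‖∫ x, F x‖ ≤ ∫ x, G x := by
  obtain ⟨ι, _, κ, f, g, hg, hfg, hF, hG⟩ := h
  have h0 : ∀ i, 0 ≤ g i := fun i => (norm_nonneg _).trans (hfg i)
  have hV : ∀ a : ℂ, ∀ k, ∫ x, a * char k x = a * if k = 0 then 4 * (Real.pi : ℂ) ^ 2 else 0 :=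
    fun a k => by rw [integral_const_mul, integral_char]
  have key : ∀ (c : ι → ℂ) (H : Torus → ℂ), (∀ i, ‖c i‖ ≤ g i) →
      (∀ x, HasSum (fun i => c i * char (κ i) x) (H x)) →
      HasSum (fun i => c i * if κ i = 0 then 4 * (Real.pi : ℂ) ^ 2 else 0) (∫ x, H x) := by
    intro c H hc hH
    have h1 := hasSum_integral_of_summable_integral_norm (μ := (volume : Measure Torus))
      (F := fun i x => c i * char (κ i) x)
      (fun i => (continuous_const.mul (continuous_char _)).integrable_of_hasCompactSupport
        (HasCompactSupport.of_compactSpace _)) (by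
        simp only [norm_mul, norm_char, mul_one, integral_const, smul_eq_mul]
        exact (Summable.of_nonneg_of_le (fun i => norm_nonneg _) hc hg).mul_left _)
    simp only [hV, (hH _).tsum_eq] at h1
    exact h1
  have hf := key f F hfg hF
  have hg' := key (fun i => g i) (fun x => G x)
    (fun i => by rw [Complex.norm_real, Real.norm_of_nonneg (h0 i)]) hG
  rw [integral_complex_ofReal] at hg'
  have hg2 : HasSum (fun i => g i * if κ i = 0 then 4 * Real.pi ^ 2 else 0) (∫ x, G x) := by
    rw [← Complex.hasSum_ofReal]
    convert hg' using 3 with i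
    push_cast
    split_ifs <;> simp
  refine hf.tsum_eq ▸ tsum_of_norm_bounded hg2 fun i => ?_
  rw [norm_mul]
  refine mul_le_mul (hfg i) ?_ (norm_nonneg _) (h0 i)
  split_ifs
  · simp
  · simp

end Majorized

/-! ### The heat kernel -/

theorem summable_exp_neg_mul_sq {t : ℝ} (ht : 0 < t) :
    Summable fun n : ℤ => Real.exp (-t * (n : ℝ) ^ 2) := by
  have h := (summable_jacobiTheta₂_term_iff 0 (Complex.I * (t / Real.pi : ℝ))).2 (by
    simp [Complex.mul_im]; positivity)
  have h2 := h.norm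
  refine h2.congr fun n => ?_
  rw [norm_jacobiTheta₂_term]
  simp [Complex.mul_im]
  field_simp

/-- The heat kernel of the circle (up to normalisation), defined by its Fourier series. -/
def heatCircle (t : ℝ) (x : AddCircle (2 * Real.pi)) : ℝ :=
  (∑' n : ℤ, (Real.exp (-t * (n : ℝ) ^ 2) : ℂ) * fourier n x).re

theorem summable_heatCircle {t : ℝ} (ht : 0 < t) (x : AddCircle (2 * Real.pi)) :
    Summable fun n : ℤ => ‖(Real.exp (-t * (n : ℝ) ^ 2) : ℂ) * fourier n x‖ := by
  refine (summable_exp_neg_mul_sq ht).congr fun n => ?_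
  rw [norm_mul, Complex.norm_real, fourier_apply, Circle.norm_coe, mul_one,
    Real.norm_of_nonneg (Real.exp_pos _).le]

/-- Poisson summation for the heat kernel of the circle. -/
theorem tsum_heatCircle {t : ℝ} (ht : 0 < t) (y : ℝ) :
    ∑' n : ℤ, (Real.exp (-t * (n : ℝ) ^ 2) : ℂ) * fourier n (y : AddCircle (2 * Real.pi)) =
      ((√(Real.pi / t) * ∑' n : ℤ, Real.exp (-(2 * Real.pi * n - y) ^ 2 / (4 * t)) : ℝ) : ℂ) := by
  have hpi := Real.pi_pos
  have hpi' : (Real.pi : ℂ) ≠ 0 := by exact_mod_cast hpi.ne'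
  have ht' : (t : ℂ) ≠ 0 := by exact_mod_cast ht.ne'
  have h := Complex.tsum_exp_neg_quadratic (a := ((t / Real.pi : ℝ) : ℂ))
    (by rw [Complex.ofReal_re]; positivity) (Complex.I * (y / (2 * Real.pi)))
  convert h using 1
  · refine tsum_congr fun n => ?_
    rw [fourier_coe_apply, Complex.ofReal_exp, ← Complex.exp_add]
    congr 1
    push_cast
    field_simp
  · rw [Complex.ofReal_mul, Complex.ofReal_tsum]
    congr 1
    · rw [show (1 / 2 : ℂ) = ((1 / 2 : ℝ) : ℂ) by norm_num,
        ← Complex.ofReal_cpow (by positivity), ← Real.sqrt_eq_rpow, ← Complex.ofReal_one,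
        ← Complex.ofReal_div, one_div, ← Real.sqrt_inv, inv_div]
    · refine tsum_congr fun n => ?_
      rw [Complex.ofReal_exp]
      congr 1
      push_cast
      rw [← mul_assoc, Complex.I_mul_I]
      field_simp
      ring

theorem ofReal_heatCircle {t : ℝ} (ht : 0 < t) (x : AddCircle (2 * Real.pi)) :
    (heatCircle t x : ℂ) = ∑' n : ℤ, (Real.exp (-t * (n : ℝ) ^ 2) : ℂ) * fourier n x := by
  obtain ⟨y, rfl⟩ := QuotientAddGroup.mk_surjective x
  have h := tsum_heatCircle ht y
  rw [heatCircle]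
  erw [h, Complex.ofReal_re]

theorem hasSum_heatCircle {t : ℝ} (ht : 0 < t) (x : AddCircle (2 * Real.pi)) :
    HasSum (fun n : ℤ => (Real.exp (-t * (n : ℝ) ^ 2) : ℂ) * fourier n x) (heatCircle t x) := by
  rw [ofReal_heatCircle ht]
  exact (summable_heatCircle ht x).of_norm.hasSum

theorem exists_repr (x : AddCircle (2 * Real.pi)) :
    ∃ y : ℝ, (y : AddCircle (2 * Real.pi)) = x ∧ |y| ≤ Real.pi ∧ ‖x‖ = |y| := by
  obtain ⟨y, hy, rfl⟩ := AddCircle.coe_image_Ico_eq (2 * Real.pi) (-Real.pi) ▸ Set.mem_univ x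
  have h : |y| ≤ Real.pi := abs_le.2 ⟨hy.1, by linarith [hy.2]⟩
  refine ⟨y, rfl, h, (AddCircle.norm_coe_eq_abs_iff _ Real.two_pi_pos.ne').2 ?_⟩
  rwa [abs_of_pos Real.two_pi_pos, mul_div_cancel_left₀ _ two_ne_zero]

theorem heatCircle_nonneg {t : ℝ} (ht : 0 < t) (x : AddCircle (2 * Real.pi)) :
    0 ≤ heatCircle t x := by
  obtain ⟨y, rfl, -, -⟩ := exists_repr x
  have h := tsum_heatCircle ht y
  rw [heatCircle, h, Complex.ofReal_re]
  exact mul_nonneg (Real.sqrt_nonneg _) (tsum_nonneg fun n => (Real.exp_pos _).le)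

theorem summable_inv_int_sq : Summable fun n : ℤ => ((n : ℝ) ^ 2)⁻¹ := by
  simpa using (Real.summable_one_div_int_pow (p := 2)).2 one_lt_two

/-- For small times the heat kernel of the circle is a Gaussian up to an error of order `√t`. -/
theorem heatCircle_le {t : ℝ} (ht : 0 < t) (x : AddCircle (2 * Real.pi)) :
    heatCircle t x ≤ √(Real.pi / t) *
      (Real.exp (-‖x‖ ^ 2 / (4 * t)) + (∑' n : ℤ, ((n : ℝ) ^ 2)⁻¹) * t) := by
  obtain ⟨y, rfl, hy, hxy⟩ := exists_repr x
  have h := tsum_heatCircle ht y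
  rw [heatCircle, h, Complex.ofReal_re, hxy]
  refine mul_le_mul_of_nonneg_left ?_ (Real.sqrt_nonneg _)
  have hpi := Real.pi_gt_three
  -- the terms of nonzero index are small since the other representatives are at distance `≥ π`
  have hb : ∀ n : ℤ, Real.exp (-(2 * Real.pi * n - y) ^ 2 / (4 * t)) ≤
      (if n = 0 then Real.exp (-|y| ^ 2 / (4 * t)) else 0) + ((n : ℝ) ^ 2)⁻¹ * t := by
    intro n
    split_ifs with hn
    · subst hn
      simp
    · rw [zero_add]
      have hn1 : 1 ≤ |(n : ℝ)| := by exact_mod_cast Int.one_le_abs hn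
      have h1 : Real.pi * |(n : ℝ)| ≤ |2 * Real.pi * n - y| := by
        have h2 : |2 * Real.pi * n| = 2 * Real.pi * |(n : ℝ)| := by
          rw [abs_mul, abs_of_pos Real.two_pi_pos]
        have h3 := abs_sub_abs_le_abs_sub (2 * Real.pi * n) y
        nlinarith
      have h4 : 4 * (n : ℝ) ^ 2 ≤ (2 * Real.pi * n - y) ^ 2 := by
        have h6 : 2 * |(n : ℝ)| ≤ |2 * Real.pi * n - y| := by nlinarith
        have h7 := pow_le_pow_left₀ (by positivity) h6 2
        rwa [sq_abs, mul_pow, sq_abs, show (2 : ℝ) ^ 2 = 4 by norm_num] at h7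
      have hn2 : 0 < (n : ℝ) ^ 2 := by positivity
      have h5 : (n : ℝ) ^ 2 / t ≤ (2 * Real.pi * n - y) ^ 2 / (4 * t) := by
        rw [div_le_div_iff₀ ht (by positivity)]
        nlinarith
      calc Real.exp (-(2 * Real.pi * n - y) ^ 2 / (4 * t))
          ≤ Real.exp (-((n : ℝ) ^ 2 / t)) := by
            rw [Real.exp_le_exp, neg_div]
            linarith
        _ ≤ ((n : ℝ) ^ 2 / t)⁻¹ := by
            rw [Real.exp_neg]
            exact inv_anti₀ (by positivity) (by linarith [Real.add_one_le_exp ((n : ℝ) ^ 2 / t)])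
        _ = ((n : ℝ) ^ 2)⁻¹ * t := by rw [inv_div]; field_simp
  have hs : HasSum (fun n : ℤ => (if n = 0 then Real.exp (-|y| ^ 2 / (4 * t)) else 0) +
      ((n : ℝ) ^ 2)⁻¹ * t) (Real.exp (-|y| ^ 2 / (4 * t)) + (∑' n : ℤ, ((n : ℝ) ^ 2)⁻¹) * t) :=
    (hasSum_ite_eq 0 _).add (summable_inv_int_sq.hasSum.mul_right t)
  rw [← hs.tsum_eq]
  exact (Summable.of_nonneg_of_le (fun n => (Real.exp_pos _).le) hb hs.summable).tsum_le_tsum hb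
    hs.summable

theorem norm_freq_sq (k : Fin 2 → ℤ) : ‖freq k‖ ^ 2 = (k 0 : ℝ) ^ 2 + (k 1 : ℝ) ^ 2 := by
  simp [freq, EuclideanSpace.norm_sq_eq]

/-- The heat kernel of the torus (up to normalisation). -/
def heat (t : ℝ) (z : Torus) : ℝ := heatCircle t (z 0) * heatCircle t (z 1)

theorem heat_nonneg {t : ℝ} (ht : 0 < t) (z : Torus) : 0 ≤ heat t z :=
  mul_nonneg (heatCircle_nonneg ht _) (heatCircle_nonneg ht _)

theorem hasSum_fin_two_mul {f g : ℤ → ℂ} {a b : ℂ} (hf : HasSum f a) (hg : HasSum g b)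
    (hf' : Summable fun n => ‖f n‖) (hg' : Summable fun n => ‖g n‖) :
    HasSum (fun k : Fin 2 → ℤ => f (k 0) * g (k 1)) (a * b) :=
  (finTwoArrowEquiv ℤ).hasSum_iff.2 (hf.mul hg (summable_mul_of_summable_norm hf' hg'))

theorem hasSum_heat {t : ℝ} (ht : 0 < t) (z : Torus) :
    HasSum (fun k : Fin 2 → ℤ => (Real.exp (-t * ‖freq k‖ ^ 2) : ℂ) * char k z) (heat t z) := by
  have h := hasSum_fin_two_mul (hasSum_heatCircle ht (z 0)) (hasSum_heatCircle ht (z 1))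
    (summable_heatCircle ht _) (summable_heatCircle ht _)
  rw [heat, Complex.ofReal_mul]
  refine h.congr_fun ?_
  intro k
  rw [norm_freq_sq, mul_add, Real.exp_add, Complex.ofReal_mul, char, Fin.prod_univ_two]
  exact mul_mul_mul_comm _ _ _ _

theorem summable_exp_neg_mul_norm_freq_sq {t : ℝ} (ht : 0 < t) :
    Summable fun k : Fin 2 → ℤ => Real.exp (-t * ‖freq k‖ ^ 2) := by
  refine (hasSum_heat ht 0).summable.norm.congr fun k => ?_
  rw [norm_mul, norm_char, mul_one, Complex.norm_real, Real.norm_of_nonneg (Real.exp_pos _).le]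

/-- The heat kernel bound with the sharp constant `π`. The square `|z|²` in the Gaussian is weakened
to `2 |z₀| |z₁|`, so that all singularities below are products of one-dimensional ones. -/
theorem exists_heat_le : ∃ C : ℝ, 0 ≤ C ∧ ∀ (t : ℝ) (z : Torus), 0 < t → t ≤ 1 →
    heat t z ≤ Real.pi / t * Real.exp (-(‖z 0‖ * ‖z 1‖) / (2 * t)) + C := by
  set S := ∑' n : ℤ, ((n : ℝ) ^ 2)⁻¹ with hS
  have hS0 : 0 ≤ S := tsum_nonneg fun n => by positivity
  have hpi := Real.pi_pos
  refine ⟨Real.pi * (2 * S + S ^ 2), by positivity, fun t z ht ht1 => ?_⟩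
  set p := Real.exp (-‖z 0‖ ^ 2 / (4 * t))
  set q := Real.exp (-‖z 1‖ ^ 2 / (4 * t))
  have hp : p ≤ 1 := Real.exp_le_one_iff.2 (by
    rw [neg_div]; exact neg_nonpos.2 (by positivity))
  have hq : q ≤ 1 := Real.exp_le_one_iff.2 (by
    rw [neg_div]; exact neg_nonpos.2 (by positivity))
  have hp0 : 0 < p := Real.exp_pos _
  have hq0 : 0 < q := Real.exp_pos _
  have hpq : p * q ≤ Real.exp (-(‖z 0‖ * ‖z 1‖) / (2 * t)) := by
    rw [← Real.exp_add, Real.exp_le_exp, ← add_div, div_le_div_iff₀ (by positivity) (by positivity)]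
    nlinarith [mul_nonneg ht.le (sq_nonneg (‖z 0‖ - ‖z 1‖))]
  have h1 : heat t z ≤ √(Real.pi / t) * (p + S * t) * (√(Real.pi / t) * (q + S * t)) :=
    mul_le_mul (heatCircle_le ht _) (heatCircle_le ht _) (heatCircle_nonneg ht _) (by positivity)
  have h2 : √(Real.pi / t) * (p + S * t) * (√(Real.pi / t) * (q + S * t))
      = Real.pi / t * (p * q) + Real.pi * (S * (p + q) + S ^ 2 * t) := by
    have h3 : √(Real.pi / t) * √(Real.pi / t) = Real.pi / t := Real.mul_self_sqrt (by positivity)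
    rw [show √(Real.pi / t) * (p + S * t) * (√(Real.pi / t) * (q + S * t))
      = √(Real.pi / t) * √(Real.pi / t) * ((p + S * t) * (q + S * t)) by ring, h3]
    field_simp
    ring
  rw [h2] at h1
  refine h1.trans (add_le_add (mul_le_mul_of_nonneg_left hpq (by positivity))
    (mul_le_mul_of_nonneg_left ?_ hpi.le))
  nlinarith [mul_le_mul_of_nonneg_left ht1 (sq_nonneg S), mul_le_mul_of_nonneg_left hp hS0,
    mul_le_mul_of_nonneg_left hq hS0]

/-! ### Bessel kernels -/

/-- The regularised Bessel kernel `∫_ε^1 t^{s-1} Θ_t(z) dt`, where `Θ_t` is the heat kernel. -/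
def bessel (s ε : ℝ) (z : Torus) : ℝ := ∫ t in Set.Ioc ε 1, t ^ (s - 1) * heat t z

/-- The Fourier coefficients of the regularised Bessel kernel; for small `ε` they are comparable to
`(1 + |k|²)^{-s}`. -/
def besselCoeff (s ε : ℝ) (k : Fin 2 → ℤ) : ℝ :=
  ∫ t in Set.Ioc ε 1, t ^ (s - 1) * Real.exp (-t * ‖freq k‖ ^ 2)

theorem continuousOn_rpow_Icc (s : ℝ) {ε : ℝ} (hε : 0 < ε) :
    ContinuousOn (fun t : ℝ => t ^ (s - 1)) (Set.Icc ε 1) := fun t ht =>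
  (Real.continuousAt_rpow_const t _ (Or.inl (hε.trans_le ht.1).ne')).continuousWithinAt

theorem integrableOn_rpow (s : ℝ) {ε : ℝ} (hε : 0 < ε) :
    IntegrableOn (fun t : ℝ => t ^ (s - 1)) (Set.Ioc ε 1) :=
  (continuousOn_rpow_Icc s hε).integrableOn_Icc.mono_set Set.Ioc_subset_Icc_self

theorem integrableOn_rpow_mul_exp (s : ℝ) {ε : ℝ} (hε : 0 < ε) (a : ℝ) :
    IntegrableOn (fun t : ℝ => t ^ (s - 1) * Real.exp (-t * a)) (Set.Ioc ε 1) :=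
  (((continuousOn_rpow_Icc s hε).mul (by fun_prop :
    Continuous fun t : ℝ => Real.exp (-t * a)).continuousOn).integrableOn_Icc).mono_set
    Set.Ioc_subset_Icc_self

theorem besselCoeff_nonneg (s : ℝ) {ε : ℝ} (hε : 0 < ε) (k : Fin 2 → ℤ) :
    0 ≤ besselCoeff s ε k :=
  setIntegral_nonneg measurableSet_Ioc fun _ ht =>
    mul_nonneg (Real.rpow_nonneg (hε.trans ht.1).le _) (Real.exp_pos _).le

theorem summable_besselCoeff (s : ℝ) {ε : ℝ} (hε : 0 < ε) : Summable (besselCoeff s ε) := by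
  refine Summable.of_nonneg_of_le (besselCoeff_nonneg s hε) (fun k => ?_)
    ((summable_exp_neg_mul_norm_freq_sq hε).mul_left (∫ t in Set.Ioc ε 1, t ^ (s - 1)))
  rw [besselCoeff, ← integral_mul_const]
  refine setIntegral_mono_on (integrableOn_rpow_mul_exp s hε _)
    ((integrableOn_rpow s hε).mul_const _) measurableSet_Ioc fun t ht => ?_
  refine mul_le_mul_of_nonneg_left ?_ (Real.rpow_nonneg (hε.trans ht.1).le _)
  rw [Real.exp_le_exp]
  nlinarith [ht.1, sq_nonneg ‖freq k‖]

theorem hasSum_bessel (s : ℝ) {ε : ℝ} (hε : 0 < ε) (z : Torus) :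
    HasSum (fun k => (besselCoeff s ε k : ℂ) * char k z) (bessel s ε z) := by
  have h := hasSum_integral_of_summable_integral_norm
    (μ := (volume : Measure ℝ).restrict (Set.Ioc ε 1))
    (F := fun (k : Fin 2 → ℤ) t => ((t ^ (s - 1) * Real.exp (-t * ‖freq k‖ ^ 2) : ℝ) : ℂ) *
      char k z) (fun k => (integrableOn_rpow_mul_exp s hε _).ofReal.mul_const _) ?_
  · have h1 : ∀ k : Fin 2 → ℤ, ∫ t in Set.Ioc ε 1, ((t ^ (s - 1) *
        Real.exp (-t * ‖freq k‖ ^ 2) : ℝ) : ℂ) * char k z = (besselCoeff s ε k : ℂ) * char k z :=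
      fun k => by rw [integral_mul_const, integral_complex_ofReal, besselCoeff]
    have h2 : ∫ t in Set.Ioc ε 1, ∑' k : Fin 2 → ℤ, ((t ^ (s - 1) *
        Real.exp (-t * ‖freq k‖ ^ 2) : ℝ) : ℂ) * char k z = (bessel s ε z : ℂ) := by
      rw [bessel, ← integral_complex_ofReal]
      refine setIntegral_congr_fun measurableSet_Ioc fun t ht => ?_
      have h3 := ((hasSum_heat (hε.trans ht.1) z).mul_left ((t ^ (s - 1) : ℝ) : ℂ)).tsum_eq
      simp only [← mul_assoc, ← Complex.ofReal_mul] at h3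
      exact h3
    simp only [h1, h2] at h
    exact h
  · refine (summable_besselCoeff s hε).congr fun k => ?_
    refine setIntegral_congr_fun measurableSet_Ioc fun t ht => ?_
    have : 0 ≤ t ^ (s - 1) * Real.exp (-t * ‖freq k‖ ^ 2) :=
      mul_nonneg (Real.rpow_nonneg (hε.trans ht.1).le _) (Real.exp_pos _).le
    simp only [norm_mul _ (char k z), norm_char, mul_one, Complex.norm_real,
      Real.norm_of_nonneg this]

/-- The coefficients of the kernel of order one nearly dominate the covariance `(1 + |k|²)⁻¹`, with
the sharp constant. -/
theorem inv_sub_le_besselCoeff_one {ε : ℝ} (hε : 0 < ε) (hε1 : ε ≤ 1) (k : Fin 2 → ℤ) :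
    (1 + ‖freq k‖ ^ 2)⁻¹ - ε ≤ besselCoeff 1 ε k := by
  set a := ‖freq k‖ ^ 2 with ha
  have ha0 : 0 ≤ a := sq_nonneg _
  have hb : besselCoeff 1 ε k = ∫ t in ε..1, Real.exp (-t * a) := by
    rw [besselCoeff, intervalIntegral.integral_of_le hε1]
    simp [ha]
  have hcont : Continuous fun t : ℝ => Real.exp (-t * a) := by fun_prop
  have h1 : (1 - ε) * Real.exp (-a) ≤ besselCoeff 1 ε k := by
    rw [hb]
    have h := intervalIntegral.integral_mono_on hε1
      (intervalIntegrable_const (μ := volume) (c := Real.exp (-a)))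
      (hcont.intervalIntegrable ε 1) (fun t ht => by
        rw [Real.exp_le_exp]; nlinarith [ht.2])
    simpa using h
  have h2 : a * besselCoeff 1 ε k = Real.exp (-ε * a) - Real.exp (-a) := by
    have h := intervalIntegral.integral_eq_sub_of_hasDerivAt (a := ε) (b := 1)
      (f := fun t => -Real.exp (-t * a)) (f' := fun t => a * Real.exp (-t * a)) (fun t _ => by
        have h3 : HasDerivAt (fun t : ℝ => -t * a) (-1 * a) t :=
          ((hasDerivAt_id t).neg).mul_const a
        exact h3.exp.neg.congr_deriv (by ring)) ((hcont.const_mul a).intervalIntegrable ε 1)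
    rw [intervalIntegral.integral_const_mul] at h
    rw [hb, h]
    simp only [neg_mul, one_mul]
    ring
  have h3 := Real.add_one_le_exp (-ε * a)
  have h4 : Real.exp (-a) ≤ 1 := Real.exp_le_one_iff.2 (by linarith)
  have h5 : 1 - ε * (1 + a) ≤ (1 + a) * besselCoeff 1 ε k := by nlinarith
  rw [sub_le_iff_le_add, inv_le_iff_one_le_mul₀ (by positivity)]
  linarith

/-- Up to a constant, the coefficients of the kernel of order `s` dominate `(1 + |k|²)^{-s}`: restrict
the integral to `t` between `(1 + |k|²)⁻¹ / 2` and `(1 + |k|²)⁻¹`. -/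
theorem rpow_le_besselCoeff {s ε : ℝ} (hs : s ≤ 1) (hε : 0 < ε) (k : Fin 2 → ℤ)
    (hεk : ε ≤ (2 * (1 + ‖freq k‖ ^ 2))⁻¹) :
    (1 + ‖freq k‖ ^ 2) ^ (-s) ≤ 2 * Real.exp 1 * besselCoeff s ε k := by
  set J := 1 + ‖freq k‖ ^ 2 with hJ
  have hJ1 : 1 ≤ J := le_add_of_nonneg_right (sq_nonneg _)
  have hJ0 : 0 < J := by linarith
  have hJi : J⁻¹ ≤ 1 := inv_le_one_of_one_le₀ hJ1
  have h2J : (2 * J)⁻¹ ≤ J⁻¹ := inv_anti₀ hJ0 (by linarith)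
  have hsub : Set.Ioc (2 * J)⁻¹ J⁻¹ ⊆ Set.Ioc ε 1 := Set.Ioc_subset_Ioc hεk hJi
  have h1 : ∫ t in Set.Ioc (2 * J)⁻¹ J⁻¹, J ^ (1 - s) * Real.exp (-1) ≤ besselCoeff s ε k := by
    refine le_trans ?_ (setIntegral_mono_set (integrableOn_rpow_mul_exp s hε _)
      ((ae_restrict_iff' measurableSet_Ioc).2 (Eventually.of_forall fun t ht => mul_nonneg
        (Real.rpow_nonneg (hε.trans ht.1).le _) (Real.exp_pos _).le)) hsub.eventuallyLE)
    refine setIntegral_mono_on (integrable_const _)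
      ((integrableOn_rpow_mul_exp s hε _).mono_set hsub) measurableSet_Ioc fun t ht => ?_
    have ht0 : 0 < t := lt_trans (by positivity) ht.1
    refine mul_le_mul ?_ ?_ (Real.exp_pos _).le (Real.rpow_nonneg ht0.le _)
    · have h3 : J ^ (1 - s) = J⁻¹ ^ (s - 1) := by
        rw [Real.inv_rpow hJ0.le, ← Real.rpow_neg hJ0.le, neg_sub]
      rw [h3]
      exact Real.rpow_le_rpow_of_nonpos ht0 ht.2 (by linarith)
    · rw [Real.exp_le_exp]
      have h4 : t * J ≤ 1 := by
        have := mul_le_mul_of_nonneg_right ht.2 hJ0.le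
        rwa [inv_mul_cancel₀ hJ0.ne'] at this
      nlinarith
  rw [setIntegral_const, Real.volume_real_Ioc_of_le h2J, smul_eq_mul] at h1
  have h5 : J⁻¹ - (2 * J)⁻¹ = J⁻¹ / 2 := by rw [mul_inv]; ring
  have h6 : J⁻¹ * J ^ (1 - s) = J ^ (-s) := by
    rw [Real.rpow_sub hJ0, Real.rpow_one, Real.rpow_neg hJ0.le]
    field_simp
  have h7 : J ^ (-s) = 2 * Real.exp 1 * ((J⁻¹ - (2 * J)⁻¹) * (J ^ (1 - s) * Real.exp (-1))) := by
    rw [h5, ← h6, Real.exp_neg]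
    field_simp
  rw [h7]
  exact mul_le_mul_of_nonneg_left h1 (by positivity)

theorem norm_addCircle_le (x : AddCircle (2 * Real.pi)) : ‖x‖ ≤ Real.pi := by
  obtain ⟨y, -, hy, h⟩ := exists_repr x
  rwa [h]

theorem norm_mul_norm_le (z : Torus) : ‖z 0‖ * ‖z 1‖ ≤ Real.pi ^ 2 := by
  rw [sq]
  exact mul_le_mul (norm_addCircle_le _) (norm_addCircle_le _) (norm_nonneg _) Real.pi_pos.le

theorem integral_Ioc_rpow_le {r ε : ℝ} (hr : 0 < r) (hε : 0 < ε) :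
    ∫ t in Set.Ioc ε 1, t ^ (r - 1) ≤ r⁻¹ := by
  have h1 : IntegrableOn (fun t : ℝ => t ^ (r - 1)) (Set.Ioc 0 1) :=
    (intervalIntegrable_iff_integrableOn_Ioc_of_le zero_le_one).1
      (intervalIntegral.intervalIntegrable_rpow' (by linarith))
  refine (setIntegral_mono_set h1 ((ae_restrict_iff' measurableSet_Ioc).2
    (Eventually.of_forall fun t ht => Real.rpow_nonneg ht.1.le _))
    (Set.Ioc_subset_Ioc_left hε.le).eventuallyLE).trans ?_
  rw [← intervalIntegral.integral_of_le zero_le_one, integral_rpow (Or.inl (by linarith))]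
  simp [Real.zero_rpow hr.ne']

theorem bessel_le_of_heat_le {s ε : ℝ} (hε : 0 < ε) {z : Torus} {g : ℝ → ℝ}
    (hg : IntegrableOn g (Set.Ioc ε 1))
    (h : ∀ t, 0 < t → t ≤ 1 → t ^ (s - 1) * heat t z ≤ g t) :
    bessel s ε z ≤ ∫ t in Set.Ioc ε 1, g t := by
  refine integral_mono_of_nonneg ?_ hg ?_
  · exact (ae_restrict_iff' measurableSet_Ioc).2 (Eventually.of_forall fun t ht => mul_nonneg
      (Real.rpow_nonneg (hε.trans ht.1).le _) (heat_nonneg (hε.trans ht.1) z))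
  · exact (ae_restrict_iff' measurableSet_Ioc).2 (Eventually.of_forall fun t ht =>
      h t (hε.trans ht.1) ht.2)

theorem bessel_nonneg (s : ℝ) {ε : ℝ} (hε : 0 < ε) (z : Torus) : 0 ≤ bessel s ε z :=
  setIntegral_nonneg measurableSet_Ioc fun _ ht => mul_nonneg
      (Real.rpow_nonneg (hε.trans ht.1).le _) (heat_nonneg (hε.trans ht.1) z)

/-- Bound on the kernel of fractional order `s`, with an arbitrarily small loss in the exponent. -/
theorem exists_bessel_le {s s' : ℝ} (hs' : 0 < s') (hss' : s' < s) (hs : s < 1) :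
    ∃ A : ℝ, 0 ≤ A ∧ ∀ (ε : ℝ) (z : Torus), 0 < ε → 0 < ‖z 0‖ * ‖z 1‖ →
      bessel s ε z ≤ A * (‖z 0‖ * ‖z 1‖) ^ (-(1 - s')) := by
  obtain ⟨C, hC0, hC⟩ := exists_heat_le
  have hpi := Real.pi_pos
  have hs0 : 0 < s := hs'.trans hss'
  have hss0 : 0 < s - s' := by linarith
  set p := 1 - s' with hp
  have hp0 : 0 < p := by linarith
  refine ⟨Real.pi * 2 ^ p / (s - s') + C / s * (Real.pi ^ 2) ^ p, by positivity,
    fun ε z hε hz => ?_⟩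
  set m := ‖z 0‖ * ‖z 1‖ with hm
  have hbound : bessel s ε z ≤ ∫ t in Set.Ioc ε 1,
      (Real.pi * 2 ^ p * m ^ (-p) * t ^ (s - s' - 1) + C * t ^ (s - 1)) := by
    refine bessel_le_of_heat_le hε (((integrableOn_rpow _ hε).const_mul _).add
      ((integrableOn_rpow _ hε).const_mul _)) fun t ht ht1 => ?_
    -- `u ^ p ≤ exp u` for `0 < p ≤ 1`
    have h1 : Real.exp (-m / (2 * t)) ≤ (m / (2 * t)) ^ (-p) := by
      rw [neg_div, Real.exp_neg, Real.rpow_neg (by positivity)]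
      refine inv_anti₀ (by positivity) ?_
      have hu : 0 < m / (2 * t) := by positivity
      rcases le_total (m / (2 * t)) 1 with h | h
      · exact (Real.rpow_le_one hu.le h hp0.le).trans (Real.one_le_exp hu.le)
      · calc (m / (2 * t)) ^ p ≤ (m / (2 * t)) ^ (1 : ℝ) :=
            Real.rpow_le_rpow_of_exponent_le h (by linarith)
          _ ≤ _ := by
            rw [Real.rpow_one]
            linarith [Real.add_one_le_exp (m / (2 * t))]
    have h2 : (m / (2 * t)) ^ (-p) = 2 ^ p * m ^ (-p) * t ^ p := by
      rw [Real.div_rpow hz.le (by positivity), Real.mul_rpow zero_le_two ht.le,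
        Real.rpow_neg zero_le_two, Real.rpow_neg ht.le]
      field_simp
    have h3 : t ^ (s - s' - 1) = t ^ (s - 1) * (t ^ p / t) := by
      rw [show s - s' - 1 = (s - 1) + (p - 1) by rw [hp]; ring, Real.rpow_add ht,
        Real.rpow_sub ht p, Real.rpow_one]
    calc t ^ (s - 1) * heat t z
        ≤ t ^ (s - 1) * (Real.pi / t * (2 ^ p * m ^ (-p) * t ^ p) + C) := by
          refine mul_le_mul_of_nonneg_left ((hC t z ht ht1).trans ?_) (Real.rpow_nonneg ht.le _)
          rw [← h2]
          gcongr
      _ = _ := by rw [h3]; ring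
  rw [integral_add ((integrableOn_rpow _ hε).const_mul _) ((integrableOn_rpow _ hε).const_mul _),
    integral_const_mul, integral_const_mul] at hbound
  have hmpi : 1 ≤ (Real.pi ^ 2) ^ p * m ^ (-p) := by
    rw [Real.rpow_neg hz.le, ← div_eq_mul_inv, ← Real.div_rpow (by positivity) hz.le]
    exact Real.one_le_rpow ((one_le_div hz).2 (norm_mul_norm_le z)) hp0.le
  have e1 := mul_le_mul_of_nonneg_left (integral_Ioc_rpow_le hss0 hε)
    (show 0 ≤ Real.pi * 2 ^ p * m ^ (-p) by positivity)
  have e2 := mul_le_mul_of_nonneg_left (integral_Ioc_rpow_le hs0 hε) hC0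
  have e3 := mul_le_mul_of_nonneg_left hmpi (show 0 ≤ C / s by positivity)
  calc bessel s ε z ≤ _ := hbound
    _ ≤ Real.pi * 2 ^ p * m ^ (-p) * (s - s')⁻¹ + C * s⁻¹ := add_le_add e1 e2
    _ ≤ Real.pi * 2 ^ p * m ^ (-p) * (s - s')⁻¹ + C / s * ((Real.pi ^ 2) ^ p * m ^ (-p)) := by
      rw [mul_one, div_eq_mul_inv] at e3
      rw [div_eq_mul_inv]
      linarith
    _ = _ := by ring

/-- The kernel of order one has a logarithmic singularity with the sharp constant; its
exponential is thus bounded by a power. -/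
theorem exists_exp_bessel_le {c : ℝ} (hc : 0 ≤ c) :
    ∃ A : ℝ, 0 ≤ A ∧ ∀ (ε : ℝ) (z : Torus), 0 < ε → ε ≤ 1 → 0 < ‖z 0‖ * ‖z 1‖ →
      Real.exp (c * bessel 1 ε z) ≤ A * (‖z 0‖ * ‖z 1‖) ^ (-(Real.pi * c)) := by
  obtain ⟨C, hC0, hC⟩ := exists_heat_le
  have hpi := Real.pi_pos
  refine ⟨Real.exp (c * C) * (2 + Real.pi ^ 2) ^ (Real.pi * c), by positivity,
    fun ε z hε hε1 hz => ?_⟩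
  set m := ‖z 0‖ * ‖z 1‖ with hm
  have hcont : ContinuousOn (fun t : ℝ => Real.pi * (2 / (2 * t + m)) + C) (Set.Icc ε 1) := by
    refine ContinuousOn.add (continuousOn_const.mul (continuousOn_const.div (by fun_prop) ?_))
      continuousOn_const
    intro t ht
    have : 0 < t := hε.trans_le ht.1
    positivity
  have h1 : bessel 1 ε z ≤ ∫ t in Set.Ioc ε 1, (Real.pi * (2 / (2 * t + m)) + C) := by
    refine bessel_le_of_heat_le hε (hcont.integrableOn_Icc.mono_set Set.Ioc_subset_Icc_self)
      fun t ht ht1 => ?_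
    rw [sub_self, Real.rpow_zero, one_mul]
    refine (hC t z ht ht1).trans (add_le_add_left ?_ C)
    -- this rational majorant of the exponential integrates to a logarithm, without constant factor
    have h2 : Real.exp (-m / (2 * t)) ≤ (m / (2 * t) + 1)⁻¹ := by
      rw [neg_div, Real.exp_neg]
      exact inv_anti₀ (by positivity) (Real.add_one_le_exp _)
    calc Real.pi / t * Real.exp (-m / (2 * t)) ≤ Real.pi / t * (m / (2 * t) + 1)⁻¹ := by gcongr
      _ = _ := by field_simp; ring
  have h3 : ∫ t in Set.Ioc ε 1, (Real.pi * (2 / (2 * t + m)) + C) =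
      Real.pi * (Real.log (2 + m) - Real.log (2 * ε + m)) + C * (1 - ε) := by
    rw [← intervalIntegral.integral_of_le hε1]
    rw [intervalIntegral.integral_eq_sub_of_hasDerivAt
      (f := fun t => Real.pi * Real.log (2 * t + m) + C * t)]
    · simp only [mul_one]; ring
    · intro t ht
      rw [Set.uIcc_of_le hε1] at ht
      have ht0 : 0 < t := hε.trans_le ht.1
      have h4 : HasDerivAt (fun t : ℝ => 2 * t + m) 2 t := by
        simpa using ((hasDerivAt_id t).const_mul 2).add_const m
      have h5 := ((h4.log (by positivity)).const_mul Real.pi).add ((hasDerivAt_id t).const_mul C)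
      exact h5.congr_deriv (by simp)
    · rw [← Set.uIcc_of_le hε1] at hcont
      exact hcont.intervalIntegrable
  have h6 : bessel 1 ε z ≤ Real.pi * Real.log ((2 + Real.pi ^ 2) / m) + C := by
    have h7 : Real.log (2 + m) ≤ Real.log (2 + Real.pi ^ 2) :=
      Real.log_le_log (by positivity) (by linarith [norm_mul_norm_le z])
    have h8 : Real.log m ≤ Real.log (2 * ε + m) := Real.log_le_log hz (by linarith)
    rw [Real.log_div (by positivity) hz.ne']
    rw [h3] at h1
    nlinarith [mul_nonneg hC0 hε.le]
  have h9 : 0 < (2 + Real.pi ^ 2) / m := by positivity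
  calc Real.exp (c * bessel 1 ε z)
      ≤ Real.exp (c * (Real.pi * Real.log ((2 + Real.pi ^ 2) / m) + C)) := by gcongr
    _ = Real.exp (c * C) * ((2 + Real.pi ^ 2) / m) ^ (Real.pi * c) := by
      rw [Real.rpow_def_of_pos h9, ← Real.exp_add]
      congr 1
      ring
    _ = _ := by
      rw [Real.div_rpow (by positivity) hz.le, Real.rpow_neg hz.le]
      ring

/-! ### Exponentials of covariance functions -/

theorem volume_addCircle_singleton_zero :
    (volume : Measure (AddCircle (2 * Real.pi))) {0} = 0 := by
  have h := (AddCircle.measurePreserving_mk (2 * Real.pi) (-Real.pi)).measure_preimage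
    (measurableSet_singleton (0 : AddCircle (2 * Real.pi))).nullMeasurableSet
  rw [← h, Measure.restrict_apply (QuotientAddGroup.measurable_coe
    (measurableSet_singleton _))]
  refine measure_mono_null (t := {0}) ?_ (measure_singleton _)
  rintro y ⟨hy, hy1, hy2⟩
  have hy3 : |y| ≤ Real.pi := abs_le.2 ⟨hy1.le, by linarith⟩
  have h1 := (AddCircle.norm_coe_eq_abs_iff (2 * Real.pi) (x := y) Real.two_pi_pos.ne').2 (by
    rwa [abs_of_pos Real.two_pi_pos, mul_div_cancel_left₀ _ two_ne_zero])
  have h2 : (y : AddCircle (2 * Real.pi)) = 0 := hy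
  rw [h2, norm_zero] at h1
  exact abs_eq_zero.1 h1.symm

theorem ae_norm_mul_norm_pos : ∀ᵐ z : Torus, 0 < ‖z 0‖ * ‖z 1‖ := by
  have : NullSingletonClass (volume : Measure (AddCircle (2 * Real.pi))) := ⟨fun x => by
    have h := measure_preimage_add_right (volume : Measure (AddCircle (2 * Real.pi))) (-x) {0}
    rw [volume_addCircle_singleton_zero] at h
    convert h using 2
    ext y
    simp⟩
  have h0 := Measure.ae_eval_ne
    (fun _ : Fin 2 => (volume : Measure (AddCircle (2 * Real.pi)))) 0 0
  have h1 := Measure.ae_eval_ne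
    (fun _ : Fin 2 => (volume : Measure (AddCircle (2 * Real.pi)))) 1 0
  filter_upwards [h0, h1] with z hz0 hz1
  exact mul_pos (norm_pos_iff.2 hz0) (norm_pos_iff.2 hz1)

theorem integrable_norm_rpow_addCircle {q : ℝ} (hq : q < 1) :
    Integrable fun x : AddCircle (2 * Real.pi) => ‖x‖ ^ (-q) := by
  have hmeas : Measurable fun x : AddCircle (2 * Real.pi) => ‖x‖ ^ (-q) :=
    measurable_norm.pow_const _
  rw [← (AddCircle.measurePreserving_mk (2 * Real.pi) (-Real.pi)).integrable_comp
    hmeas.aestronglyMeasurable]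
  have hpi := Real.pi_pos
  have h1 : IntervalIntegrable (fun y : ℝ => |y| ^ (-q)) volume 0 Real.pi := by
    refine (intervalIntegral.intervalIntegrable_rpow' (r := -q) (by linarith)).congr ?_
    intro y hy
    rw [Set.uIoc_of_le hpi.le] at hy
    simp only [abs_of_pos hy.1]
  have h2 : IntervalIntegrable (fun y : ℝ => |y| ^ (-q)) volume (-Real.pi) 0 := by
    have := (h1.comp_sub_left 0).symm
    simpa using this
  have h3 := (intervalIntegrable_iff_integrableOn_Ioc_of_le (by linarith)).1 (h2.trans h1)
  rw [show -Real.pi + 2 * Real.pi = Real.pi by ring]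
  refine IntegrableOn.congr_fun h3 (fun y hy => ?_) measurableSet_Ioc
  have hy3 : |y| ≤ Real.pi := abs_le.2 ⟨hy.1.le, hy.2⟩
  have h1 := (AddCircle.norm_coe_eq_abs_iff (2 * Real.pi) (x := y) Real.two_pi_pos.ne').2 (by
    rwa [abs_of_pos Real.two_pi_pos, mul_div_cancel_left₀ _ two_ne_zero])
  simp only [Function.comp_apply]
  exact congrArg (· ^ (-q)) h1.symm

theorem integrable_norm_mul_norm_rpow {q : ℝ} (hq : q < 1) :
    Integrable fun z : Torus => (‖z 0‖ * ‖z 1‖) ^ (-q) := by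
  have h := Integrable.fintype_prod (μ := fun _ : Fin 2 =>
    (volume : Measure (AddCircle (2 * Real.pi)))) (f := fun _ x => ‖x‖ ^ (-q))
    fun _ => integrable_norm_rpow_addCircle hq
  refine h.congr (Eventually.of_forall fun z => ?_)
  simp only [Fin.prod_univ_two]
  exact (Real.mul_rpow (norm_nonneg _) (norm_nonneg _)).symm

theorem hasSum_integral_mul_pow_div_factorial {A B : Torus → ℂ} (hA : Continuous A)
    (hB : Continuous B) :
    HasSum (fun n : ℕ => ∫ x, A x * (B x ^ n / n.factorial)) (∫ x, A x * Complex.exp (B x)) := by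
  obtain ⟨a, ha⟩ := isCompact_univ.exists_bound_of_continuousOn hA.continuousOn
  obtain ⟨b, hb⟩ := isCompact_univ.exists_bound_of_continuousOn hB.continuousOn
  have h0 : 0 ≤ a := (norm_nonneg _).trans (ha 0 trivial)
  have hs : Summable fun n : ℕ => a * (b ^ n / n.factorial) :=
    (Real.summable_pow_div_factorial b).mul_left a
  refine hasSum_integral_of_dominated_convergence (fun n _ => a * (b ^ n / n.factorial))
    (fun n => (hA.mul ((hB.pow n).div_const _)).aestronglyMeasurable)
    (fun n => Eventually.of_forall fun x => ?_) (Eventually.of_forall fun x => hs)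
    (integrable_const _) (Eventually.of_forall fun x => ?_)
  · rw [norm_mul, norm_div, norm_pow, Complex.norm_natCast]
    gcongr
    · exact ha x trivial
    · exact hb x trivial
  · have := NormedSpace.expSeries_div_hasSum_exp (B x)
    rw [← Complex.exp_eq_exp_ℂ] at this
    exact this.mul_left _

theorem hasSum_integral_mul_pow_div_factorial_real {A B : Torus → ℝ} (hA : Continuous A)
    (hB : Continuous B) :
    HasSum (fun n : ℕ => ∫ x, A x * (B x ^ n / n.factorial)) (∫ x, A x * Real.exp (B x)) := by
  have h := hasSum_integral_mul_pow_div_factorial (Complex.continuous_ofReal.comp hA)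
    (Complex.continuous_ofReal.comp hB)
  rw [← Complex.hasSum_ofReal]
  convert h using 1
  · funext n
    rw [← integral_complex_ofReal]
    simp
  · rw [← integral_complex_ofReal]
    simp

theorem integrable_of_continuous {E : Type*} [NormedAddCommGroup E] {f : Torus → E}
    (hf : Continuous f) : Integrable f :=
  hf.integrable_of_hasCompactSupport (HasCompactSupport.of_compactSpace _)

/-- Comparison of exponentials of Fourier series with their majorants. All terms of the exponential
series are compared coefficientwise, so that the cancellations in the Fourier series on the left do
not matter. -/
theorem Majorized.norm_integral_exp_sub_le {L P Q : Torus → ℂ} {L' H D : Torus → ℝ} {c : ℝ}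
    (hc : 0 ≤ c) (hL : Majorized L L') (hP : Majorized P H) (hQ : Majorized Q H)
    (hD : Majorized (fun x => P x - Q x) D) :
    ‖∫ x, L x * (Complex.exp (c * P x) - Complex.exp (c * Q x))‖ ≤
      c * ∫ x, L' x * D x * Real.exp (c * H x) := by
  have hPc := hP.continuous_left
  have hQc := hQ.continuous_left
  have hLc := hL.continuous_left
  have hpow : ∀ n : ℕ, ‖∫ x, L x * (P x ^ n - Q x ^ n)‖ ≤
      n * ∫ x, L' x * D x * H x ^ (n - 1) := by
    intro n
    have h1 : ∫ x, L x * (P x ^ n - Q x ^ n) = ∑ i ∈ Finset.range n,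
        ∫ x, L x * (P x - Q x) * (P x ^ i * Q x ^ (n - 1 - i)) := by
      rw [← integral_finsetSum _ fun i _ => integrable_of_continuous (by fun_prop)]
      refine integral_congr_ae (Eventually.of_forall fun x => ?_)
      simp only
      rw [← geom_sum₂_mul, ← Finset.mul_sum]
      ring
    rw [h1]
    refine (norm_sum_le _ _).trans ?_
    have h2 : ∀ i ∈ Finset.range n, ‖∫ x, L x * (P x - Q x) * (P x ^ i * Q x ^ (n - 1 - i))‖ ≤
        ∫ x, L' x * D x * H x ^ (n - 1) := by
      intro i hi
      have hi' : i + (n - 1 - i) = n - 1 := by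
        have := Finset.mem_range.1 hi
        omega
      have h3 := ((hL.mul hD).mul ((hP.pow i).mul (hQ.pow (n - 1 - i)))).norm_integral_le
      simpa only [← pow_add, hi'] using h3
    refine (Finset.sum_le_sum h2).trans ?_
    rw [Finset.sum_const, Finset.card_range, nsmul_eq_mul]
  have hH := hP.continuous_right
  have hR := (hasSum_integral_mul_pow_div_factorial_real
    (A := fun x => L' x * D x) (B := fun x => c * H x)
    (hL.continuous_right.mul hD.continuous_right) (continuous_const.mul hH)).mul_left c
  have hsub := (hasSum_integral_mul_pow_div_factorial (B := fun x => (c : ℂ) * P x) hLc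
    (continuous_const.mul hPc)).sub
      (hasSum_integral_mul_pow_div_factorial (B := fun x => (c : ℂ) * Q x) hLc
        (continuous_const.mul hQc))
  have e1 : (∫ x, L x * Complex.exp (c * P x)) - ∫ x, L x * Complex.exp (c * Q x) =
      ∫ x, L x * (Complex.exp (c * P x) - Complex.exp (c * Q x)) := by
    rw [← integral_sub (integrable_of_continuous (by fun_prop))
      (integrable_of_continuous (by fun_prop))]
    simp only [mul_sub]
  have e2 : ∀ n : ℕ, (∫ x, L x * ((c * P x) ^ n / n.factorial)) -
      ∫ x, L x * ((c * Q x) ^ n / n.factorial) =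
      (c ^ n / n.factorial : ℂ) * ∫ x, L x * (P x ^ n - Q x ^ n) := by
    intro n
    rw [← integral_sub (integrable_of_continuous (by fun_prop))
      (integrable_of_continuous (by fun_prop)), ← integral_const_mul]
    refine integral_congr_ae (Eventually.of_forall fun x => ?_)
    simp only [mul_pow]
    ring
  rw [e1] at hsub
  simp only [e2] at hsub
  rw [← hasSum_nat_add_iff' 1] at hsub
  simp only [Finset.range_one, Finset.sum_singleton, pow_zero, sub_self, mul_zero, integral_zero,
    sub_zero] at hsub
  rw [← hsub.tsum_eq]
  refine tsum_of_norm_bounded hR fun n => ?_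
  rw [norm_mul, norm_div, norm_pow, Complex.norm_real, Complex.norm_natCast,
    Real.norm_of_nonneg hc]
  refine (mul_le_mul_of_nonneg_left (hpow (n + 1)) (by positivity)).trans (le_of_eq ?_)
  rw [add_tsub_cancel_right]
  have e3 : ∫ x, L' x * D x * ((c * H x) ^ n / n.factorial) =
      c ^ n / n.factorial * ∫ x, L' x * D x * H x ^ n := by
    rw [← integral_const_mul]
    refine integral_congr_ae (Eventually.of_forall fun x => ?_)
    simp only [mul_pow]
    ring
  rw [e3, Nat.factorial_succ, pow_succ]
  push_cast
  field_simp

/-- Trigonometric polynomials with coefficients bounded by those of a regularised Bessel kernel are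
majorized by that kernel. -/
theorem majorized_finsetSum {S : Finset (Fin 2 → ℤ)} {f : (Fin 2 → ℤ) → ℝ} {s ε M : ℝ}
    (hε : 0 < ε) (hM : 0 ≤ M) (hf : ∀ k ∈ S, |f k| ≤ M * besselCoeff s ε k) :
    Majorized (fun z => ∑ k ∈ S, (f k : ℂ) * char k z) fun z => M * bessel s ε z := by
  classical
  refine ⟨Fin 2 → ℤ, inferInstance, id, fun k => if k ∈ S then (f k : ℂ) else 0,
    fun k => M * besselCoeff s ε k, (summable_besselCoeff s hε).mul_left M, fun k => ?_,
    fun z => ?_, fun z => ?_⟩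
  · dsimp only
    split_ifs with h
    · rw [Complex.norm_real]
      exact hf k h
    · rw [norm_zero]
      exact mul_nonneg hM (besselCoeff_nonneg s hε k)
  · have e : ∑ k ∈ S, (f k : ℂ) * char k z =
        ∑ k ∈ S, (if k ∈ S then (f k : ℂ) else 0) * char k z :=
      Finset.sum_congr rfl fun k hk => by rw [if_pos hk]
    beta_reduce
    rw [e]
    exact hasSum_sum_of_ne_finset_zero fun k hk => by rw [if_neg hk, zero_mul]
  · have h := (hasSum_bessel s hε z).mul_left (M : ℂ)
    simpa only [← mul_assoc, ← Complex.ofReal_mul, id] using h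

/-- The trigonometric polynomial with coefficients `p_k (1 + |k|²)⁻¹`, `k ∈ S`. Up to the factor
`(4π²)⁻¹` it is the covariance function of a mollified free field. -/
def cov (S : Finset (Fin 2 → ℤ)) (p : (Fin 2 → ℤ) → ℝ) (z : Torus) : ℂ :=
  ∑ k ∈ S, ((p k * (1 + ‖freq k‖ ^ 2)⁻¹ : ℝ) : ℂ) * char k z

/-- The trigonometric polynomial with coefficients `(1 + |k|²)^{-β}`, `k ∈ T`. -/
def sobolevKernel (T : Finset (Fin 2 → ℤ)) (β : ℝ) (z : Torus) : ℂ :=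
  ∑ k ∈ T, (((1 + ‖freq k‖ ^ 2) ^ (-β) : ℝ) : ℂ) * char k z

/-- The main analytic estimate: in the regime `π c < β < 1` the `H^{-β}` norms of exponentials of
covariances are controlled uniformly by the difference of the multipliers, with a small loss of
derivatives. -/
theorem exists_norm_integral_exp_cov_sub_le {β c δ : ℝ} (hc : 0 ≤ c) (hβ : β < 1) (hδ : 0 < δ)
    (hδβ : 5 * δ ≤ β - Real.pi * c) :
    ∃ K : ℝ, 0 ≤ K ∧ ∀ (S T : Finset (Fin 2 → ℤ)) (p q : (Fin 2 → ℤ) → ℝ) (η : ℝ), 0 ≤ η →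
      (∀ k, |p k| ≤ 1) → (∀ k, |q k| ≤ 1) →
      (∀ k, |p k - q k| ≤ η * (1 + ‖freq k‖ ^ 2) ^ δ) →
      ‖∫ z, sobolevKernel T β z * (Complex.exp (c * cov S p z) - Complex.exp (c * cov S q z))‖ ≤
        K * η := by
  have hpi := Real.pi_pos
  have hpc : 0 ≤ Real.pi * c := by positivity
  obtain ⟨A, hA0, hA⟩ := exists_bessel_le (s := β) (s' := β - δ) (by linarith) (by linarith) hβ
  obtain ⟨B, hB0, hB⟩ := exists_bessel_le (s := 1 - δ) (s' := 1 - 2 * δ) (by linarith)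
    (by linarith) (by linarith)
  -- the covariance is majorized by `ρ` times the kernel of order one, which costs less than `δ` in
  -- the exponent of its exponential
  set ρ := 1 + δ / (Real.pi * c + 1) with hρ
  have hρ1 : 1 < ρ := by
    have : 0 < δ / (Real.pi * c + 1) := by positivity
    linarith
  have hρc : Real.pi * (c * ρ) ≤ Real.pi * c + δ := by
    have h1 : Real.pi * c / (Real.pi * c + 1) ≤ 1 := (div_le_one (by linarith)).2 (by linarith)
    have h2 : Real.pi * (c * ρ) = Real.pi * c + δ * (Real.pi * c / (Real.pi * c + 1)) := by
      rw [hρ]; ring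
    rw [h2]
    nlinarith
  obtain ⟨E, hE0, hE⟩ := exists_exp_bessel_le (c := c * ρ) (by positivity)
  set r := (1 - (β - δ)) + (1 - (1 - 2 * δ)) + Real.pi * (c * ρ) with hr
  have hr1 : r < 1 := by rw [hr]; linarith
  set e2 := 2 * Real.exp 1 with he2
  have he20 : 0 ≤ e2 := by positivity
  refine ⟨c * (e2 * A * (e2 * B) * E * ∫ z : Torus, (‖z 0‖ * ‖z 1‖) ^ (-r)), ?_,
    fun S T p q η hη hp hq hpq => ?_⟩
  · have : 0 ≤ ∫ z : Torus, (‖z 0‖ * ‖z 1‖) ^ (-r) := integral_nonneg fun z => by positivity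
    positivity
  have hw0 : ∀ k : Fin 2 → ℤ, 0 < 1 + ‖freq k‖ ^ 2 := fun k => by positivity
  -- the regularisation is removed below the finitely many frequencies involved
  obtain ⟨ε, hε, hε1, hεk⟩ : ∃ ε : ℝ, 0 < ε ∧ ε ≤ 1 ∧ ∀ k ∈ S ∪ T,
      ε ≤ (1 - ρ⁻¹) * (1 + ‖freq k‖ ^ 2)⁻¹ ∧ ε ≤ (2 * (1 + ‖freq k‖ ^ 2))⁻¹ := by
    have hev : ∀ a : ℝ, 0 < a → ∀ᶠ ε : ℝ in 𝓝[>] 0, ε ≤ a := fun a ha =>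
      (Iic_mem_nhds ha |> mem_nhdsWithin_of_mem_nhds)
    have hk : ∀ᶠ ε : ℝ in 𝓝[>] 0, ∀ k ∈ S ∪ T,
        ε ≤ (1 - ρ⁻¹) * (1 + ‖freq k‖ ^ 2)⁻¹ ∧ ε ≤ (2 * (1 + ‖freq k‖ ^ 2))⁻¹ := by
      rw [Finset.eventually_all]
      intro k _
      have hρi : 0 < 1 - ρ⁻¹ := by
        have := inv_lt_one_of_one_lt₀ hρ1
        linarith
      exact (hev _ (mul_pos hρi (inv_pos.2 (hw0 k)))).and (hev _ (by have := hw0 k; positivity))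
    obtain ⟨ε, h1, h2, h3⟩ := ((hev 1 one_pos).and (hk.and self_mem_nhdsWithin)).exists
    exact ⟨ε, h3, h1, h2⟩
  have hcov : ∀ p : (Fin 2 → ℤ) → ℝ, (∀ k, |p k| ≤ 1) →
      Majorized (cov S p) fun z => ρ * bessel 1 ε z := by
    intro p hp
    refine majorized_finsetSum hε (by linarith) fun k hk => ?_
    have h1 := (hεk k (Finset.mem_union_left _ hk)).1
    have h2 := inv_sub_le_besselCoeff_one hε hε1 k
    have h3 : (1 + ‖freq k‖ ^ 2)⁻¹ * ρ⁻¹ ≤ besselCoeff 1 ε k := by linarith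
    rw [abs_mul, abs_of_pos (inv_pos.2 (hw0 k))]
    refine (mul_le_of_le_one_left (inv_pos.2 (hw0 k)).le (hp k)).trans ?_
    rwa [← div_eq_mul_inv, div_le_iff₀ (by linarith), mul_comm] at h3
  have hker : Majorized (sobolevKernel T β) fun z => e2 * bessel β ε z := by
    refine majorized_finsetSum hε he20 fun k hk => ?_
    rw [abs_of_nonneg (Real.rpow_nonneg (hw0 k).le _)]
    exact rpow_le_besselCoeff hβ.le hε k (hεk k (Finset.mem_union_right _ hk)).2
  have hdiff : Majorized (fun z => cov S p z - cov S q z)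
      fun z => η * e2 * bessel (1 - δ) ε z := by
    have h1 : (fun z => cov S p z - cov S q z) = fun z =>
        ∑ k ∈ S, (((p k - q k) * (1 + ‖freq k‖ ^ 2)⁻¹ : ℝ) : ℂ) * char k z := by
      funext z
      simp only [cov, ← Finset.sum_sub_distrib, ← sub_mul, ← Complex.ofReal_sub]
    rw [h1]
    refine majorized_finsetSum hε (by positivity) fun k hk => ?_
    rw [abs_mul, abs_of_pos (inv_pos.2 (hw0 k))]
    refine (mul_le_mul_of_nonneg_right (hpq k) (inv_pos.2 (hw0 k)).le).trans ?_
    have h2 := rpow_le_besselCoeff (s := 1 - δ) (by linarith) hε k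
      (hεk k (Finset.mem_union_left _ hk)).2
    have h3 : (1 + ‖freq k‖ ^ 2) ^ δ * (1 + ‖freq k‖ ^ 2)⁻¹ = (1 + ‖freq k‖ ^ 2) ^ (-(1 - δ)) := by
      rw [neg_sub, Real.rpow_sub (hw0 k), Real.rpow_one, div_eq_mul_inv]
    rw [mul_assoc, h3, mul_assoc]
    exact mul_le_mul_of_nonneg_left h2 hη
  refine (Majorized.norm_integral_exp_sub_le hc hker (hcov p hp) (hcov q hq) hdiff).trans ?_
  rw [mul_assoc c]
  refine mul_le_mul_of_nonneg_left ?_ hc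
  rw [show ∀ I : ℝ, e2 * A * (e2 * B) * E * I * η = e2 * A * (η * e2 * B) * E * I from
    fun I => by ring, ← integral_const_mul]
  refine integral_mono_of_nonneg (Eventually.of_forall fun z => ?_)
    ((integrable_norm_mul_norm_rpow hr1).const_mul _) ?_
  · have h1 := bessel_nonneg β hε z
    have h2 := bessel_nonneg (1 - δ) hε z
    positivity
  filter_upwards [ae_norm_mul_norm_pos] with z hz
  have h1 := mul_le_mul_of_nonneg_left (hA ε z hε hz) he20
  have h2 := mul_le_mul_of_nonneg_left (hB ε z hε hz) (mul_nonneg hη he20)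
  have h3 := hE ε z hε hε1 hz
  rw [← mul_assoc c]
  refine (mul_le_mul (mul_le_mul h1 h2 (mul_nonneg (by positivity) (bessel_nonneg _ hε z))
    (by positivity)) h3 (Real.exp_pos _).le (by positivity)).trans (le_of_eq ?_)
  rw [hr, neg_add, neg_add, Real.rpow_add hz, Real.rpow_add hz]
  ring

/-! ### Decay of the Fourier coefficients of test functions -/

theorem mode_eq (k : Fin 2 → ℤ) (x : Torus) : mode k x = (2 * (Real.pi : ℂ))⁻¹ * char k x := rfl

theorem norm_mode (k : Fin 2 → ℤ) (x : Torus) : ‖mode k x‖ = (2 * Real.pi)⁻¹ := by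
  rw [mode_eq, norm_mul, norm_char, mul_one, norm_inv, norm_mul, Complex.norm_real,
    Real.norm_of_nonneg Real.pi_pos.le]
  simp

theorem continuous_mode (k : Fin 2 → ℤ) : Continuous (mode k) :=
  continuous_const.mul (continuous_char k)

theorem mode_neg (k : Fin 2 → ℤ) (x : Torus) : mode (-k) x = (starRingEnd ℂ) (mode k x) := by
  rw [mode_eq, mode_eq, char_neg, map_mul]
  simp only [map_inv₀, map_mul, Complex.conj_ofReal, map_ofNat]

theorem measureReal_torus : (volume : Measure Torus).real Set.univ = 4 * Real.pi ^ 2 := by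
  have h : ∫ x : Torus, char 0 x = 4 * (Real.pi : ℂ) ^ 2 := by simp [integral_char]
  simp only [char_zero, integral_const, Complex.real_smul, mul_one] at h
  exact_mod_cast h

/-- The Fourier coefficients of a function on the torus. -/
def fourierCoef (f : Torus → ℝ) (k : Fin 2 → ℤ) : ℂ :=
  ∫ x, (f x : ℂ) * (starRingEnd ℂ) (mode k x)

theorem integral_mode_mul_conj_mode (k l : Fin 2 → ℤ) :
    ∫ x, mode k x * (starRingEnd ℂ) (mode l x) = if k = l then 1 else 0 := by
  have hpi : (Real.pi : ℂ) ≠ 0 := by exact_mod_cast Real.pi_ne_zero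
  have h : ∀ x, mode k x * (starRingEnd ℂ) (mode l x) =
      (4 * (Real.pi : ℂ) ^ 2)⁻¹ * char (k - l) x := by
    intro x
    rw [sub_eq_add_neg, char_add, char_neg, mode_eq, mode_eq, map_mul]
    simp only [map_inv₀, map_mul, Complex.conj_ofReal, map_ofNat]
    field_simp
    ring
  simp only [h, integral_const_mul, integral_char, sub_eq_zero]
  split_ifs
  · field_simp
  · simp

theorem lift_add_single (f : Torus → ℝ) (y : Plane) (i : Fin 2) (h : ℝ) :
    f (proj y + Pi.single i (h : AddCircle (2 * Real.pi))) =
      lift f (y + h • EuclideanSpace.single i 1) := by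
  rw [lift]
  congr 1
  funext j
  by_cases hj : j = i
  · subst hj
    simp [proj]
  · simp [proj, hj]

/-- Second differences of a test function are controlled by its second derivative. -/
theorem abs_second_difference_le (f : testFunctions) {B : ℝ}
    (hB : ∀ x, ‖iteratedFDeriv ℝ 2 (lift (f : Torus → ℝ)) x‖ ≤ B) (x : Torus) (i : Fin 2) (h : ℝ) :
    |(f : Torus → ℝ) (x + Pi.single i (h : AddCircle (2 * Real.pi))) +
      (f : Torus → ℝ) (x - Pi.single i (h : AddCircle (2 * Real.pi))) -
      2 * (f : Torus → ℝ) x| ≤ B * h ^ 2 := by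
  obtain ⟨y, rfl⟩ := proj_surjective x
  have hneg : proj y - Pi.single i (h : AddCircle (2 * Real.pi)) =
      proj y + Pi.single i ((-h : ℝ) : AddCircle (2 * Real.pi)) := by
    rw [sub_eq_add_neg, ← Pi.single_neg, AddCircle.coe_neg]
  rw [hneg, lift_add_single (f : Torus → ℝ), lift_add_single (f : Torus → ℝ)]
  have hf : ContDiff ℝ ∞ (lift (f : Torus → ℝ)) := f.2
  set F := lift (f : Torus → ℝ) with hF
  change |F _ + F _ - 2 * F y| ≤ _
  set e : Plane := h • EuclideanSpace.single i 1 with he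
  have hne : ‖e‖ = |h| := by simp [he, norm_smul]
  have hneg2 : (-h) • EuclideanSpace.single i (1 : ℝ) = -e := by rw [he, neg_smul]
  rw [hneg2]
  have hd : Differentiable ℝ F := hf.differentiable (by simp)
  have hd2 : Differentiable ℝ (fderiv ℝ F) :=
    (hf.fderiv_right (m := ∞) (by simp)).differentiable (by simp)
  have h1 : ∀ v w : Plane, ‖fderiv ℝ F v - fderiv ℝ F w‖ ≤ B * ‖v - w‖ := fun v w =>
    convex_univ.norm_image_sub_le_of_norm_fderiv_le (𝕜 := ℝ) (fun x _ => hd2 x) (fun x _ => by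
      rw [← norm_iteratedFDeriv_one, norm_iteratedFDeriv_fderiv]
      exact hB x) trivial trivial
  have h2 := convex_univ.norm_image_sub_le_of_norm_fderiv_le (𝕜 := ℝ)
    (f := fun v => F (v + e) - F v) (C := B * ‖e‖) (x := y + -e) (y := y)
    (fun x _ => ((hd _).comp x (by fun_prop)).sub (hd x)) (fun x _ => by
      have h3 : HasFDerivAt (fun v => F (v + e) - F v) (fderiv ℝ F (x + e) - fderiv ℝ F x) x :=
        ((hasFDerivAt_comp_add_right e).2 (hd (x + e)).hasFDerivAt).sub (hd x).hasFDerivAt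
      rw [h3.fderiv]
      simpa using h1 (x + e) x) trivial trivial
  rw [neg_add_cancel_right, Real.norm_eq_abs, sub_add_cancel_left, neg_neg, hne] at h2
  calc |F (y + e) + F (y + -e) - 2 * F y| = |F (y + e) - F y - (F y - F (y + -e))| := by ring_nf
    _ ≤ B * |h| * |h| := h2
    _ = B * h ^ 2 := by rw [mul_assoc, ← sq, sq_abs]

theorem fourierCoef_comp_add (f : testFunctions) (k : Fin 2 → ℤ) (t : Torus) :
    ∫ x, ((f : Torus → ℝ) (x + t) : ℂ) * (starRingEnd ℂ) (mode k x) =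
      char k t * fourierCoef f k := by
  rw [fourierCoef, ← integral_const_mul, ← integral_add_right_eq_self
    (fun x => char k t * (((f : Torus → ℝ) x : ℂ) * (starRingEnd ℂ) (mode k x))) t]
  refine integral_congr_ae (Eventually.of_forall fun x => ?_)
  have h : char k t * (starRingEnd ℂ) (char k t) = 1 := by
    rw [Complex.mul_conj', norm_char]; simp
  simp only [mode_eq, char_apply_add, map_mul]
  linear_combination (-((f : Torus → ℝ) (x + t) : ℂ) * (starRingEnd ℂ) (2 * (Real.pi : ℂ))⁻¹ *
    (starRingEnd ℂ) (char k x)) * h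

/-- Fourier coefficients of test functions decay quadratically: translate by half a period of the
mode. -/
theorem norm_fourierCoef_mul_sq_le (f : testFunctions) {B : ℝ}
    (hB : ∀ x, ‖iteratedFDeriv ℝ 2 (lift (f : Torus → ℝ)) x‖ ≤ B) (k : Fin 2 → ℤ) (i : Fin 2) :
    ‖fourierCoef f k‖ * (k i : ℝ) ^ 2 ≤ Real.pi ^ 3 / 2 * B := by
  have hB0 : 0 ≤ B := (norm_nonneg _).trans (hB 0)
  by_cases hk : k i = 0
  · simp only [hk, Int.cast_zero]
    have := Real.pi_pos
    have : 0 ≤ Real.pi ^ 3 / 2 * B := by positivity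
    simpa using this
  have hkR : (k i : ℝ) ≠ 0 := by exact_mod_cast hk
  have hkC : (k i : ℂ) ≠ 0 := by exact_mod_cast hk
  have hpi : (Real.pi : ℂ) ≠ 0 := by exact_mod_cast Real.pi_ne_zero
  set h : ℝ := Real.pi / k i with hh
  set t : Torus := Pi.single i (h : AddCircle (2 * Real.pi)) with ht
  have hchar : char k t = -1 := by
    have h1 : char k t = fourier (k i) (h : AddCircle (2 * Real.pi)) := by
      rw [char, Finset.prod_eq_single i]
      · rw [ht, Pi.single_eq_same]
      · intro j _ hj
        rw [ht, Pi.single_eq_of_ne hj, fourier_eval_zero]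
      · simp
    rw [h1, fourier_coe_apply, ← Complex.exp_pi_mul_I]
    congr 1
    rw [hh]
    push_cast
    field_simp
  have hchar' : char k (-t) = -1 := by rw [char_apply_neg, hchar]; simp
  have hc := continuous_testFunction f
  have hm : Continuous fun x => (starRingEnd ℂ) (mode k x) :=
    Complex.continuous_conj.comp (continuous_mode k)
  have hI : ∫ x, ((((f : Torus → ℝ) (x + t) + (f : Torus → ℝ) (x - t) -
      2 * (f : Torus → ℝ) x : ℝ)) : ℂ) * (starRingEnd ℂ) (mode k x) = -4 * fourierCoef f k := by
    have e1 := fourierCoef_comp_add f k t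
    have e2 := fourierCoef_comp_add f k (-t)
    rw [hchar] at e1
    rw [hchar'] at e2
    have e3 : ∀ x, ((((f : Torus → ℝ) (x + t) + (f : Torus → ℝ) (x - t) -
      2 * (f : Torus → ℝ) x : ℝ)) : ℂ) * (starRingEnd ℂ) (mode k x) =
      ((f : Torus → ℝ) (x + t) : ℂ) * (starRingEnd ℂ) (mode k x) +
      ((f : Torus → ℝ) (x + -t) : ℂ) * (starRingEnd ℂ) (mode k x) -
      2 * (((f : Torus → ℝ) x : ℂ) * (starRingEnd ℂ) (mode k x)) := by
      intro x
      rw [sub_eq_add_neg x t]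
      push_cast
      ring
    simp only [e3]
    rw [integral_sub, integral_add, e1, e2, integral_const_mul, ← fourierCoef]
    · ring
    all_goals exact integrable_of_continuous (by fun_prop)
  have hle : ‖-4 * fourierCoef f k‖ ≤ B * h ^ 2 * (2 * Real.pi)⁻¹ * (4 * Real.pi ^ 2) := by
    rw [← hI, ← measureReal_torus]
    refine norm_integral_le_of_norm_le_const (Eventually.of_forall fun x => ?_)
    rw [norm_mul, RCLike.norm_conj, norm_mode, Complex.norm_real]
    exact mul_le_mul_of_nonneg_right (abs_second_difference_le f hB x i h)
      (by have := Real.pi_pos; positivity)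
  rw [norm_mul, norm_neg, Complex.norm_ofNat] at hle
  have e4 : B * h ^ 2 * (2 * Real.pi)⁻¹ * (4 * Real.pi ^ 2) * (k i : ℝ) ^ 2 =
      2 * Real.pi ^ 3 * B := by
    have := Real.pi_ne_zero
    rw [hh]
    field_simp
    ring
  have := mul_le_mul_of_nonneg_right hle (sq_nonneg (k i : ℝ))
  rw [e4] at this
  linarith

/-- Summability against these bounds makes a Fourier series a distribution of order two. -/
theorem norm_fourierCoef_le (f : testFunctions) {B : ℝ}
    (hB : ∀ j ≤ 2, ∀ x, ‖iteratedFDeriv ℝ j (lift (f : Torus → ℝ)) x‖ ≤ B) (k : Fin 2 → ℤ) :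
    ‖fourierCoef f k‖ ≤ (2 * Real.pi + Real.pi ^ 3) * B * (1 + ‖freq k‖ ^ 2)⁻¹ := by
  have h0 : ‖fourierCoef f k‖ ≤ 2 * Real.pi * B := by
    have h1 : 2 * Real.pi * B = B * (2 * Real.pi)⁻¹ * (4 * Real.pi ^ 2) := by
      have := Real.pi_ne_zero
      field_simp
      ring
    rw [h1, ← measureReal_torus]
    refine norm_integral_le_of_norm_le_const (Eventually.of_forall fun x => ?_)
    rw [norm_mul, RCLike.norm_conj, norm_mode, Complex.norm_real]
    refine mul_le_mul_of_nonneg_right ?_ (by have := Real.pi_pos; positivity)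
    obtain ⟨y, rfl⟩ := proj_surjective x
    simpa [lift] using hB 0 (by norm_num) y
  have h1 := norm_fourierCoef_mul_sq_le f (hB 2 le_rfl) k 0
  have h2 := norm_fourierCoef_mul_sq_le f (hB 2 le_rfl) k 1
  rw [← div_eq_mul_inv, le_div_iff₀ (by positivity), norm_freq_sq]
  linarith

theorem exists_iteratedFDeriv_lift_le (f : testFunctions) (m : ℕ) :
    ∃ B, ∀ j ≤ m, ∀ x, ‖iteratedFDeriv ℝ j (lift (f : Torus → ℝ)) x‖ ≤ B := by
  have hf : ContDiff ℝ ∞ (lift (f : Torus → ℝ)) := f.2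
  have key : ∀ j : ℕ, ∃ B, ∀ x, ‖iteratedFDeriv ℝ j (lift (f : Torus → ℝ)) x‖ ≤ B := by
    intro j
    obtain ⟨B, hB⟩ := (isCompact_closedBall (0 : Plane) (2 * Real.pi)).exists_bound_of_continuousOn
      (hf.continuous_iteratedFDeriv (m := j) (by exact_mod_cast le_top)).continuousOn
    refine ⟨B, fun x => ?_⟩
    choose y hy hyle _ using fun i => exists_repr (proj x i)
    set y' : Plane := WithLp.toLp 2 y with hy'
    have hper : (fun v => lift (f : Torus → ℝ) (v + (x - y'))) = lift (f : Torus → ℝ) := by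
      funext v
      refine congrArg (f : Torus → ℝ) (funext fun i => ?_)
      have h1 : ((y i : ℝ) : AddCircle (2 * Real.pi)) = (x i : ℝ) := hy i
      simp only [proj, hy', PiLp.add_apply, PiLp.sub_apply, AddCircle.coe_add, AddCircle.coe_sub]
      rw [h1, sub_self, add_zero]
    have h2 : iteratedFDeriv ℝ j (lift (f : Torus → ℝ)) x =
        iteratedFDeriv ℝ j (lift (f : Torus → ℝ)) y' := by
      have h3 := iteratedFDeriv_comp_add_right (𝕜 := ℝ) (f := lift (f : Torus → ℝ)) j (x - y') y'
      rw [hper, add_sub_cancel] at h3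
      exact h3.symm
    rw [h2]
    refine hB y' (mem_closedBall_zero_iff.2 ?_)
    refine le_of_sq_le_sq ?_ Real.two_pi_pos.le
    rw [EuclideanSpace.norm_sq_eq, Fin.sum_univ_two]
    have h4 : ∀ i, ‖y' i‖ ^ 2 ≤ Real.pi ^ 2 := fun i =>
      pow_le_pow_left₀ (norm_nonneg _) (hyle i) 2
    nlinarith [h4 0, h4 1]
  choose B hB using key
  refine ⟨∑ j ∈ Finset.range (m + 1), |B j|, fun j hj x => (hB j x).trans ((le_abs_self _).trans ?_)⟩
  exact Finset.single_le_sum (f := fun j => |B j|) (fun _ _ => abs_nonneg _)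
    (Finset.mem_range.2 (by omega))

theorem exists_norm_fourierCoef_le (f : testFunctions) :
    ∃ C : ℝ, ∀ k, ‖fourierCoef f k‖ ≤ C * (1 + ‖freq k‖ ^ 2)⁻¹ := by
  obtain ⟨B, hB⟩ := exists_iteratedFDeriv_lift_le f 2
  exact ⟨_, norm_fourierCoef_le f hB⟩

/-! ### Distributions with prescribed Fourier coefficients -/

/-- Fourier coefficients that define a real distribution (of low order). -/
def IsRealCoeff (c : (Fin 2 → ℤ) → ℂ) : Prop :=
  (∀ k, c (-k) = (starRingEnd ℂ) (c k)) ∧ Summable fun k => ‖c k‖ * (1 + ‖freq k‖ ^ 2)⁻¹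

theorem fourierCoef_add (f g : testFunctions) (k : Fin 2 → ℤ) :
    fourierCoef ((f + g : testFunctions) : Torus → ℝ) k = fourierCoef f k + fourierCoef g k := by
  have hm : Continuous fun x => (starRingEnd ℂ) (mode k x) :=
    Complex.continuous_conj.comp (continuous_mode k)
  have hf := continuous_testFunction f
  have hg := continuous_testFunction g
  rw [fourierCoef, fourierCoef, fourierCoef, ← integral_add (integrable_of_continuous (by fun_prop))
    (integrable_of_continuous (by fun_prop))]
  refine integral_congr_ae (Eventually.of_forall fun x => ?_)
  simp [add_mul]

theorem fourierCoef_smul (a : ℝ) (f : testFunctions) (k : Fin 2 → ℤ) :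
    fourierCoef ((a • f : testFunctions) : Torus → ℝ) k = a * fourierCoef f k := by
  rw [fourierCoef, fourierCoef, ← integral_const_mul]
  refine integral_congr_ae (Eventually.of_forall fun x => ?_)
  simp [mul_assoc]

theorem norm_mul_conj_fourierCoef_le {c : (Fin 2 → ℤ) → ℂ} (f : testFunctions) {C : ℝ}
    (hC : ∀ k, ‖fourierCoef f k‖ ≤ C * (1 + ‖freq k‖ ^ 2)⁻¹) (k : Fin 2 → ℤ) :
    ‖(c k * (starRingEnd ℂ) (fourierCoef f k)).re‖ ≤ C * (‖c k‖ * (1 + ‖freq k‖ ^ 2)⁻¹) := by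
  refine (Complex.abs_re_le_norm _).trans ?_
  rw [norm_mul, RCLike.norm_conj]
  refine (mul_le_mul_of_nonneg_left (hC k) (norm_nonneg _)).trans (le_of_eq ?_)
  ring

theorem summable_re_mul_conj_fourierCoef {c : (Fin 2 → ℤ) → ℂ} (hc : IsRealCoeff c)
    (f : testFunctions) : Summable fun k => (c k * (starRingEnd ℂ) (fourierCoef f k)).re := by
  obtain ⟨C, hC⟩ := exists_norm_fourierCoef_le f
  exact Summable.of_norm_bounded (hc.2.mul_left C) (norm_mul_conj_fourierCoef_le f hC)

open Classical in
/-- The real distribution with given Fourier coefficients (and `0` when the coefficients are not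
Hermitian or grow too fast). -/
def ofCoeff (c : (Fin 2 → ℤ) → ℂ) : TorusDistribution :=
  if hc : IsRealCoeff c then
    ⟨{ toFun := fun f => ∑' k, (c k * (starRingEnd ℂ) (fourierCoef f k)).re
       map_add' := fun f g => by
        rw [← (summable_re_mul_conj_fourierCoef hc f).tsum_add
          (summable_re_mul_conj_fourierCoef hc g)]
        refine tsum_congr fun k => ?_
        rw [fourierCoef_add, map_add, mul_add, Complex.add_re]
       map_smul' := fun a f => by
        rw [RingHom.id_apply, smul_eq_mul, ← tsum_mul_left]
        refine tsum_congr fun k => ?_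
        rw [fourierCoef_smul, map_mul, Complex.conj_ofReal, mul_left_comm, Complex.re_ofReal_mul] },
     by
      have h0 : 0 ≤ ∑' k : Fin 2 → ℤ, ‖c k‖ * (1 + ‖freq k‖ ^ 2)⁻¹ :=
        tsum_nonneg fun k => by positivity
      have hpi := Real.pi_pos
      refine ⟨2, (2 * Real.pi + Real.pi ^ 3) * ∑' k, ‖c k‖ * (1 + ‖freq k‖ ^ 2)⁻¹,
        by positivity, fun f B hB => ?_⟩
      have h := tsum_of_norm_bounded ((hc.2.hasSum).mul_left ((2 * Real.pi + Real.pi ^ 3) * B))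
        (norm_mul_conj_fourierCoef_le (c := c) f (norm_fourierCoef_le f hB))
      rw [Real.norm_eq_abs] at h
      refine h.trans (le_of_eq ?_)
      ring⟩
  else 0

theorem pair_ofCoeff {c : (Fin 2 → ℤ) → ℂ} (hc : IsRealCoeff c) (f : testFunctions) :
    pair (ofCoeff c) f = ∑' k, (c k * (starRingEnd ℂ) (fourierCoef f k)).re := by
  rw [pair, ofCoeff, dif_pos hc]
  rfl

theorem fourierCoef_modeRe (l k : Fin 2 → ℤ) :
    fourierCoef (modeRe l) k = ((if l = k then 1 else 0) + if -l = k then 1 else 0) / 2 := by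
  have h : ∀ x, (((modeRe l : Torus → ℝ) x : ℝ) : ℂ) * (starRingEnd ℂ) (mode k x) =
      (mode l x * (starRingEnd ℂ) (mode k x) + mode (-l) x * (starRingEnd ℂ) (mode k x)) / 2 := by
    intro x
    change (((mode l x).re : ℝ) : ℂ) * _ = _
    rw [mode_neg, Complex.re_eq_add_conj]
    ring
  have hc : ∀ j : Fin 2 → ℤ, Continuous fun x => mode j x * (starRingEnd ℂ) (mode k x) := fun j =>
    (continuous_mode j).mul (Complex.continuous_conj.comp (continuous_mode k))
  simp only [fourierCoef, h]
  rw [integral_div, integral_add (integrable_of_continuous (hc _))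
    (integrable_of_continuous (hc _)), integral_mode_mul_conj_mode, integral_mode_mul_conj_mode]

theorem fourierCoef_modeIm (l k : Fin 2 → ℤ) :
    fourierCoef (modeIm l) k =
      ((if l = k then 1 else 0) - if -l = k then 1 else 0) / (2 * Complex.I) := by
  have h : ∀ x, (((modeIm l : Torus → ℝ) x : ℝ) : ℂ) * (starRingEnd ℂ) (mode k x) =
      (mode l x * (starRingEnd ℂ) (mode k x) - mode (-l) x * (starRingEnd ℂ) (mode k x)) /
        (2 * Complex.I) := by
    intro x
    change (((mode l x).im : ℝ) : ℂ) * _ = _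
    rw [mode_neg, Complex.im_eq_sub_conj]
    ring
  have hc : ∀ j : Fin 2 → ℤ, Continuous fun x => mode j x * (starRingEnd ℂ) (mode k x) := fun j =>
    (continuous_mode j).mul (Complex.continuous_conj.comp (continuous_mode k))
  simp only [fourierCoef, h]
  rw [integral_div, integral_sub (integrable_of_continuous (hc _))
    (integrable_of_continuous (hc _)), integral_mode_mul_conj_mode, integral_mode_mul_conj_mode]

theorem coeff_ofCoeff {c : (Fin 2 → ℤ) → ℂ} (hc : IsRealCoeff c) (l : Fin 2 → ℤ) :
    coeff (ofCoeff c) l = c l := by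
  have hneg := hc.1 l
  have hite : ∀ j : Fin 2 → ℤ, ∀ z : ℂ, HasSum (fun k => (c k * (z * if j = k then 1 else 0)).re)
      (c j * z).re := by
    intro j z
    have h := hasSum_single (f := fun k => (c k * (z * if j = k then 1 else 0)).re) j
      fun k hk => by simp [hk.symm]
    simpa using h
  have hre : pair (ofCoeff c) (modeRe l) = (c l).re := by
    rw [pair_ofCoeff hc]
    have h := (hite l (1 / 2)).add (hite (-l) (1 / 2))
    have e : ∀ k, (c k * (starRingEnd ℂ) (fourierCoef (modeRe l) k)).re =
        (c k * (1 / 2 * if l = k then 1 else 0)).re +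
          (c k * (1 / 2 * if -l = k then 1 else 0)).re := by
      intro k
      rw [fourierCoef_modeRe, ← Complex.add_re]
      congr 1
      split_ifs <;> simp [map_ofNat]
      ring
    rw [tsum_congr e, h.tsum_eq, hneg]
    simp
    ring
  have him : pair (ofCoeff c) (modeIm l) = -(c l).im := by
    rw [pair_ofCoeff hc]
    have h := (hite l (Complex.I / 2)).add (hite (-l) (-Complex.I / 2))
    have e : ∀ k, (c k * (starRingEnd ℂ) (fourierCoef (modeIm l) k)).re =
        (c k * (Complex.I / 2 * if l = k then 1 else 0)).re +
          (c k * (-Complex.I / 2 * if -l = k then 1 else 0)).re := by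
      intro k
      have hI : (starRingEnd ℂ) (2 * Complex.I)⁻¹ = Complex.I / 2 := by
        rw [mul_inv, Complex.inv_I, map_mul, map_inv₀, map_ofNat, map_neg, Complex.conj_I]
        ring
      rw [fourierCoef_modeIm, ← Complex.add_re, div_eq_mul_inv, map_mul, hI, map_sub]
      congr 1
      split_ifs <;> simp only [map_one, map_zero] <;> ring
    rw [tsum_congr e, h.tsum_eq, hneg]
    simp
    ring
  rw [coeff, hre, him]
  apply Complex.ext <;> simp

theorem measurable_pair (f : testFunctions) : Measurable fun u : TorusDistribution => pair u f :=
  (comap_measurable _).mono (le_iSup (fun f : testFunctions =>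
    MeasurableSpace.comap (fun u : TorusDistribution => pair u f) inferInstance) f) le_rfl

theorem measurable_of_pair {Ω : Type*} [MeasurableSpace Ω] {X : Ω → TorusDistribution}
    (h : ∀ f, Measurable fun y => pair (X y) f) : Measurable X := by
  rw [measurable_iff_comap_le, instMeasurableSpaceDistribution, MeasurableSpace.comap_iSup]
  refine iSup_le fun f => ?_
  rw [MeasurableSpace.comap_comp]
  exact (h f).comap_le

theorem measurable_coeff (k : Fin 2 → ℤ) : Measurable fun u => coeff u k :=
  (Complex.measurable_ofReal.comp (measurable_pair _)).sub
    ((Complex.measurable_ofReal.comp (measurable_pair _)).const_mul _)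

theorem measurable_ofCoeff {Ω : Type*} [MeasurableSpace Ω] {c : Ω → (Fin 2 → ℤ) → ℂ}
    (hc : ∀ k, Measurable fun y => c y k) : Measurable fun y => ofCoeff (c y) := by
  classical
  have hset : MeasurableSet {y | IsRealCoeff (c y)} := by
    refine MeasurableSet.inter (s₁ := {y | ∀ k, c y (-k) = (starRingEnd ℂ) (c y k)})
      (s₂ := {y | Summable fun k => ‖c y k‖ * (1 + ‖freq k‖ ^ 2)⁻¹}) ?_ ?_
    · rw [Set.ofPred_forall]
      exact MeasurableSet.iInter fun k => measurableSet_eq_fun (hc _)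
        (Complex.continuous_conj.measurable.comp (hc k))
    · have h : {y | Summable fun k => ‖c y k‖ * (1 + ‖freq k‖ ^ 2)⁻¹} =
          {y | ∑' k, ENNReal.ofReal (‖c y k‖ * (1 + ‖freq k‖ ^ 2)⁻¹) < ⊤} := by
        ext y
        have h0 : ∀ k, 0 ≤ ‖c y k‖ * (1 + ‖freq k‖ ^ 2)⁻¹ := fun k => by positivity
        simp only [Set.mem_ofPred_eq, lt_top_iff_ne_top]
        refine ⟨fun h => h.tsum_ofReal_ne_top, fun h => ?_⟩
        refine (ENNReal.summable_toReal h).congr fun k => ?_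
        rw [ENNReal.toReal_ofReal (h0 k)]
      rw [h]
      exact measurableSet_lt (Measurable.tsum fun k =>
        ((hc k).norm.mul_const _).ennreal_ofReal) measurable_const
  refine measurable_of_pair fun f => ?_
  have h : (fun y => pair (ofCoeff (c y)) f) = fun y => if IsRealCoeff (c y) then
      ∑' k, (c y k * (starRingEnd ℂ) (fourierCoef f k)).re else 0 := by
    funext y
    split_ifs with h
    · exact pair_ofCoeff h f
    · rw [pair, ofCoeff, dif_neg h]
      rfl
  rw [h]
  exact Measurable.ite hset (Measurable.tsum fun k =>
    Complex.measurable_re.comp ((hc k).mul_const _)) measurable_const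

theorem coeff_sub (u v : TorusDistribution) (k : Fin 2 → ℤ) :
    coeff (u - v) k = coeff u k - coeff v k := by
  have h : ∀ f, pair (u - v) f = pair u f - pair v f := fun f => rfl
  rw [coeff, coeff, coeff, h, h]
  push_cast
  ring

theorem coeff_neg_freq (u : TorusDistribution) (k : Fin 2 → ℤ) :
    coeff u (-k) = (starRingEnd ℂ) (coeff u k) := by
  have h1 : modeRe (-k) = modeRe k := by
    apply Subtype.ext
    funext x
    change (mode (-k) x).re = (mode k x).re
    rw [mode_neg, Complex.conj_re]
  have h2 : modeIm (-k) = -modeIm k := by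
    apply Subtype.ext
    funext x
    change (mode (-k) x).im = -(mode k x).im
    rw [mode_neg, Complex.conj_im]
  have h3 : pair u (-modeIm k) = -pair u (modeIm k) := map_neg (u : Module.Dual ℝ testFunctions) _
  rw [coeff, coeff, h1, h2, h3]
  simp

theorem pair_ofFunction {g : Torus → ℝ} (hg : Integrable g) (f : testFunctions) :
    pair (ofFunction g) f = ∫ x, (f : Torus → ℝ) x * g x := by
  rw [pair, ofFunction, dif_pos hg]
  rfl

theorem coeff_ofFunction {g : Torus → ℝ} (hg : Integrable g) (k : Fin 2 → ℤ) :
    coeff (ofFunction g) k = fourierCoef g k := by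
  rw [coeff, pair_ofFunction hg, pair_ofFunction hg, fourierCoef, ← integral_complex_ofReal,
    ← integral_complex_ofReal, ← integral_const_mul, ← integral_sub]
  · refine integral_congr_ae (Eventually.of_forall fun x => ?_)
    change (((mode k x).re * g x : ℝ) : ℂ) - Complex.I * (((mode k x).im * g x : ℝ) : ℂ) = _
    apply Complex.ext <;> simp <;> ring
  · exact (integrable_testFunction_mul (modeRe k) hg).ofReal
  · exact (integrable_testFunction_mul (modeIm k) hg).ofReal.const_mul _

/-! ### Gaussian fields and the two-point function of their Wick exponentials -/

/-- The field with Fourier multiplier `a`; the field `trunc ψ N` is the case `a = cutoffN ψ N`. -/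
def field (a : (Fin 2 → ℤ) → ℝ) (φ : TorusDistribution) (x : Torus) : ℝ :=
  (∑' k, (a k : ℂ) * coeff φ k * mode k x).re

/-- The variance of `field a` at a point. -/
def fieldVar (a : (Fin 2 → ℤ) → ℝ) : ℝ :=
  1 / (4 * Real.pi ^ 2) * ∑' k : Fin 2 → ℤ, a k ^ 2 / (1 + ‖freq k‖ ^ 2)

/-- The Wick exponential of the field with Fourier multiplier `a`. -/
def wick (α : ℝ) (a : (Fin 2 → ℤ) → ℝ) (φ : TorusDistribution) (x : Torus) : ℝ :=
  Real.exp (α * field a φ x - α ^ 2 / 2 * fieldVar a)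

theorem wickExp_eq_wick (ψ : Plane → ℝ) (α : ℝ) (N : ℕ) :
    wickExp ψ α N = wick α (cutoffN ψ N) := rfl

theorem _root_.Measurable.wick {Ω : Type*} [MeasurableSpace Ω] {Φ : Ω → TorusDistribution}
    {Y : Ω → Torus} (α : ℝ) (a : (Fin 2 → ℤ) → ℝ) (hΦ : Measurable Φ) (hY : Measurable Y) :
    Measurable fun y => wick α a (Φ y) (Y y) := by
  have h : Measurable fun y => field a (Φ y) (Y y) :=
    Complex.measurable_re.comp (Measurable.tsum fun k =>
      (((measurable_coeff k).comp hΦ).const_mul _).mul ((continuous_mode k).measurable.comp hY))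
  exact Real.measurable_exp.comp ((h.const_mul α).sub_const _)

/-- Even Fourier multipliers with values in `[0, 1]` that vanish outside the finite set `S`. -/
structure IsMultiplier (S : Finset (Fin 2 → ℤ)) (a : (Fin 2 → ℤ) → ℝ) : Prop where
  eq_zero : ∀ k ∉ S, a k = 0
  even : ∀ k, a (-k) = a k
  nonneg : ∀ k, 0 ≤ a k
  le_one : ∀ k, a k ≤ 1

/-- The test function whose pairing with `φ` is `field a φ x`. -/
def fieldTest (S : Finset (Fin 2 → ℤ)) (a : (Fin 2 → ℤ) → ℝ) (x : Torus) : testFunctions :=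
  ∑ k ∈ S, a k • ((mode k x).re • modeRe k + (mode k x).im • modeIm k)

theorem pair_add (φ : TorusDistribution) (f g : testFunctions) :
    pair φ (f + g) = pair φ f + pair φ g := map_add (φ : Module.Dual ℝ testFunctions) f g

theorem pair_smul (φ : TorusDistribution) (c : ℝ) (f : testFunctions) :
    pair φ (c • f) = c * pair φ f := map_smul (φ : Module.Dual ℝ testFunctions) c f

theorem pair_sum (φ : TorusDistribution) {ι : Type*} (S : Finset ι) (f : ι → testFunctions) :
    pair φ (∑ i ∈ S, f i) = ∑ i ∈ S, pair φ (f i) :=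
  map_sum (φ : Module.Dual ℝ testFunctions) f S

namespace IsMultiplier

variable {S : Finset (Fin 2 → ℤ)} {a b : (Fin 2 → ℤ) → ℝ}

theorem tsum_eq (ha : IsMultiplier S a) (φ : TorusDistribution) (x : Torus) :
    ∑' k, (a k : ℂ) * coeff φ k * mode k x = ∑ k ∈ S, (a k : ℂ) * coeff φ k * mode k x :=
  tsum_eq_sum fun k hk => by rw [ha.eq_zero k hk]; simp

theorem field_eq_pair (ha : IsMultiplier S a) (φ : TorusDistribution) (x : Torus) :
    field a φ x = pair φ (fieldTest S a x) := by
  rw [field, ha.tsum_eq, Complex.re_sum, fieldTest, pair_sum]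
  refine Finset.sum_congr rfl fun k _ => ?_
  rw [pair_smul, pair_add, pair_smul, pair_smul, coeff]
  simp
  ring

theorem continuous_field (ha : IsMultiplier S a) (φ : TorusDistribution) :
    Continuous (field a φ) := by
  have h : field a φ = fun x => (∑ k ∈ S, (a k : ℂ) * coeff φ k * mode k x).re :=
    funext fun x => by rw [field, ha.tsum_eq]
  rw [h]
  exact Complex.continuous_re.comp (continuous_finsetSum _ fun k _ =>
    continuous_const.mul (continuous_mode k))

theorem continuous_wick (ha : IsMultiplier S a) (α : ℝ) (φ : TorusDistribution) :
    Continuous (wick α a φ) :=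
  Real.continuous_exp.comp ((continuous_const.mul (ha.continuous_field φ)).sub continuous_const)

theorem ofReal_field (ha : IsMultiplier S a) (φ : TorusDistribution) (x : Torus) :
    (field a φ x : ℂ) = ∑ k ∈ S, (a k : ℂ) * coeff φ k * mode k x := by
  rw [← ha.tsum_eq, field, ← Complex.conj_eq_iff_re, Complex.conj_tsum,
    ← (Equiv.neg (Fin 2 → ℤ)).tsum_eq]
  refine tsum_congr fun k => ?_
  simp only [Equiv.neg_apply, map_mul, Complex.conj_ofReal, ha.even, coeff_neg_freq, mode_neg,
    Complex.conj_conj]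

theorem fieldVar_eq (ha : IsMultiplier S a) :
    fieldVar a = 1 / (4 * Real.pi ^ 2) * ∑ k ∈ S, a k ^ 2 / (1 + ‖freq k‖ ^ 2) := by
  rw [fieldVar, tsum_eq_sum fun k hk => by rw [ha.eq_zero k hk]; simp]

end IsMultiplier

variable {μ : Measure TorusDistribution}

theorem IsMassiveGFF.memLp_pair (hμ : IsMassiveGFF μ) (f : testFunctions) :
    MemLp (fun φ => pair φ f) 2 μ := by
  obtain ⟨v, hv⟩ := hμ.gaussian f
  have h := memLp_id_gaussianReal (μ := 0) (v := v) 2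
  rw [← hv] at h
  exact (memLp_map_measure_iff aestronglyMeasurable_id (measurable_pair f).aemeasurable).1 h

theorem IsMassiveGFF.memLp_coeff (hμ : IsMassiveGFF μ) (k : Fin 2 → ℤ) :
    MemLp (fun φ => coeff φ k) 2 μ :=
  (hμ.memLp_pair (modeRe k)).ofReal.sub ((hμ.memLp_pair (modeIm k)).ofReal.const_mul Complex.I)

/-- Exponential moments of pairings; no information on joint laws is needed beyond the Gaussianity of
each pairing, since linear combinations of pairings are pairings. -/
theorem IsMassiveGFF.exp_pair (hμ : IsMassiveGFF μ) (f : testFunctions) :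
    Integrable (fun φ => Real.exp (pair φ f)) μ ∧
      ∫ φ, Real.exp (pair φ f) ∂μ = Real.exp ((∫ φ, pair φ f ^ 2 ∂μ) / 2) := by
  obtain ⟨v, hv⟩ := hμ.gaussian f
  have hm := measurable_pair f
  have h1 : ∫ φ, pair φ f ^ 2 ∂μ = v := by
    have h2 := variance_id_gaussianReal (μ := 0) (v := v)
    rw [variance_eq_integral measurable_id.aemeasurable] at h2
    simp only [id, integral_id_gaussianReal, sub_zero] at h2
    rw [← hv, integral_map hm.aemeasurable (by fun_prop)] at h2
    exact h2
  constructor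
  · have h2 := integrable_exp_mul_gaussianReal (μ := 0) (v := v) 1
    rw [← hv, integrable_map_measure (by fun_prop) hm.aemeasurable] at h2
    simpa [Function.comp_def] using h2
  · have h2 := mgf_gaussianReal hv 1
    simpa [mgf, h1] using h2

theorem IsMassiveGFF.ofReal_integral_field_mul_field (hμ : IsMassiveGFF μ)
    {S : Finset (Fin 2 → ℤ)} {a b : (Fin 2 → ℤ) → ℝ} (ha : IsMultiplier S a)
    (hb : IsMultiplier S b) (x y : Torus) :
    ((∫ φ, field a φ x * field b φ y ∂μ : ℝ) : ℂ) =
      (4 * (Real.pi : ℂ) ^ 2)⁻¹ * cov S (fun k => a k * b k) (x - y) := by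
  have hint : ∀ k l, Integrable (fun φ => coeff φ k * (starRingEnd ℂ) (coeff φ l)) μ := fun k l =>
    (hμ.memLp_coeff k).integrable_mul (hμ.memLp_coeff l).star
  have h1 : ∀ φ, ((field a φ x * field b φ y : ℝ) : ℂ) = ∑ k ∈ S, ∑ l ∈ S,
      ((a k : ℂ) * b l * mode k x * (starRingEnd ℂ) (mode l y)) *
        (coeff φ k * (starRingEnd ℂ) (coeff φ l)) := by
    intro φ
    have h2 : (field b φ y : ℂ) = (starRingEnd ℂ) (field b φ y : ℂ) := by simp
    rw [Complex.ofReal_mul, h2, ha.ofReal_field, hb.ofReal_field, map_sum, Finset.sum_mul_sum]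
    refine Finset.sum_congr rfl fun k _ => Finset.sum_congr rfl fun l _ => ?_
    simp only [map_mul, Complex.conj_ofReal]
    ring
  rw [← integral_complex_ofReal]
  simp only [h1]
  rw [integral_finsetSum _ fun k _ => integrable_finsetSum _ fun l _ => (hint k l).const_mul _,
    cov, Finset.mul_sum]
  refine Finset.sum_congr rfl fun k hk => ?_
  rw [integral_finsetSum _ fun l _ => (hint k l).const_mul _]
  simp only [integral_const_mul, hμ.covariance, mul_ite, mul_zero]
  rw [Finset.sum_ite_eq, if_pos hk, char_apply_sub, mode_eq, mode_eq, map_mul]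
  have hpi : (Real.pi : ℂ) ≠ 0 := by exact_mod_cast Real.pi_ne_zero
  simp only [map_inv₀, map_mul, Complex.conj_ofReal, map_ofNat]
  push_cast
  field_simp
  ring

theorem IsMassiveGFF.integral_field_sq (hμ : IsMassiveGFF μ)
    {S : Finset (Fin 2 → ℤ)} {a : (Fin 2 → ℤ) → ℝ} (ha : IsMultiplier S a) (x : Torus) :
    ∫ φ, field a φ x * field a φ x ∂μ = fieldVar a := by
  have h := hμ.ofReal_integral_field_mul_field ha ha x x
  rw [sub_self] at h
  have h1 : ∀ k, char k 0 = 1 := fun k => by simp [char]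
  simp only [cov, h1, mul_one] at h
  rw [ha.fieldVar_eq]
  rw [← Complex.ofReal_inj, h]
  push_cast
  simp only [sq, div_eq_mul_inv, one_mul]

/-- The two-point function of Wick exponentials. -/
theorem IsMassiveGFF.wick_mul_wick (hμ : IsMassiveGFF μ) (α : ℝ)
    {S : Finset (Fin 2 → ℤ)} {a b : (Fin 2 → ℤ) → ℝ} (ha : IsMultiplier S a)
    (hb : IsMultiplier S b) (x y : Torus) :
    Integrable (fun φ => wick α a φ x * wick α b φ y) μ ∧
      ((∫ φ, wick α a φ x * wick α b φ y ∂μ : ℝ) : ℂ) =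
        Complex.exp ((α ^ 2 / (4 * Real.pi ^ 2) : ℝ) * cov S (fun k => a k * b k) (x - y)) := by
  set f := α • (fieldTest S a x + fieldTest S b y) with hf
  have hpair : ∀ φ, pair φ f = α * (field a φ x + field b φ y) := fun φ => by
    rw [hf, pair_smul, pair_add, ha.field_eq_pair, hb.field_eq_pair]
  obtain ⟨h1, h2⟩ := hμ.exp_pair f
  have h3 : ∀ φ, wick α a φ x * wick α b φ y =
      Real.exp (-(α ^ 2 / 2 * (fieldVar a + fieldVar b))) * Real.exp (pair φ f) := fun φ => by
    rw [wick, wick, hpair, ← Real.exp_add, ← Real.exp_add]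
    congr 1
    ring
  have hL : ∀ {c : (Fin 2 → ℤ) → ℝ}, IsMultiplier S c → ∀ z, MemLp (fun φ => field c φ z) 2 μ :=
    fun {c} hc z => by
      simpa only [hc.field_eq_pair] using hμ.memLp_pair (fieldTest S c z)
  have iaa := (hL ha x).integrable_mul (hL ha x)
  have iab := (hL ha x).integrable_mul (hL hb y)
  have ibb := (hL hb y).integrable_mul (hL hb y)
  have h4 : ∫ φ, pair φ f ^ 2 ∂μ =
      α ^ 2 * (fieldVar a + 2 * (∫ φ, field a φ x * field b φ y ∂μ) + fieldVar b) := by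
    rw [← hμ.integral_field_sq ha x, ← hμ.integral_field_sq hb y, ← integral_const_mul,
      ← integral_add (by exact iaa) (by exact iab.const_mul 2),
      ← integral_add (by exact iaa.add (iab.const_mul 2)) (by exact ibb), ← integral_const_mul]
    refine integral_congr_ae (Eventually.of_forall fun φ => ?_)
    simp only [hpair]
    ring
  simp only [h3]
  refine ⟨h1.const_mul _, ?_⟩
  rw [integral_const_mul, h2, h4, ← Real.exp_add, Complex.ofReal_exp]
  congr 1
  have h5 := hμ.ofReal_integral_field_mul_field ha hb x y
  rw [show ((α ^ 2 / (4 * Real.pi ^ 2) : ℝ) : ℂ) * cov S (fun k => a k * b k) (x - y) =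
    ((α ^ 2 : ℝ) : ℂ) * ((4 * (Real.pi : ℂ) ^ 2)⁻¹ * cov S (fun k => a k * b k) (x - y)) by
      push_cast; ring, ← h5]
  push_cast
  ring

theorem continuous_cov (S : Finset (Fin 2 → ℤ)) (p : (Fin 2 → ℤ) → ℝ) : Continuous (cov S p) :=
  continuous_finsetSum _ fun k _ => continuous_const.mul (continuous_char k)

theorem continuous_sobolevKernel (T : Finset (Fin 2 → ℤ)) (β : ℝ) :
    Continuous (sobolevKernel T β) :=
  continuous_finsetSum _ fun k _ => continuous_const.mul (continuous_char k)

theorem integrable_prod_of_continuous {E : Type*} [NormedAddCommGroup E] {f : Torus × Torus → E}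
    (hf : Continuous f) : Integrable f :=
  hf.integrable_of_hasCompactSupport (HasCompactSupport.of_compactSpace _)

theorem IsMassiveGFF.integrable_prod_wick_mul_wick (hμ : IsMassiveGFF μ) (α : ℝ)
    {S : Finset (Fin 2 → ℤ)} {a b : (Fin 2 → ℤ) → ℝ} (ha : IsMultiplier S a)
    (hb : IsMultiplier S b) :
    Integrable (fun p : TorusDistribution × (Torus × Torus) =>
      wick α a p.1 p.2.1 * wick α b p.1 p.2.2) (μ.prod volume) := by
  have := hμ.isProbabilityMeasure
  have hmeas : Measurable (fun p : TorusDistribution × (Torus × Torus) =>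
      wick α a p.1 p.2.1 * wick α b p.1 p.2.2) :=
    (Measurable.wick α a measurable_fst (measurable_fst.comp measurable_snd)).mul
      (Measurable.wick α b measurable_fst (measurable_snd.comp measurable_snd))
  rw [integrable_prod_iff' hmeas.aestronglyMeasurable]
  refine ⟨Eventually.of_forall fun q => (hμ.wick_mul_wick α ha hb q.1 q.2).1, ?_⟩
  have h : (fun q : Torus × Torus => ∫ φ, ‖wick α a φ q.1 * wick α b φ q.2‖ ∂μ) = fun q =>
      (Complex.exp ((α ^ 2 / (4 * Real.pi ^ 2) : ℝ) *
        cov S (fun k => a k * b k) (q.1 - q.2))).re := by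
    funext q
    rw [← (hμ.wick_mul_wick α ha hb q.1 q.2).2, Complex.ofReal_re]
    refine integral_congr_ae (Eventually.of_forall fun φ => ?_)
    exact Real.norm_of_nonneg (mul_pos (Real.exp_pos _) (Real.exp_pos _)).le
  rw [h]
  have hc : Continuous fun z : Torus => (Complex.exp ((α ^ 2 / (4 * Real.pi ^ 2) : ℝ) *
        cov S (fun k => a k * b k) z)).re :=
    Complex.continuous_re.comp (Complex.continuous_exp.comp (continuous_const.mul
      (continuous_cov S fun k => a k * b k)))
  exact integrable_prod_of_continuous (hc.comp (continuous_fst.sub continuous_snd))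

/-! ### Second moments of differences of Wick exponentials -/

theorem integral_prod_comp_sub {F : Torus → ℂ} (hF : Continuous F) :
    ∫ q : Torus × Torus, F (q.1 - q.2) = 4 * (Real.pi : ℂ) ^ 2 * ∫ z, F z := by
  have h := integral_prod_symm (μ := (volume : Measure Torus)) (ν := (volume : Measure Torus))
    (fun q : Torus × Torus => F (q.1 - q.2))
    (integrable_prod_of_continuous (hF.comp (continuous_fst.sub continuous_snd)))
  rw [Measure.volume_eq_prod, h]
  have h1 : ∀ y : Torus, ∫ x : Torus, F (x - y) = ∫ z, F z := fun y =>
    integral_sub_right_eq_self F y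
  simp only [h1]
  rw [integral_const, measureReal_torus, Complex.real_smul]
  push_cast
  rfl

theorem norm_fourierCoef_sq (g : Torus → ℝ) (k : Fin 2 → ℤ) :
    ((‖fourierCoef g k‖ ^ 2 : ℝ) : ℂ) =
      ∫ q : Torus × Torus, mode k q.1 * (starRingEnd ℂ) (mode k q.2) * (g q.1 * g q.2 : ℝ) := by
  have h1 : (starRingEnd ℂ) (fourierCoef g k) = ∫ x, (g x : ℂ) * mode k x := by
    rw [fourierCoef, ← integral_conj]
    simp
  rw [Complex.ofReal_pow, ← Complex.conj_mul', h1, fourierCoef, Measure.volume_eq_prod,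
    ← integral_prod_mul]
  refine integral_congr_ae (Eventually.of_forall fun q => ?_)
  simp only
  push_cast
  ring

/-- The second moment of a Fourier coefficient of a difference of Wick exponentials, in terms of
the covariances of the fields. -/
theorem IsMassiveGFF.integral_norm_fourierCoef_wick_sub_sq (hμ : IsMassiveGFF μ) (α : ℝ)
    {S : Finset (Fin 2 → ℤ)} {a b : (Fin 2 → ℤ) → ℝ} (ha : IsMultiplier S a)
    (hb : IsMultiplier S b) (k : Fin 2 → ℤ) :
    Integrable (fun φ => ‖fourierCoef (fun x => wick α a φ x - wick α b φ x) k‖ ^ 2) μ ∧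
    ((∫ φ, ‖fourierCoef (fun x => wick α a φ x - wick α b φ x) k‖ ^ 2 ∂μ : ℝ) : ℂ) =
      ∫ z, char k z * ((Complex.exp ((α ^ 2 / (4 * Real.pi ^ 2) : ℝ) * cov S (fun k => a k * a k) z)
          - Complex.exp ((α ^ 2 / (4 * Real.pi ^ 2) : ℝ) * cov S (fun k => a k * b k) z)) +
        (Complex.exp ((α ^ 2 / (4 * Real.pi ^ 2) : ℝ) * cov S (fun k => b k * b k) z)
          - Complex.exp ((α ^ 2 / (4 * Real.pi ^ 2) : ℝ) * cov S (fun k => a k * b k) z))) := by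
  have := hμ.isProbabilityMeasure
  set c : ℝ := α ^ 2 / (4 * Real.pi ^ 2) with hc
  set H : Torus → ℂ := fun z => (Complex.exp (c * cov S (fun k => a k * a k) z)
          - Complex.exp (c * cov S (fun k => a k * b k) z)) +
        (Complex.exp (c * cov S (fun k => b k * b k) z)
          - Complex.exp (c * cov S (fun k => a k * b k) z)) with hH
  have hHc : Continuous H := by
    have h1 := continuous_cov S fun k => a k * a k
    have h2 := continuous_cov S fun k => a k * b k
    have h3 := continuous_cov S fun k => b k * b k
    fun_prop
  let U : TorusDistribution → Torus → ℝ := fun φ x => wick α a φ x - wick α b φ x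
  have hUU : ∀ φ x y, U φ x * U φ y = (wick α a φ x * wick α a φ y - wick α a φ x * wick α b φ y) +
      (wick α b φ x * wick α b φ y - wick α b φ x * wick α a φ y) := fun φ x y => by
    simp only [U]
    ring
  have hUint : Integrable (fun p : TorusDistribution × (Torus × Torus) =>
      U p.1 p.2.1 * U p.1 p.2.2) (μ.prod volume) := by
    simp only [hUU]
    exact ((hμ.integrable_prod_wick_mul_wick α ha ha).sub
      (hμ.integrable_prod_wick_mul_wick α ha hb)).add
      ((hμ.integrable_prod_wick_mul_wick α hb hb).sub (hμ.integrable_prod_wick_mul_wick α hb ha))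
  have hmc : Continuous fun q : Torus × Torus => mode k q.1 * (starRingEnd ℂ) (mode k q.2) :=
    ((continuous_mode k).comp continuous_fst).mul
      (Complex.continuous_conj.comp ((continuous_mode k).comp continuous_snd))
  have hG : Integrable (fun p : TorusDistribution × (Torus × Torus) =>
      mode k p.2.1 * (starRingEnd ℂ) (mode k p.2.2) * ((U p.1 p.2.1 * U p.1 p.2.2 : ℝ) : ℂ))
      (μ.prod volume) := by
    refine hUint.ofReal.bdd_mul (c := (2 * Real.pi)⁻¹ * (2 * Real.pi)⁻¹)
      (hmc.measurable.comp measurable_snd).aestronglyMeasurable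
      (Eventually.of_forall fun p => le_of_eq ?_)
    rw [norm_mul, RCLike.norm_conj, norm_mode, norm_mode]
  have hsq : ∀ φ, ((‖fourierCoef (U φ) k‖ ^ 2 : ℝ) : ℂ) = ∫ q : Torus × Torus,
      mode k q.1 * (starRingEnd ℂ) (mode k q.2) * ((U φ q.1 * U φ q.2 : ℝ) : ℂ) :=
    fun φ => norm_fourierCoef_sq (U φ) k
  have hint : Integrable (fun φ => ((‖fourierCoef (U φ) k‖ ^ 2 : ℝ) : ℂ)) μ := by
    simp only [hsq]
    exact hG.integral_prod_left
  have hE : ∀ q : Torus × Torus, ∫ φ, mode k q.1 * (starRingEnd ℂ) (mode k q.2) *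
      ((U φ q.1 * U φ q.2 : ℝ) : ℂ) ∂μ =
      (4 * (Real.pi : ℂ) ^ 2)⁻¹ * (char k (q.1 - q.2) * H (q.1 - q.2)) := by
    intro q
    have iaa := hμ.wick_mul_wick α ha ha q.1 q.2
    have iab := hμ.wick_mul_wick α ha hb q.1 q.2
    have iba := hμ.wick_mul_wick α hb ha q.1 q.2
    have ibb := hμ.wick_mul_wick α hb hb q.1 q.2
    have h1 : ((∫ φ, U φ q.1 * U φ q.2 ∂μ : ℝ) : ℂ) = H (q.1 - q.2) := by
      simp only [hUU]
      rw [integral_add (by exact iaa.1.sub iab.1) (by exact ibb.1.sub iba.1),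
        integral_sub iaa.1 iab.1,
        integral_sub ibb.1 iba.1]
      push_cast
      rw [iaa.2, iab.2, iba.2, ibb.2]
      simp only [hH, hc, mul_comm (b _) (a _)]
    rw [integral_const_mul, integral_complex_ofReal, h1, char_apply_sub, mode_eq, mode_eq, map_mul]
    simp only [map_inv₀, map_mul, Complex.conj_ofReal, map_ofNat]
    have hpi : (Real.pi : ℂ) ≠ 0 := by exact_mod_cast Real.pi_ne_zero
    field_simp
    ring
  refine ⟨hint.re, ?_⟩
  change ((∫ φ, ‖fourierCoef (U φ) k‖ ^ 2 ∂μ : ℝ) : ℂ) = ∫ z, char k z * H z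
  rw [← integral_complex_ofReal]
  simp only [hsq]
  rw [integral_integral_swap hG]
  simp only [hE]
  rw [integral_const_mul, integral_prod_comp_sub (F := fun z => char k z * H z)
      ((continuous_char k).mul hHc), ← mul_assoc, inv_mul_cancel₀, one_mul]
  · have hpi : (Real.pi : ℂ) ≠ 0 := by exact_mod_cast Real.pi_ne_zero
    simp [hpi]

/-- Differences of Wick exponentials of trigonometric fields are controlled in `L²(μ; H^{-β})` by
the difference of the multipliers, uniformly in the number of frequencies. -/
theorem IsMassiveGFF.exists_lintegral_sum_wick_sub_le (hμ : IsMassiveGFF μ) {α β δ : ℝ}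
    (hβ : β < 1) (hδ : 0 < δ) (hδβ : 5 * δ ≤ β - α ^ 2 / (4 * Real.pi)) :
    ∃ K : ℝ, 0 ≤ K ∧ ∀ (S T : Finset (Fin 2 → ℤ)) (a b : (Fin 2 → ℤ) → ℝ) (η : ℝ), 0 ≤ η →
      IsMultiplier S a → IsMultiplier S b →
      (∀ k, |a k - b k| ≤ η * (1 + ‖freq k‖ ^ 2) ^ δ) →
      ∫⁻ φ, ∑ k ∈ T, ENNReal.ofReal ((1 + ‖freq k‖ ^ 2) ^ (-β) *
        ‖fourierCoef (fun x => wick α a φ x - wick α b φ x) k‖ ^ 2) ∂μ ≤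
        ENNReal.ofReal (K * η) := by
  have hpi := Real.pi_pos
  set c : ℝ := α ^ 2 / (4 * Real.pi ^ 2) with hc
  have hc0 : 0 ≤ c := by positivity
  have hpc : Real.pi * c = α ^ 2 / (4 * Real.pi) := by rw [hc]; field_simp
  obtain ⟨K, hK0, hK⟩ := exists_norm_integral_exp_cov_sub_le hc0 hβ hδ (by rwa [hpc])
  refine ⟨2 * K, by positivity, fun S T a b η hη ha hb hab => ?_⟩
  have hw : ∀ k : Fin 2 → ℤ, 0 ≤ (1 + ‖freq k‖ ^ 2) ^ (-β) := fun k => by positivity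
  have hmom := fun k => hμ.integral_norm_fourierCoef_wick_sub_sq α ha hb k
  simp only [← hc] at hmom
  have hint : ∀ k ∈ T, Integrable (fun φ => (1 + ‖freq k‖ ^ 2) ^ (-β) *
      ‖fourierCoef (fun x => wick α a φ x - wick α b φ x) k‖ ^ 2) μ := fun k _ =>
    (hmom k).1.const_mul _
  have h0 : ∀ k φ, 0 ≤ (1 + ‖freq k‖ ^ 2) ^ (-β) *
      ‖fourierCoef (fun x => wick α a φ x - wick α b φ x) k‖ ^ 2 := fun k φ =>
    mul_nonneg (hw k) (sq_nonneg _)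
  simp only [← ENNReal.ofReal_sum_of_nonneg fun k _ => h0 k _]
  rw [← ofReal_integral_eq_lintegral_ofReal (integrable_finsetSum _ hint)
    (Eventually.of_forall fun φ => Finset.sum_nonneg fun k _ => h0 k φ)]
  refine ENNReal.ofReal_le_ofReal ?_
  rw [integral_finsetSum _ hint]
  simp only [integral_const_mul]
  set V := ∑ k ∈ T, (1 + ‖freq k‖ ^ 2) ^ (-β) *
    ∫ φ, ‖fourierCoef (fun x => wick α a φ x - wick α b φ x) k‖ ^ 2 ∂μ with hV
  have haa : ∀ k, |a k * a k| ≤ 1 := fun k => by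
    rw [abs_of_nonneg (mul_nonneg (ha.nonneg k) (ha.nonneg k))]
    exact mul_le_one₀ (ha.le_one k) (ha.nonneg k) (ha.le_one k)
  have hab1 : ∀ k, |a k * b k| ≤ 1 := fun k => by
    rw [abs_of_nonneg (mul_nonneg (ha.nonneg k) (hb.nonneg k))]
    exact mul_le_one₀ (ha.le_one k) (hb.nonneg k) (hb.le_one k)
  have hbb : ∀ k, |b k * b k| ≤ 1 := fun k => by
    rw [abs_of_nonneg (mul_nonneg (hb.nonneg k) (hb.nonneg k))]
    exact mul_le_one₀ (hb.le_one k) (hb.nonneg k) (hb.le_one k)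
  have h1 := hK S T (fun k => a k * a k) (fun k => a k * b k) η hη haa hab1 fun k => by
    rw [← mul_sub, abs_mul, abs_of_nonneg (ha.nonneg k)]
    exact (mul_le_of_le_one_left (abs_nonneg _) (ha.le_one k)).trans (hab k)
  have h2 := hK S T (fun k => b k * b k) (fun k => a k * b k) η hη hbb hab1 fun k => by
    rw [← sub_mul, abs_mul, abs_of_nonneg (hb.nonneg k), abs_sub_comm]
    exact (mul_le_of_le_one_right (abs_nonneg _) (hb.le_one k)).trans (hab k)
  have hcs := continuous_sobolevKernel T β
  have hc1 := continuous_cov S fun k => a k * a k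
  have hc2 := continuous_cov S fun k => a k * b k
  have hc3 := continuous_cov S fun k => b k * b k
  have hVC : (V : ℂ) = (∫ z, sobolevKernel T β z * (Complex.exp (c * cov S (fun k => a k * a k) z) -
      Complex.exp (c * cov S (fun k => a k * b k) z))) +
      ∫ z, sobolevKernel T β z * (Complex.exp (c * cov S (fun k => b k * b k) z) -
      Complex.exp (c * cov S (fun k => a k * b k) z)) := by
    rw [← integral_add (integrable_of_continuous (by fun_prop))
      (integrable_of_continuous (by fun_prop)), hV, Complex.ofReal_sum]
    simp only [← mul_add]
    simp only [sobolevKernel, Finset.sum_mul]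
    rw [integral_finsetSum _ fun k _ => integrable_of_continuous (by
      have := continuous_char k
      fun_prop)]
    refine Finset.sum_congr rfl fun k _ => ?_
    rw [Complex.ofReal_mul, (hmom k).2, ← integral_const_mul]
    simp only [mul_assoc]
  calc V ≤ |V| := le_abs_self V
    _ = ‖(V : ℂ)‖ := (Complex.norm_real V).symm
    _ ≤ K * η + K * η := by
      rw [hVC]
      exact (norm_add_le _ _).trans (add_le_add h1 h2)
    _ = 2 * K * η := by ring

/-! ### Sharp truncations, almost sure convergence and Sobolev norms -/

/-- The square box of frequencies of side `2 ^ (L + 1)` around the origin. -/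
def box (L : ℕ) : Finset (Fin 2 → ℤ) := Fintype.piFinset fun _ => Finset.Icc (-2 ^ L) (2 ^ L)

theorem mem_box {L : ℕ} {k : Fin 2 → ℤ} : k ∈ box L ↔ ∀ i, |k i| ≤ 2 ^ L := by
  simp [box, abs_le]

theorem neg_mem_box {L : ℕ} {k : Fin 2 → ℤ} : -k ∈ box L ↔ k ∈ box L := by
  simp [mem_box]

theorem eventually_mem_box (k : Fin 2 → ℤ) : ∀ᶠ L in atTop, k ∈ box L := by
  simp only [mem_box, eventually_all]
  intro i
  filter_upwards [eventually_ge_atTop (k i).natAbs] with L hL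
  have h : ((k i).natAbs : ℤ) < 2 ^ L := by
    exact_mod_cast (hL.trans_lt Nat.lt_two_pow_self)
  rw [Int.abs_eq_natAbs]
  exact h.le

theorem two_pow_le_norm_freq {L : ℕ} {k : Fin 2 → ℤ} (hk : k ∉ box L) :
    (2 : ℝ) ^ L ≤ ‖freq k‖ := by
  rw [mem_box] at hk
  push Not at hk
  obtain ⟨i, hi⟩ := hk
  have h1 : ((2 : ℝ)) ^ L ≤ |(k i : ℝ)| := by exact_mod_cast hi.le
  refine h1.trans ?_
  have h2 := PiLp.norm_apply_le (freq k) i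
  simpa [freq] using h2

/-- Restriction of a multiplier to the frequencies in a box. -/
def restrict (a : (Fin 2 → ℤ) → ℝ) (L : ℕ) (k : Fin 2 → ℤ) : ℝ := if k ∈ box L then a k else 0

theorem isMultiplier_restrict {a : (Fin 2 → ℤ) → ℝ} (he : ∀ k, a (-k) = a k) (h0 : ∀ k, 0 ≤ a k)
    (h1 : ∀ k, a k ≤ 1) (L : ℕ) : IsMultiplier (box L) (restrict a L) where
  eq_zero k hk := if_neg hk
  even k := by simp only [restrict, neg_mem_box, he]
  nonneg k := by unfold restrict; split_ifs; exacts [h0 k, le_rfl]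
  le_one k := by unfold restrict; split_ifs; exacts [h1 k, zero_le_one]

theorem IsMultiplier.mono {S S' : Finset (Fin 2 → ℤ)} {a : (Fin 2 → ℤ) → ℝ}
    (ha : IsMultiplier S a) (h : S ⊆ S') : IsMultiplier S' a :=
  ⟨fun k hk => ha.eq_zero k fun h' => hk (h h'), ha.even, ha.nonneg, ha.le_one⟩

theorem fourierCoef_sub {f g : Torus → ℝ} (hf : Continuous f) (hg : Continuous g)
    (k : Fin 2 → ℤ) : fourierCoef (fun x => f x - g x) k = fourierCoef f k - fourierCoef g k := by
  have hm : Continuous fun x => (starRingEnd ℂ) (mode k x) :=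
    Complex.continuous_conj.comp (continuous_mode k)
  rw [fourierCoef, fourierCoef, fourierCoef, ← integral_sub
    (integrable_of_continuous (by fun_prop)) (integrable_of_continuous (by fun_prop))]
  simp [sub_mul]

theorem fourierCoef_neg_freq (g : Torus → ℝ) (k : Fin 2 → ℤ) :
    fourierCoef g (-k) = (starRingEnd ℂ) (fourierCoef g k) := by
  rw [fourierCoef, fourierCoef, ← integral_conj]
  simp [mode_neg]

theorem measurable_fourierCoef_wick (α : ℝ) (a : (Fin 2 → ℤ) → ℝ) (k : Fin 2 → ℤ) :
    Measurable fun φ => fourierCoef (wick α a φ) k := by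
  have h : Measurable (Function.uncurry fun (φ : TorusDistribution) (x : Torus) =>
      (wick α a φ x : ℂ) * (starRingEnd ℂ) (mode k x)) :=
    (Complex.measurable_ofReal.comp (Measurable.wick α a measurable_fst measurable_snd)).mul
      ((Complex.continuous_conj.comp (continuous_mode k)).measurable.comp measurable_snd)
  exact (h.stronglyMeasurable.integral_prod_right).measurable

theorem measurable_wickExpDist (ψ : Plane → ℝ) (α : ℝ) (N : ℕ) :
    Measurable (wickExpDist ψ α N) := by
  classical
  have hw : Measurable (Function.uncurry (wickExp ψ α N)) :=
    Measurable.wick α (cutoffN ψ N) measurable_fst measurable_snd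
  refine measurable_of_pair fun f => ?_
  have h : (fun φ => pair (wickExpDist ψ α N φ) f) = fun φ =>
      if Integrable (wickExp ψ α N φ) then ∫ x, (f : Torus → ℝ) x * wickExp ψ α N φ x else 0 := by
    funext φ
    split_ifs with h
    · exact pair_ofFunction h f
    · rw [wickExpDist, pair, ofFunction, dif_neg h]
      rfl
  rw [h]
  refine Measurable.ite (measurableSet_integrable hw.stronglyMeasurable) ?_ measurable_const
  have h2 : Measurable (Function.uncurry fun (φ : TorusDistribution) (x : Torus) =>
      (f : Torus → ℝ) x * wickExp ψ α N φ x) :=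
    ((continuous_testFunction f).measurable.comp measurable_snd).mul hw
  exact (h2.stronglyMeasurable.integral_prod_right).measurable

section Truncation

variable {a : (Fin 2 → ℤ) → ℝ} {φ : TorusDistribution}

theorem norm_mul_coeff_mul_mode (h0 : ∀ k, 0 ≤ a k) (x : Torus) (k : Fin 2 → ℤ) :
    ‖(a k : ℂ) * coeff φ k * mode k x‖ = a k * ‖coeff φ k‖ * (2 * Real.pi)⁻¹ := by
  rw [norm_mul, norm_mul, norm_mode, Complex.norm_real, Real.norm_of_nonneg (h0 k)]

theorem continuous_wick_of_summable (α : ℝ) (h0 : ∀ k, 0 ≤ a k)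
    (hφ : Summable fun k => a k * ‖coeff φ k‖) : Continuous (wick α a φ) := by
  have h : Continuous (field a φ) := Complex.continuous_re.comp
    (continuous_tsum (fun k => continuous_const.mul (continuous_mode k))
      (hφ.mul_right (2 * Real.pi)⁻¹) fun k x => (norm_mul_coeff_mul_mode h0 x k).le)
  exact Real.continuous_exp.comp ((continuous_const.mul h).sub continuous_const)

theorem abs_field_le (h0 : ∀ k, 0 ≤ a k) (hφ : Summable fun k => a k * ‖coeff φ k‖) (x : Torus) :
    |field a φ x| ≤ (∑' k, a k * ‖coeff φ k‖) * (2 * Real.pi)⁻¹ :=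
  (Complex.abs_re_le_norm _).trans (tsum_of_norm_bounded (hφ.hasSum.mul_right (2 * Real.pi)⁻¹)
    fun k => (norm_mul_coeff_mul_mode h0 x k).le)

theorem restrict_nonneg (h0 : ∀ k, 0 ≤ a k) (L : ℕ) (k : Fin 2 → ℤ) : 0 ≤ restrict a L k := by
  unfold restrict; split_ifs; exacts [h0 k, le_rfl]

theorem restrict_le (h0 : ∀ k, 0 ≤ a k) (L : ℕ) (k : Fin 2 → ℤ) : restrict a L k ≤ a k := by
  unfold restrict; split_ifs; exacts [le_rfl, h0 k]

theorem tendsto_of_restrict {E : Type*} [TopologicalSpace E] (g : ℝ → E) (k : Fin 2 → ℤ) :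
    Tendsto (fun L => g (restrict a L k)) atTop (𝓝 (g (a k))) :=
  tendsto_const_nhds.congr' ((eventually_mem_box k).mono fun _ hL =>
    congrArg g (if_pos hL).symm)

/-- Summable multipliers are approximated by finitely supported ones, for fixed `φ`. -/
theorem tendsto_fourierCoef_wick_restrict (α : ℝ) (h0 : ∀ k, 0 ≤ a k) (h1 : ∀ k, a k ≤ 1)
    (ha : Summable a) (hφ : Summable fun k => a k * ‖coeff φ k‖) (k : Fin 2 → ℤ) :
    Tendsto (fun L => fourierCoef (wick α (restrict a L) φ) k) atTop
      (𝓝 (fourierCoef (wick α a φ) k)) := by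
  have hr0 := restrict_nonneg h0
  have hrs : ∀ L, Summable fun k => restrict a L k * ‖coeff φ k‖ := fun L =>
    Summable.of_nonneg_of_le (fun k => mul_nonneg (hr0 L k) (norm_nonneg _))
      (fun k => mul_le_mul_of_nonneg_right (restrict_le h0 L k) (norm_nonneg _)) hφ
  have hfield : ∀ x, Tendsto (fun L => field (restrict a L) φ x) atTop (𝓝 (field a φ x)) := by
    intro x
    refine (Complex.continuous_re.tendsto _).comp
      (tendsto_tsum_of_dominated_convergence (hφ.mul_right (2 * Real.pi)⁻¹)
        (fun k => tendsto_of_restrict (fun t => (t : ℂ) * coeff φ k * mode k x) k)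
        (Eventually.of_forall fun L k => ?_))
    rw [norm_mul_coeff_mul_mode (hr0 L)]
    exact mul_le_mul_of_nonneg_right
      (mul_le_mul_of_nonneg_right (restrict_le h0 L k) (norm_nonneg _))
      (by have := Real.pi_pos; positivity)
  have hvar : Tendsto (fun L => fieldVar (restrict a L)) atTop (𝓝 (fieldVar a)) := by
    refine Tendsto.const_mul _ (tendsto_tsum_of_dominated_convergence ha
      (fun k => tendsto_of_restrict (fun t => t ^ 2 / (1 + ‖freq k‖ ^ 2)) k)
      (Eventually.of_forall fun L k => ?_))
    have h2 := restrict_le h0 L k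
    have h3 := hr0 L k
    rw [Real.norm_of_nonneg (by positivity)]
    refine (div_le_self (sq_nonneg _) (le_add_of_nonneg_right (sq_nonneg _))).trans ?_
    nlinarith [h1 k]
  have hvar0 : ∀ b : (Fin 2 → ℤ) → ℝ, 0 ≤ fieldVar b := fun b =>
    mul_nonneg (by positivity) (tsum_nonneg fun k => by positivity)
  set M := (∑' k, a k * ‖coeff φ k‖) * (2 * Real.pi)⁻¹ with hM
  refine tendsto_integral_of_dominated_convergence
    (fun _ => Real.exp (|α| * M) * (2 * Real.pi)⁻¹) (fun L => ?_) (integrable_const _)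
    (fun L => Eventually.of_forall fun x => ?_) (Eventually.of_forall fun x => ?_)
  · exact ((Complex.continuous_ofReal.comp (continuous_wick_of_summable α (hr0 L) (hrs L))).mul
      (Complex.continuous_conj.comp (continuous_mode k))).aestronglyMeasurable
  · rw [norm_mul, RCLike.norm_conj, norm_mode, Complex.norm_real,
      Real.norm_of_nonneg (by unfold wick; positivity)]
    refine mul_le_mul_of_nonneg_right ?_ (by have := Real.pi_pos; positivity)
    rw [wick, Real.exp_le_exp]
    have e1 : α * field (restrict a L) φ x ≤ |α| * M := by
      refine (le_abs_self _).trans ?_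
      rw [abs_mul]
      refine mul_le_mul_of_nonneg_left ((abs_field_le (hr0 L) (hrs L) x).trans ?_) (abs_nonneg _)
      refine mul_le_mul_of_nonneg_right ((hrs L).tsum_le_tsum (fun k => ?_) hφ)
        (by have := Real.pi_pos; positivity)
      exact mul_le_mul_of_nonneg_right (restrict_le h0 L k) (norm_nonneg _)
    have e2 : 0 ≤ α ^ 2 / 2 * fieldVar (restrict a L) := mul_nonneg (by positivity) (hvar0 _)
    linarith
  · refine Tendsto.mul_const _ ((Complex.continuous_ofReal.tendsto _).comp
      ((Real.continuous_exp.tendsto _).comp ?_))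
    exact ((hfield x).const_mul α).sub (hvar.const_mul _)

end Truncation

theorem IsMassiveGFF.lintegral_norm_coeff_le (hμ : IsMassiveGFF μ) (k : Fin 2 → ℤ) :
    ∫⁻ φ, ENNReal.ofReal ‖coeff φ k‖ ∂μ ≤ 1 := by
  have := hμ.isProbabilityMeasure
  have h2 := hμ.covariance k k
  rw [if_pos rfl] at h2
  have hL := hμ.memLp_coeff k
  have h3 : ∫ φ, ‖coeff φ k‖ ^ 2 ∂μ = (1 + ‖freq k‖ ^ 2)⁻¹ := by
    rw [← Complex.ofReal_inj, ← h2, ← integral_complex_ofReal]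
    refine integral_congr_ae (Eventually.of_forall fun φ => ?_)
    simp [Complex.mul_conj']
  have h4 : (1 + ‖freq k‖ ^ 2)⁻¹ ≤ 1 :=
    inv_le_one_of_one_le₀ (le_add_of_nonneg_right (sq_nonneg _))
  have h5 : Integrable (fun φ => ‖coeff φ k‖ ^ 2) μ := hL.integrable_norm_pow two_ne_zero
  rw [← ofReal_integral_eq_lintegral_ofReal (hL.integrable one_le_two).norm
    (Eventually.of_forall fun φ => norm_nonneg _), ENNReal.ofReal_le_one]
  have h6 : ∫ φ, ‖coeff φ k‖ ∂μ ≤ ∫ φ, (1 / 2 + 1 / 2 * ‖coeff φ k‖ ^ 2) ∂μ :=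
    integral_mono (hL.integrable one_le_two).norm ((integrable_const _).add (h5.const_mul _))
      fun φ => by simp only; nlinarith [sq_nonneg (‖coeff φ k‖ - 1)]
  rw [integral_add (integrable_const _) (h5.const_mul _), integral_const_mul, h3] at h6
  simp only [integral_const, probReal_univ, one_smul] at h6
  linarith

theorem IsMassiveGFF.ae_summable_mul_norm_coeff (hμ : IsMassiveGFF μ) {a : (Fin 2 → ℤ) → ℝ}
    (h0 : ∀ k, 0 ≤ a k) (ha : Summable a) :
    ∀ᵐ φ ∂μ, Summable fun k => a k * ‖coeff φ k‖ := by
  have hm : ∀ k, Measurable fun φ => ENNReal.ofReal (a k * ‖coeff φ k‖) := fun k =>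
    ((measurable_coeff k).norm.const_mul _).ennreal_ofReal
  have h1 : ∫⁻ φ, ∑' k, ENNReal.ofReal (a k * ‖coeff φ k‖) ∂μ ≠ ⊤ := by
    rw [lintegral_tsum fun k => (hm k).aemeasurable]
    refine ne_top_of_le_ne_top ha.tsum_ofReal_ne_top (ENNReal.tsum_le_tsum fun k => ?_)
    simp only [ENNReal.ofReal_mul (h0 k)]
    rw [lintegral_const_mul _ (measurable_coeff k).norm.ennreal_ofReal]
    exact mul_le_of_le_one_right' (hμ.lintegral_norm_coeff_le k)
  filter_upwards [ae_lt_top (Measurable.tsum hm) h1] with φ hφ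
  refine (ENNReal.summable_toReal hφ.ne).congr fun k => ?_
  rw [ENNReal.toReal_ofReal (mul_nonneg (h0 k) (norm_nonneg _))]

/-- Geometric decay of the second moments of the increments implies almost sure convergence. -/
theorem ae_exists_tendsto_of_lintegral_sq_le {Ω : Type*} [MeasurableSpace Ω] {P : Measure Ω}
    [IsProbabilityMeasure P] {f : ℕ → Ω → ℂ} (hf : ∀ n, Measurable (f n)) {K r : ℝ} (hK : 0 ≤ K)
    (hr0 : 0 < r) (hr1 : r < 1)
    (h : ∀ n, ∫⁻ y, ENNReal.ofReal (‖f (n + 1) y - f n y‖ ^ 2) ∂P ≤ ENNReal.ofReal (K * r ^ n)) :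
    ∀ᵐ y ∂P, ∃ l, Tendsto (fun n => f n y) atTop (𝓝 l) := by
  -- the mean absolute increments decay like `√r ^ n`, by weighting the two sides of
  -- `t ≤ √r ^ n + √r ^ (-n) t²`
  set s := √r with hs
  have hs0 : 0 < s := Real.sqrt_pos.2 hr0
  have hs1 : s < 1 := by rw [hs, Real.sqrt_lt' one_pos]; simpa using hr1
  have hsr : r = s * s := (Real.mul_self_sqrt hr0.le).symm
  have hm : ∀ n, Measurable fun y => ENNReal.ofReal ‖f (n + 1) y - f n y‖ := fun n =>
    ((hf _).sub (hf _)).norm.ennreal_ofReal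
  have h1 : ∀ n, ∫⁻ y, ENNReal.ofReal ‖f (n + 1) y - f n y‖ ∂P ≤
      ENNReal.ofReal ((1 + K) * s ^ n) := by
    intro n
    have hsn : 0 < s ^ n := pow_pos hs0 n
    calc ∫⁻ y, ENNReal.ofReal ‖f (n + 1) y - f n y‖ ∂P
        ≤ ∫⁻ y, (ENNReal.ofReal (s ^ n) +
          ENNReal.ofReal ((s ^ n)⁻¹) * ENNReal.ofReal (‖f (n + 1) y - f n y‖ ^ 2)) ∂P := by
          refine lintegral_mono fun y => ?_
          rw [← ENNReal.ofReal_mul (by positivity), ← ENNReal.ofReal_add (by positivity)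
            (by positivity)]
          refine ENNReal.ofReal_le_ofReal ?_
          set t := ‖f (n + 1) y - f n y‖
          have ht : 0 ≤ (t - s ^ n) ^ 2 := sq_nonneg _
          have ht0 : 0 ≤ t := norm_nonneg _
          have h2 : s ^ n + (s ^ n)⁻¹ * t ^ 2 - t = (s ^ n)⁻¹ * ((t - s ^ n) ^ 2 + t * s ^ n) := by
            field_simp
            ring
          have h3 : 0 ≤ (s ^ n)⁻¹ * ((t - s ^ n) ^ 2 + t * s ^ n) := by positivity
          linarith
      _ = ENNReal.ofReal (s ^ n) + ENNReal.ofReal ((s ^ n)⁻¹) *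
          ∫⁻ y, ENNReal.ofReal (‖f (n + 1) y - f n y‖ ^ 2) ∂P := by
          rw [lintegral_add_left measurable_const, lintegral_const, measure_univ, mul_one,
            lintegral_const_mul _ (by exact (((hf _).sub (hf _)).norm.pow_const 2).ennreal_ofReal)]
      _ ≤ ENNReal.ofReal (s ^ n) + ENNReal.ofReal ((s ^ n)⁻¹) * ENNReal.ofReal (K * r ^ n) := by
          gcongr
          exact h n
      _ = ENNReal.ofReal ((1 + K) * s ^ n) := by
          rw [← ENNReal.ofReal_mul (by positivity), ← ENNReal.ofReal_add (by positivity)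
            (by positivity), hsr, mul_pow]
          congr 1
          field_simp
  have h2 : ∫⁻ y, ∑' n, ENNReal.ofReal ‖f (n + 1) y - f n y‖ ∂P ≠ ⊤ := by
    rw [lintegral_tsum fun n => (hm n).aemeasurable]
    exact ne_top_of_le_ne_top ((summable_geometric_of_lt_one hs0.le hs1).mul_left
      (1 + K)).tsum_ofReal_ne_top (ENNReal.tsum_le_tsum h1)
  filter_upwards [ae_lt_top (Measurable.tsum hm) h2] with y hy
  refine cauchySeq_tendsto_of_complete (cauchySeq_of_summable_dist ?_)
  refine (ENNReal.summable_toReal hy.ne).congr fun n => ?_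
  rw [ENNReal.toReal_ofReal (norm_nonneg _), dist_comm, dist_eq_norm]

/-- Fatou's lemma for weighted `ℓ²` norms. -/
theorem lintegral_tsum_norm_sq_le_of_tendsto {Ω ι : Type*} [Countable ι] [MeasurableSpace Ω]
    {P : Measure Ω} {w : ι → ℝ} {f : ℕ → Ω → ι → ℂ} {g : Ω → ι → ℂ}
    (hf : ∀ n i, Measurable fun y => f n y i) (hg : ∀ i, Measurable fun y => g y i)
    (hfg : ∀ᵐ y ∂P, ∀ i, Tendsto (fun n => f n y i) atTop (𝓝 (g y i))) {B : ℝ≥0∞}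
    (h : ∀ (T : Finset ι) n, ∫⁻ y, ∑ i ∈ T, ENNReal.ofReal (w i * ‖f n y i‖ ^ 2) ∂P ≤ B) :
    ∫⁻ y, ∑' i, ENNReal.ofReal (w i * ‖g y i‖ ^ 2) ∂P ≤ B := by
  rw [lintegral_tsum fun i => (((hg i).norm.pow_const 2).const_mul _).ennreal_ofReal.aemeasurable,
    ENNReal.tsum_eq_iSup_sum]
  refine iSup_le fun T => ?_
  rw [← lintegral_finsetSum _ fun i _ => (((hg i).norm.pow_const 2).const_mul _).ennreal_ofReal]
  have h1 : ∫⁻ y, ∑ i ∈ T, ENNReal.ofReal (w i * ‖g y i‖ ^ 2) ∂P ≤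
      ∫⁻ y, liminf (fun n => ∑ i ∈ T, ENNReal.ofReal (w i * ‖f n y i‖ ^ 2)) atTop ∂P := by
    refine lintegral_mono_ae ?_
    filter_upwards [hfg] with y hy
    refine le_of_eq (Tendsto.liminf_eq ?_).symm
    exact tendsto_finsetSum _ fun i _ => (ENNReal.continuous_ofReal.tendsto _).comp
      (((hy i).norm.pow 2).const_mul _)
  refine h1.trans ((lintegral_liminf_le fun n => Finset.measurable_sum _ fun i _ =>
    (((hf n i).norm.pow_const 2).const_mul _).ennreal_ofReal).trans ?_)
  exact liminf_le_of_le (by isBoundedDefault) fun b hb => by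
    obtain ⟨n, hn⟩ := hb.exists
    exact hn.trans (h T n)

theorem sobolevNorm_sq (s : ℝ) (u : TorusDistribution) : sobolevNorm s u ^ 2 =
    ∑' k : Fin 2 → ℤ, ENNReal.ofReal ((1 + ‖freq k‖ ^ 2) ^ s * ‖coeff u k‖ ^ 2) := by
  rw [sobolevNorm, ← ENNReal.rpow_natCast, ← ENNReal.rpow_mul]
  norm_num

theorem measurable_sobolevNorm_sub_sq {Ω : Type*} [MeasurableSpace Ω] (s : ℝ)
    {X Y : Ω → TorusDistribution} (hX : Measurable X) (hY : Measurable Y) :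
    Measurable fun y => sobolevNorm s (X y - Y y) ^ 2 := by
  simp only [sobolevNorm_sq, coeff_sub]
  exact Measurable.tsum fun k => (((((measurable_coeff k).comp hX).sub
    ((measurable_coeff k).comp hY)).norm.pow_const 2).const_mul _).ennreal_ofReal

theorem ofReal_mul_norm_add_sq_le {w : ℝ} (hw : 0 ≤ w) (z z' : ℂ) :
    ENNReal.ofReal (w * ‖z + z'‖ ^ 2) ≤
      2 * ENNReal.ofReal (w * ‖z‖ ^ 2) + 2 * ENNReal.ofReal (w * ‖z'‖ ^ 2) := by
  have e : (2 : ℝ≥0∞) = ENNReal.ofReal 2 := by simp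
  rw [e, ← ENNReal.ofReal_mul zero_le_two, ← ENNReal.ofReal_mul zero_le_two,
    ← ENNReal.ofReal_add (by positivity) (by positivity)]
  refine ENNReal.ofReal_le_ofReal ?_
  have h1 := norm_add_le z z'
  have h2 : ‖z + z'‖ ^ 2 ≤ 2 * ‖z‖ ^ 2 + 2 * ‖z'‖ ^ 2 := by
    nlinarith [sq_nonneg (‖z‖ - ‖z'‖), norm_nonneg (z + z')]
  nlinarith

theorem tsum_ofReal_mul_norm_add_sq_le {ι : Type*} {w : ι → ℝ} (hw : ∀ i, 0 ≤ w i)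
    (f g : ι → ℂ) : ∑' i, ENNReal.ofReal (w i * ‖f i + g i‖ ^ 2) ≤
      2 * ∑' i, ENNReal.ofReal (w i * ‖f i‖ ^ 2) + 2 * ∑' i, ENNReal.ofReal (w i * ‖g i‖ ^ 2) := by
  rw [← ENNReal.tsum_mul_left, ← ENNReal.tsum_mul_left, ← ENNReal.tsum_add]
  exact ENNReal.tsum_le_tsum fun i => ofReal_mul_norm_add_sq_le (hw i) _ _

theorem sobolevNorm_sq_le (s : ℝ) (u v : TorusDistribution) :
    sobolevNorm s u ^ 2 ≤ 2 * sobolevNorm s (u - v) ^ 2 + 2 * sobolevNorm s v ^ 2 := by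
  simp only [sobolevNorm_sq]
  refine le_trans (le_of_eq ?_) (tsum_ofReal_mul_norm_add_sq_le (fun k => by positivity) _ _)
  simp [coeff_sub]

theorem memSobolev_iff (s : ℝ) (u : TorusDistribution) :
    MemSobolev s u ↔ sobolevNorm s u ^ 2 < ⊤ := by
  rw [MemSobolev, ENNReal.pow_lt_top_iff]
  simp

/-! ### Cut-offs and construction of the limit -/

theorem summable_one_add_norm_freq_sq_rpow {s : ℝ} (hs : 1 < s) :
    Summable fun k : Fin 2 → ℤ => (1 + ‖freq k‖ ^ 2) ^ (-s) := by
  have h1 := EisensteinSeries.summable_one_div_norm_rpow (k := 2 * s) (by linarith)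
  refine Summable.of_nonneg_of_le (fun k => by positivity) (fun k => ?_)
    (h1.add (hasSum_ite_eq 0 (1 : ℝ)).summable)
  split_ifs with hk
  · have h2 : 0 ≤ 1 / ‖k‖ ^ (2 * s) := by positivity
    have h3 : (1 + ‖freq k‖ ^ 2) ^ (-s) ≤ 1 := Real.rpow_le_one_of_one_le_of_nonpos
      (le_add_of_nonneg_right (sq_nonneg _)) (by linarith)
    simpa only [Real.rpow_neg (norm_nonneg k), one_div] using h3.trans (le_add_of_nonneg_left h2)
  · have h2 : ‖k‖ ≤ ‖freq k‖ := by
      refine (pi_norm_le_iff_of_nonneg (norm_nonneg _)).2 fun i => ?_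
      have h3 := PiLp.norm_apply_le (freq k) i
      simpa [freq, Int.norm_eq_abs] using h3
    have h3 : 0 < ‖k‖ := norm_pos_iff.2 hk
    rw [add_zero, show -(2 * s) = 2 * -s by ring, Real.rpow_mul h3.le, Real.rpow_two]
    exact Real.rpow_le_rpow_of_nonpos (by positivity) (by nlinarith) (by linarith)

theorem norm_rpow_le_one_add_rpow (k : Fin 2 → ℤ) {δ : ℝ} (hδ : 0 ≤ δ) :
    ‖freq k‖ ^ (2 * δ) ≤ (1 + ‖freq k‖ ^ 2) ^ δ := by
  rw [Real.rpow_mul (norm_nonneg _), Real.rpow_two]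
  exact Real.rpow_le_rpow (by positivity) (by linarith) hδ

theorem inv_two_pow_mul_rpow_le (N : ℕ) (k : Fin 2 → ℤ) {δ : ℝ} (hδ : 0 ≤ δ) :
    (((2 : ℝ) ^ N)⁻¹ * ‖freq k‖) ^ (2 * δ) ≤
      ((2 : ℝ) ^ (-(2 * δ))) ^ N * (1 + ‖freq k‖ ^ 2) ^ δ := by
  rw [Real.mul_rpow (by positivity) (norm_nonneg _)]
  refine mul_le_mul (le_of_eq ?_) (norm_rpow_le_one_add_rpow k hδ) (by positivity) (by positivity)
  rw [Real.inv_rpow (by positivity), ← Real.rpow_natCast, ← Real.rpow_natCast,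
    ← Real.rpow_mul zero_le_two, ← Real.rpow_mul zero_le_two, ← Real.rpow_neg zero_le_two]
  congr 1
  ring

theorem abs_restrict_sub_one_le (L : ℕ) (k : Fin 2 → ℤ) {δ : ℝ} (hδ : 0 ≤ δ) :
    |restrict (fun _ => 1) L k - 1| ≤ ((2 : ℝ) ^ (-(2 * δ))) ^ L * (1 + ‖freq k‖ ^ 2) ^ δ := by
  unfold restrict
  split_ifs with hk
  · rw [sub_self, abs_zero]
    positivity
  · rw [zero_sub, abs_neg, abs_one]
    refine le_trans ?_ (inv_two_pow_mul_rpow_le L k hδ)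
    refine Real.one_le_rpow ?_ (by positivity)
    rw [inv_mul_eq_div, one_le_div (by positivity)]
    exact two_pow_le_norm_freq hk

theorem abs_restrict_sub_restrict_succ_le (L : ℕ) (k : Fin 2 → ℤ) {δ : ℝ} (hδ : 0 ≤ δ) :
    |restrict (fun _ => 1) (L + 1) k - restrict (fun _ => 1) L k| ≤
      ((2 : ℝ) ^ (-(2 * δ))) ^ L * (1 + ‖freq k‖ ^ 2) ^ δ := by
  refine le_trans ?_ (abs_restrict_sub_one_le L k hδ)
  by_cases hk : k ∈ box L
  · have hk' : k ∈ box (L + 1) := mem_box.2 fun i => (mem_box.1 hk i).trans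
      (pow_le_pow_right₀ one_le_two (Nat.le_succ L))
    simp [restrict, hk, hk']
  · simp only [restrict, hk, if_false]
    split_ifs <;> simp

namespace IsCutoff

variable {ψ : Plane → ℝ}

theorem cutoffN_nonneg (hψ : IsCutoff ψ) (N : ℕ) (k : Fin 2 → ℤ) : 0 ≤ cutoffN ψ N k :=
  (hψ.mem_Icc _).1

theorem cutoffN_le_one (hψ : IsCutoff ψ) (N : ℕ) (k : Fin 2 → ℤ) : cutoffN ψ N k ≤ 1 :=
  (hψ.mem_Icc _).2

theorem cutoffN_neg (hψ : IsCutoff ψ) (N : ℕ) (k : Fin 2 → ℤ) :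
    cutoffN ψ N (-k) = cutoffN ψ N k := by
  have h : freq (-k) = -freq k := by
    ext i
    simp [freq]
  rw [cutoffN, cutoffN, h, smul_neg, ← hψ.even]

theorem norm_dilated_freq (N : ℕ) (k : Fin 2 → ℤ) :
    ‖((2 : ℝ) ^ N)⁻¹ • freq k‖ = ((2 : ℝ) ^ N)⁻¹ * ‖freq k‖ := by
  rw [norm_smul, Real.norm_of_nonneg (by positivity)]

theorem summable_cutoffN (hψ : IsCutoff ψ) (N : ℕ) : Summable (cutoffN ψ N) := by
  obtain ⟨m, hm, C, hC⟩ := hψ.decay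
  have h4 : ∀ x, ‖x‖ ^ 4 * ψ x ≤ max 1 C := by
    intro x
    obtain ⟨h0, h1⟩ := hψ.mem_Icc x
    rcases le_total ‖x‖ 1 with h | h
    · refine le_trans ?_ (le_max_left _ _)
      exact mul_le_one₀ (pow_le_one₀ (norm_nonneg _) h) h0 h1
    · refine le_trans ?_ (le_max_right _ _)
      refine le_trans ?_ (hC x)
      rw [abs_of_nonneg h0, ← Real.rpow_natCast]
      exact mul_le_mul_of_nonneg_right (Real.rpow_le_rpow_of_exponent_le h (by exact_mod_cast hm)) h0
  set D := max 1 C * ((2 : ℝ) ^ N) ^ 4 with hD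
  refine Summable.of_nonneg_of_le (hψ.cutoffN_nonneg N) (fun k => ?_)
    ((summable_one_add_norm_freq_sq_rpow one_lt_two).mul_left (2 + 2 * D))
  have h5 := h4 (((2 : ℝ) ^ N)⁻¹ • freq k)
  rw [norm_dilated_freq, mul_pow, inv_pow, mul_assoc, inv_mul_le_iff₀ (by positivity),
    mul_comm _ (max 1 C), ← hD] at h5
  change ‖freq k‖ ^ 4 * cutoffN ψ N k ≤ D at h5
  have h6 := hψ.cutoffN_le_one N k
  have h7 := hψ.cutoffN_nonneg N k
  rw [Real.rpow_neg (by positivity), ← div_eq_mul_inv, Real.rpow_two, le_div_iff₀ (by positivity)]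
  nlinarith [mul_nonneg h7 (sq_nonneg (‖freq k‖ ^ 2 - 1))]

/-- The behaviour of `ψ` at the origin, of order `θ`, as a comparison with the multiplier `1`. The
exponent `δ` may be chosen small since `|ψ - 1| ≤ 1`. -/
theorem exists_abs_cutoffN_sub_one_le (hψ : IsCutoff ψ) {δ₀ : ℝ} (hδ₀ : 0 < δ₀) :
    ∃ δ : ℝ, 0 < δ ∧ δ ≤ δ₀ ∧ ∃ C : ℝ, 0 ≤ C ∧ ∀ N k,
      |cutoffN ψ N k - 1| ≤ C * ((2 : ℝ) ^ (-(2 * δ))) ^ N * (1 + ‖freq k‖ ^ 2) ^ δ := by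
  obtain ⟨θ, hθ, -, C, hC⟩ := hψ.near_zero
  have hδ : 0 < min δ₀ (θ / 2) := lt_min hδ₀ (by linarith)
  refine ⟨min δ₀ (θ / 2), hδ, min_le_left _ _, max 1 C, by positivity, fun N k => ?_⟩
  set δ := min δ₀ (θ / 2) with hδdef
  have hδθ : 2 * δ ≤ θ := by linarith [min_le_right δ₀ (θ / 2)]
  have key : ∀ x, |ψ x - 1| ≤ max 1 C * ‖x‖ ^ (2 * δ) := by
    intro x
    by_cases hx : x = 0
    · rw [hx, hψ.at_zero, sub_self, abs_zero]
      positivity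
    have hx0 : 0 < ‖x‖ := norm_pos_iff.2 hx
    rcases le_total ‖x‖ 1 with h | h
    · have h1 := hC x hx
      rw [Real.rpow_neg hx0.le, inv_mul_le_iff₀ (by positivity), mul_comm] at h1
      refine h1.trans (mul_le_mul (le_max_right _ _)
        (Real.rpow_le_rpow_of_exponent_ge hx0 h hδθ) (by positivity) (by positivity))
    · obtain ⟨h0, h1⟩ := hψ.mem_Icc x
      have h2 : |ψ x - 1| ≤ 1 := abs_le.2 ⟨by linarith, by linarith⟩
      exact h2.trans (one_le_mul_of_one_le_of_one_le (le_max_left _ _)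
        (Real.one_le_rpow h (by positivity)))
  refine (key _).trans ?_
  rw [norm_dilated_freq, mul_assoc]
  exact mul_le_mul_of_nonneg_left (inv_two_pow_mul_rpow_le N k hδ.le) (by positivity)

end IsCutoff

theorem isMultiplier_zero (S : Finset (Fin 2 → ℤ)) : IsMultiplier S fun _ => 0 :=
  ⟨fun _ _ => rfl, fun _ => rfl, fun _ => le_rfl, fun _ => zero_le_one⟩

theorem isMultiplier_restrict_one (L : ℕ) : IsMultiplier (box L) (restrict (fun _ => 1) L) :=
  isMultiplier_restrict (fun _ => rfl) (fun _ => zero_le_one) (fun _ => le_rfl) L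

theorem tsum_fourierCoef_wick_zero_lt_top (s α : ℝ) (φ : TorusDistribution) :
    ∑' k, ENNReal.ofReal ((1 + ‖freq k‖ ^ 2) ^ s *
      ‖fourierCoef (wick α (fun _ => 0) φ) k‖ ^ 2) < ⊤ := by
  have h1 : wick α (fun _ => 0) φ = fun _ => 1 := by
    funext x
    simp [wick, field, fieldVar]
  have h2 : ∀ k : Fin 2 → ℤ, k ≠ 0 → fourierCoef (fun _ => 1) k = 0 := by
    intro k hk
    have h3 : ∀ x, ((1 : ℝ) : ℂ) * (starRingEnd ℂ) (mode k x) =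
        2 * Real.pi * (mode 0 x * (starRingEnd ℂ) (mode k x)) := by
      intro x
      have hpi : (Real.pi : ℂ) ≠ 0 := by exact_mod_cast Real.pi_ne_zero
      rw [mode_eq 0, char_zero]
      push_cast
      field_simp
    simp only [fourierCoef, h3]
    rw [integral_const_mul, integral_mode_mul_conj_mode, if_neg hk.symm, mul_zero]
  rw [h1, tsum_eq_single 0 fun k hk => by rw [h2 k hk]; simp]
  exact ENNReal.ofReal_lt_top

/-- By the Cauchy-Schwarz inequality, sequences in `H^{-β}` with `β < 1` are coefficients of
distributions. -/
theorem isRealCoeff_of_tsum_lt_top {β : ℝ} (hβ : β < 1) {c : (Fin 2 → ℤ) → ℂ}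
    (hc : ∀ k, c (-k) = (starRingEnd ℂ) (c k))
    (h : ∑' k, ENNReal.ofReal ((1 + ‖freq k‖ ^ 2) ^ (-β) * ‖c k‖ ^ 2) < ⊤) : IsRealCoeff c := by
  refine ⟨hc, ?_⟩
  have h1 : Summable fun k => (1 + ‖freq k‖ ^ 2) ^ (-β) * ‖c k‖ ^ 2 :=
    (ENNReal.summable_toReal h.ne).congr fun k => ENNReal.toReal_ofReal (by positivity)
  refine Summable.of_nonneg_of_le (fun k => by positivity) (fun k => ?_)
    (h1.add (summable_one_add_norm_freq_sq_rpow (s := 2 - β) (by linarith)))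
  set J := 1 + ‖freq k‖ ^ 2 with hJ
  have hJ0 : 0 < J := by positivity
  set l := J ^ (-β) with hl
  have hl0 : 0 < l := by positivity
  have h2 : J ^ (-(2 - β)) = J⁻¹ ^ 2 / l := by
    rw [hl, show -(2 - β) = -2 - -β by ring, Real.rpow_sub hJ0, Real.rpow_neg hJ0.le, Real.rpow_two,
      inv_pow]
  have h3 : l * ‖c k‖ ^ 2 + J⁻¹ ^ 2 / l - ‖c k‖ * J⁻¹ =
      ((l * ‖c k‖ - J⁻¹) ^ 2 + l * (‖c k‖ * J⁻¹)) / l := by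
    field_simp
    ring
  have h4 : 0 ≤ ((l * ‖c k‖ - J⁻¹) ^ 2 + l * (‖c k‖ * J⁻¹)) / l := by positivity
  rw [h2]
  linarith

/-- The Wick exponential as the almost sure limit of its Fourier coefficients along sharp
cut-offs. -/
theorem IsMassiveGFF.exists_wick_limit (hμ : IsMassiveGFF μ) {α β δ : ℝ}
    (hβ : β < 1) (hδ : 0 < δ) (hδβ : 5 * δ ≤ β - α ^ 2 / (4 * Real.pi)) :
    ∃ X : TorusDistribution → TorusDistribution, Measurable X ∧
      (∀ᵐ φ ∂μ, ∀ k, Tendsto (fun L => fourierCoef (wick α (restrict (fun _ => 1) L) φ) k) atTop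
        (𝓝 (coeff (X φ) k))) ∧
      ∫⁻ φ, sobolevNorm (-β) (X φ) ^ 2 ∂μ < ⊤ := by
  have := hμ.isProbabilityMeasure
  obtain ⟨K, hK0, hK⟩ := hμ.exists_lintegral_sum_wick_sub_le hβ hδ hδβ
  set W : ℕ → TorusDistribution → (Fin 2 → ℤ) → ℂ := fun L φ k =>
    fourierCoef (wick α (restrict (fun _ => 1) L) φ) k with hW
  have hWm : ∀ L k, Measurable fun φ => W L φ k := fun L k => measurable_fourierCoef_wick α _ k
  have hWc : ∀ L φ, Continuous (wick α (restrict (fun _ => 1) L) φ) := fun L φ =>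
    (isMultiplier_restrict_one L).continuous_wick α φ
  have hlim : ∀ k, ∀ᵐ φ ∂μ, ∃ l, Tendsto (fun L => W L φ k) atTop (𝓝 l) := by
    intro k
    have hw : 0 < (1 + ‖freq k‖ ^ 2) ^ (-β) := by positivity
    refine ae_exists_tendsto_of_lintegral_sq_le (fun L => hWm L k)
      (K := ((1 + ‖freq k‖ ^ 2) ^ (-β))⁻¹ * K) (r := (2 : ℝ) ^ (-(2 * δ))) (by positivity)
      (by positivity) (Real.rpow_lt_one_of_one_lt_of_neg one_lt_two (by linarith)) fun L => ?_
    have hsub : box L ⊆ box (L + 1) := fun j hj => mem_box.2 fun i => (mem_box.1 hj i).trans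
      (pow_le_pow_right₀ one_le_two (Nat.le_succ L))
    have h1 := hK (box (L + 1)) {k} _ _ (((2 : ℝ) ^ (-(2 * δ))) ^ L) (by positivity)
      (isMultiplier_restrict_one (L + 1)) ((isMultiplier_restrict_one L).mono hsub)
      fun k => abs_restrict_sub_restrict_succ_le L k hδ.le
    simp only [Finset.sum_singleton, fourierCoef_sub (hWc _ _) (hWc _ _)] at h1
    have h2 : ∀ φ, ENNReal.ofReal (‖W (L + 1) φ k - W L φ k‖ ^ 2) =
        ENNReal.ofReal (((1 + ‖freq k‖ ^ 2) ^ (-β))⁻¹) * ENNReal.ofReal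
          ((1 + ‖freq k‖ ^ 2) ^ (-β) * ‖W (L + 1) φ k - W L φ k‖ ^ 2) := by
      intro φ
      rw [← ENNReal.ofReal_mul (by positivity), inv_mul_cancel_left₀ hw.ne']
    simp only [h2]
    rw [lintegral_const_mul _ (by exact
      ((((hWm _ _).sub (hWm _ _)).norm.pow_const 2).const_mul _).ennreal_ofReal), mul_assoc,
      ENNReal.ofReal_mul (by positivity)]
    gcongr
  choose c hcm hc using fun k =>
    measurable_limit_of_tendsto_metrizable_ae (fun L => (hWm L k).aemeasurable) (hlim k)
  have hcall : ∀ᵐ φ ∂μ, ∀ k, Tendsto (fun L => W L φ k) atTop (𝓝 (c k φ)) := ae_all_iff.2 hc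
  have hfin : ∫⁻ φ, ∑' k, ENNReal.ofReal ((1 + ‖freq k‖ ^ 2) ^ (-β) * ‖c k φ‖ ^ 2) ∂μ < ⊤ := by
    -- comparison with the multiplier `0`, whose Wick exponential is the constant `1`
    set W0 : TorusDistribution → (Fin 2 → ℤ) → ℂ := fun φ k =>
      fourierCoef (wick α (fun _ => 0) φ) k with hW0
    have hW0m : ∀ k, Measurable fun φ => W0 φ k := fun k => measurable_fourierCoef_wick α _ k
    have hW0c : ∀ φ, Continuous (wick α (fun _ => 0) φ) := fun φ =>
      (isMultiplier_zero ∅).continuous_wick α φ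
    have h1 : ∫⁻ φ, ∑' k, ENNReal.ofReal ((1 + ‖freq k‖ ^ 2) ^ (-β) * ‖c k φ - W0 φ k‖ ^ 2) ∂μ ≤
        ENNReal.ofReal (K * 1) := by
      refine lintegral_tsum_norm_sq_le_of_tendsto (f := fun L φ k => W L φ k - W0 φ k)
        (fun L k => (hWm L k).sub (hW0m k)) (fun k => (hcm k).sub (hW0m k)) ?_ fun T L => ?_
      · filter_upwards [hcall] with φ hφ k
        exact (hφ k).sub_const _
      · have h2 := hK (box L) T _ _ 1 zero_le_one (isMultiplier_restrict_one L)
          (isMultiplier_zero _) fun k => by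
            have h3 := isMultiplier_restrict_one L
            rw [sub_zero, one_mul, abs_of_nonneg (h3.nonneg k)]
            exact (h3.le_one k).trans
              (Real.one_le_rpow (le_add_of_nonneg_right (sq_nonneg _)) hδ.le)
        simp only [fourierCoef_sub (hWc _ _) (hW0c _)] at h2
        exact h2
    have h2 : ∀ φ, W0 φ = W0 0 := fun φ => by
      have h3 : wick α (fun _ => 0) φ = wick α (fun _ => 0) 0 := by
        funext x
        simp [wick, field]
      simp only [hW0, h3]
    calc ∫⁻ φ, ∑' k, ENNReal.ofReal ((1 + ‖freq k‖ ^ 2) ^ (-β) * ‖c k φ‖ ^ 2) ∂μ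
        ≤ ∫⁻ φ, (2 * ∑' k, ENNReal.ofReal ((1 + ‖freq k‖ ^ 2) ^ (-β) * ‖c k φ - W0 φ k‖ ^ 2) +
          2 * ∑' k, ENNReal.ofReal ((1 + ‖freq k‖ ^ 2) ^ (-β) * ‖W0 0 k‖ ^ 2)) ∂μ := by
          refine lintegral_mono fun φ => le_trans (le_of_eq ?_)
            (tsum_ofReal_mul_norm_add_sq_le (fun k => by positivity) _ _)
          rw [h2 φ]
          simp only [sub_add_cancel]
      _ = 2 * ∫⁻ φ, ∑' k, ENNReal.ofReal ((1 + ‖freq k‖ ^ 2) ^ (-β) * ‖c k φ - W0 φ k‖ ^ 2) ∂μ +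
          2 * ∑' k, ENNReal.ofReal ((1 + ‖freq k‖ ^ 2) ^ (-β) * ‖W0 0 k‖ ^ 2) := by
          rw [lintegral_add_right _ measurable_const, lintegral_const, measure_univ, mul_one,
            lintegral_const_mul _ (by exact Measurable.tsum fun k =>
              ((((hcm k).sub (hW0m k)).norm.pow_const 2).const_mul _).ennreal_ofReal)]
      _ < ⊤ := by
          refine ENNReal.add_lt_top.2 ⟨ENNReal.mul_lt_top (by simp) (h1.trans_lt ?_),
            ENNReal.mul_lt_top (by simp) (tsum_fourierCoef_wick_zero_lt_top _ _ _)⟩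
          exact ENNReal.ofReal_lt_top
  have hmeas : Measurable fun φ => ∑' k, ENNReal.ofReal
      ((1 + ‖freq k‖ ^ 2) ^ (-β) * ‖c k φ‖ ^ 2) :=
    Measurable.tsum fun k => (((hcm k).norm.pow_const 2).const_mul _).ennreal_ofReal
  have hreal : ∀ᵐ φ ∂μ, ∀ k, coeff (ofCoeff fun k => c k φ) k = c k φ := by
    filter_upwards [hcall, ae_lt_top hmeas hfin.ne] with φ hφ hφ2 k
    refine coeff_ofCoeff (isRealCoeff_of_tsum_lt_top hβ (fun k => ?_) hφ2) k
    refine tendsto_nhds_unique (hφ (-k)) ?_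
    have h1 := (Complex.continuous_conj.tendsto _).comp (hφ k)
    refine h1.congr fun L => ?_
    exact (fourierCoef_neg_freq _ k).symm
  refine ⟨fun φ => ofCoeff fun k => c k φ, measurable_ofCoeff hcm, ?_, ?_⟩
  · filter_upwards [hcall, hreal] with φ h1 h2 k
    rw [h2 k]
    exact h1 k
  · refine lt_of_eq_of_lt (lintegral_congr_ae ?_) hfin
    filter_upwards [hreal] with φ h2
    simp only [sobolevNorm_sq, h2]

/-- Quantitative convergence of the approximate Wick exponentials to the limit. -/
theorem IsMassiveGFF.exists_lintegral_wickExpDist_sub_le (hμ : IsMassiveGFF μ) {α β δ₀ : ℝ}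
    (hβ : β < 1) (hδ₀ : 0 < δ₀) (hδβ : 5 * δ₀ ≤ β - α ^ 2 / (4 * Real.pi))
    {X : TorusDistribution → TorusDistribution} (hX : Measurable X)
    (hlim : ∀ᵐ φ ∂μ, ∀ k, Tendsto (fun L => fourierCoef (wick α (restrict (fun _ => 1) L) φ) k)
      atTop (𝓝 (coeff (X φ) k))) {ψ : Plane → ℝ} (hψ : IsCutoff ψ) :
    ∃ K r : ℝ, 0 ≤ K ∧ 0 < r ∧ r < 1 ∧ ∀ N,
      ∫⁻ φ, sobolevNorm (-β) (wickExpDist ψ α N φ - X φ) ^ 2 ∂μ ≤ ENNReal.ofReal (K * r ^ N) := by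
  obtain ⟨δ, hδ, hδδ₀, C, hC0, hC⟩ := hψ.exists_abs_cutoffN_sub_one_le hδ₀
  obtain ⟨K, hK0, hK⟩ := hμ.exists_lintegral_sum_wick_sub_le (α := α) hβ hδ (by linarith)
  refine ⟨K * C, (2 : ℝ) ^ (-(2 * δ)), by positivity, by positivity,
    Real.rpow_lt_one_of_one_lt_of_neg one_lt_two (by linarith), fun N => ?_⟩
  set a := cutoffN ψ N with ha
  have h0 := hψ.cutoffN_nonneg N
  have h1 := hψ.cutoffN_le_one N
  have hr := isMultiplier_restrict (hψ.cutoffN_neg N) h0 h1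
  have hs := hψ.summable_cutoffN N
  have hcoef : ∀ᵐ φ ∂μ, ∀ k, coeff (wickExpDist ψ α N φ - X φ) k =
      fourierCoef (wick α a φ) k - coeff (X φ) k := by
    filter_upwards [hμ.ae_summable_mul_norm_coeff h0 hs] with φ hφ k
    rw [coeff_sub, wickExpDist, wickExp_eq_wick, coeff_ofFunction
      (integrable_of_continuous (continuous_wick_of_summable α h0 hφ))]
  have h2 : ∫⁻ φ, sobolevNorm (-β) (wickExpDist ψ α N φ - X φ) ^ 2 ∂μ =
      ∫⁻ φ, ∑' k, ENNReal.ofReal ((1 + ‖freq k‖ ^ 2) ^ (-β) *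
        ‖fourierCoef (wick α a φ) k - coeff (X φ) k‖ ^ 2) ∂μ := by
    refine lintegral_congr_ae ?_
    filter_upwards [hcoef] with φ hφ
    simp only [sobolevNorm_sq, hφ]
  rw [h2, mul_assoc]
  refine lintegral_tsum_norm_sq_le_of_tendsto
    (f := fun L φ k => fourierCoef (wick α (restrict a L) φ) k -
      fourierCoef (wick α (restrict (fun _ => 1) L) φ) k)
    (fun L k => (measurable_fourierCoef_wick α _ k).sub (measurable_fourierCoef_wick α _ k))
    (fun k => (measurable_fourierCoef_wick α _ k).sub ((measurable_coeff k).comp hX))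
    ?_ fun T L => ?_
  · filter_upwards [hlim, hμ.ae_summable_mul_norm_coeff h0 hs] with φ hφ1 hφ2 k
    exact (tendsto_fourierCoef_wick_restrict α h0 h1 hs hφ2 k).sub (hφ1 k)
  · have h3 := hK (box L) T _ _ (C * ((2 : ℝ) ^ (-(2 * δ))) ^ N) (by positivity) (hr L)
      (isMultiplier_restrict_one L) fun k => by
        refine le_trans ?_ (hC N k)
        unfold restrict
        split_ifs
        · exact le_rfl
        · simp
    simp only [fourierCoef_sub ((hr L).continuous_wick α _)
      ((isMultiplier_restrict_one L).continuous_wick α _)] at h3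
    exact h3

/-! ### Square integrable random variables with values in Sobolev spaces -/

theorem memL2Sobolev_of_lintegral_lt_top {s : ℝ} {X : TorusDistribution → TorusDistribution}
    (hX : Measurable X) (h : ∫⁻ φ, sobolevNorm s (X φ) ^ 2 ∂μ < ⊤) : MemL2Sobolev μ s X := by
  refine ⟨hX.aemeasurable, ?_, h⟩
  have hm : Measurable fun φ => sobolevNorm s (X φ) ^ 2 := by
    simp only [sobolevNorm_sq]
    exact Measurable.tsum fun k =>
      ((((measurable_coeff k).comp hX).norm.pow_const 2).const_mul _).ennreal_ofReal
  filter_upwards [ae_lt_top hm h.ne] with φ hφ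
  exact (memSobolev_iff _ _).2 hφ

theorem MemL2Sobolev.of_sub [IsFiniteMeasure μ] {s : ℝ}
    {X Y : TorusDistribution → TorusDistribution} (hX : Measurable X) (hY : Measurable Y)
    (h : ∫⁻ φ, sobolevNorm s (Y φ - X φ) ^ 2 ∂μ < ⊤)
    (hX2 : ∫⁻ φ, sobolevNorm s (X φ) ^ 2 ∂μ < ⊤) : MemL2Sobolev μ s Y := by
  refine memL2Sobolev_of_lintegral_lt_top hY ?_
  refine (lintegral_mono fun φ => sobolevNorm_sq_le s (Y φ) (X φ)).trans_lt ?_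
  rw [lintegral_add_left ((measurable_sobolevNorm_sub_sq s hY hX).const_mul 2),
    lintegral_const_mul' _ _ (by simp), lintegral_const_mul' _ _ (by simp)]
  exact ENNReal.add_lt_top.2 ⟨ENNReal.mul_lt_top (by simp) h, ENNReal.mul_lt_top (by simp) hX2⟩

theorem tendsto_zero_of_sq {f : ℕ → ℝ≥0∞} (h : Tendsto (fun n => f n ^ 2) atTop (𝓝 0)) :
    Tendsto f atTop (𝓝 0) := by
  have h1 := ((ENNReal.continuous_rpow_const (y := 1 / 2)).tendsto 0).comp h
  rw [ENNReal.zero_rpow_of_pos (by norm_num)] at h1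
  refine h1.congr fun n => ?_
  rw [Function.comp_apply, ← ENNReal.rpow_natCast, ← ENNReal.rpow_mul]
  norm_num

end

end WickGFF

/-! ### Convergence of the Wick exponentials -/

theorem theorem2p2 (α β : ℝ) (hα : |α| < √(4 * Real.pi))
    (hβ : α ^ 2 / (4 * Real.pi) < β ∧ β < 1)
    (μ₀ : Measure TorusDistribution) (hμ₀ : IsMassiveGFF μ₀) :
    ∃ X : TorusDistribution → TorusDistribution,
      MemL2Sobolev μ₀ (-β) X ∧
      ∀ ψ : Plane → ℝ, IsCutoff ψ →
        (∀ᵐ φ ∂μ₀, ∀ N : ℕ, (∀ x, Summable (truncTerm ψ N φ x)) ∧ Integrable (wickExp ψ α N φ)) ∧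
        (∀ᵐ φ ∂μ₀, (∀ N : ℕ, MemSobolev (-β) (wickExpDist ψ α N φ)) ∧
          Tendsto (fun N : ℕ => sobolevNorm (-β) (wickExpDist ψ α N φ - X φ)) atTop (𝓝 0)) ∧
        (∀ N : ℕ, MemL2Sobolev μ₀ (-β) (wickExpDist ψ α N)) ∧
        Tendsto (fun N : ℕ => ∫⁻ φ, sobolevNorm (-β) (wickExpDist ψ α N φ - X φ) ^ 2 ∂μ₀)
          atTop (𝓝 0) := by
  have := hμ₀.isProbabilityMeasure
  -- four losses of `δ` occur in the exponent of the singularity, which has to stay above `-1`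
  have hδ : 0 < (β - α ^ 2 / (4 * Real.pi)) / 5 := by linarith [hβ.1]
  have hδβ : 5 * ((β - α ^ 2 / (4 * Real.pi)) / 5) ≤ β - α ^ 2 / (4 * Real.pi) := by linarith
  obtain ⟨X, hXm, hXlim, hX2⟩ := hμ₀.exists_wick_limit hβ.2 hδ hδβ
  refine ⟨X, memL2Sobolev_of_lintegral_lt_top hXm hX2, fun ψ hψ => ?_⟩
  obtain ⟨K, r, hK0, hr0, hr1, hK⟩ :=
    hμ₀.exists_lintegral_wickExpDist_sub_le hβ.2 hδ hδβ hXm hXlim hψ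
  have hL2 : ∀ N, MemL2Sobolev μ₀ (-β) (wickExpDist ψ α N) := fun N =>
    .of_sub hXm (measurable_wickExpDist ψ α N) ((hK N).trans_lt ENNReal.ofReal_lt_top) hX2
  have hgeo : Summable fun N => K * r ^ N := (summable_geometric_of_lt_one hr0.le hr1).mul_left K
  have hQm : ∀ N, Measurable fun φ => sobolevNorm (-β) (wickExpDist ψ α N φ - X φ) ^ 2 :=
    fun N => measurable_sobolevNorm_sub_sq _ (measurable_wickExpDist ψ α N) hXm
  have hsum : ∫⁻ φ, ∑' N, sobolevNorm (-β) (wickExpDist ψ α N φ - X φ) ^ 2 ∂μ₀ < ⊤ := by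
    rw [lintegral_tsum fun N => (hQm N).aemeasurable]
    refine (ENNReal.tsum_le_tsum hK).trans_lt ?_
    rw [← ENNReal.ofReal_tsum_of_nonneg (fun N => by positivity) hgeo]
    exact ENNReal.ofReal_lt_top
  refine ⟨ae_all_iff.2 fun N => ?_, ?_, hL2, ?_⟩
  · filter_upwards [hμ₀.ae_summable_mul_norm_coeff (hψ.cutoffN_nonneg N) (hψ.summable_cutoffN N)]
      with φ hφ
    refine ⟨fun x => .of_norm ?_, integrable_of_continuous
      (continuous_wick_of_summable α (hψ.cutoffN_nonneg N) hφ)⟩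
    exact (hφ.mul_right (2 * Real.pi)⁻¹).congr fun k =>
      (norm_mul_coeff_mul_mode (hψ.cutoffN_nonneg N) x k).symm
  · filter_upwards [ae_all_iff.2 fun N => (hL2 N).2.1,
      ae_lt_top (Measurable.tsum hQm) hsum.ne] with φ h1 h2
    exact ⟨h1, tendsto_zero_of_sq (ENNReal.tendsto_atTop_zero_of_tsum_ne_top h2.ne)⟩
  · refine tendsto_of_tendsto_of_tendsto_of_le_of_le tendsto_const_nhds ?_ (fun _ => zero_le) hK
    rw [← ENNReal.ofReal_zero]
    exact ENNReal.tendsto_ofReal hgeo.tendsto_atTop_zero
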